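/- Let $r<a<3r$ and $f(t)=a+r\cos(t/r)$, and let $M$ be the standard torus of revolution, i.e. $\mathbb S^1\times[-\pi r,\pi r]$ with the metric $ds^2=dt^2+f(t)^2\,d\theta^2$ ($\theta\in\mathbb S^1=\mathbb R/2\pi\mathbb Z$) and the two boundary circles identified. For a unit speed curve $\gamma=(\theta,t)$, let $\sigma$ be the oriented angle from $\partial_t$ to $\gamma'$, so that $t'=\cos\sigma$ and $\theta'=\sin\sigma/f(t)$, and measure geodesic curvature with respect to the normal $N=\frac{\cos\sigma}{f(t)}\partial_\theta-\sin\sigma\,\partial_t$. An *unduloid type curve* is a $C^2$ unit speed curve of constant geodesic curvature whose $t$-coordinate has a strict local maximum at some $s_0$, with orientation chosen so that $\sin\sigma(s_0)=1$, and for which $\sin\sigma(s_1)=1$ at the next critical point $s_1>s_0$ of the $t$-coordinate. A closed curve winding once in the $\theta$-direction is *stable* if it is a local minimum of length for any variation keeping the enclosed area fixed: for every $C^2$ one-parameter family of closed curves $C_\tau$ with $C_0=C$ and constant signed area $\int_{C_\tau}\big(\int_0^{t}f(x)\,dx\big)\,d\theta$ between $C_\tau$ and the parallel $\mathbb S^1\times\{0\}$,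 one has $L(C)\le L(C_\tau)$ for all $\tau$ close enough to $0$. Then there is $\tilde t\in(0,\pi r)$ with $\big[(f')^2-f f''\big](\tilde t)=1$. Moreover, for every $\tilde t\in[-\pi r,\pi r]$ with $\big[(f')^2-f f''\big](\tilde t)=1$ and every $\varepsilon>0$, there is a closed embedded unduloid type curve in $M$, winding once in the $\theta$-direction, which is stable and along which $|t-\tilde t|<\varepsilon$. -/

import Mathlib

open Real Set Filter Topology

namespace TorusUnduloid

/-- The profile function of the standard torus of revolution: the distance to the axis of the
point at arc length `t` (measured from the outermost point) on a circle of radius `r` whose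
centre is at distance `a` from the axis. -/
noncomputable def profile (a r : ℝ) : ℝ → ℝ := fun t => a + r * Real.cos (t / r)

/-- The torus obtained from `S¹ × [-t₀, t₀]` by identifying `S¹ × {-t₀}` with `S¹ × {t₀}`. -/
abbrev Torus (t₀ : ℝ) : Type := AddCircle (2 * π) × AddCircle (2 * t₀)

/-- The covering map `(θ, t) ↦ [θ, t]` from the plane onto the torus. Curves in the torus are
described by their lifts `s ↦ (θ(s), t(s))` to the plane. -/
noncomputable def toTorus (t₀ : ℝ) (p : ℝ × ℝ) : Torus t₀ := ((p.1 : AddCircle (2 * π)), (p.2 : AddCircle (2 * t₀)))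

/-- The Riemannian metric `dt² + f(t)² dθ²` at the point `p = (θ, t)`; tangent vectors are
written as `(v.1, v.2) = v.1 ∂_θ + v.2 ∂_t`. -/
def metric (f : ℝ → ℝ) (p v w : ℝ × ℝ) : ℝ := f p.2 ^ 2 * (v.1 * w.1) + v.2 * w.2

/-- `γ` is parametrized by arc length. -/
def IsUnitSpeed (f : ℝ → ℝ) (γ : ℝ → ℝ × ℝ) : Prop :=
  ∀ s, metric f (γ s) (deriv γ s) (deriv γ s) = 1

/-- The covariant acceleration of `γ` for the Levi-Civita connection of `dt² + f(t)² dθ²`,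
whose nonzero Christoffel symbols are `Γ^θ_{θt} = Γ^θ_{tθ} = f'/f` and `Γ^t_{θθ} = -f f'`. -/
noncomputable def covariantAccel (f : ℝ → ℝ) (γ : ℝ → ℝ × ℝ) (s : ℝ) : ℝ × ℝ :=
  ((deriv (deriv γ) s).1
      + 2 * (deriv f (γ s).2 / f (γ s).2) * ((deriv γ s).1 * (deriv γ s).2),
    (deriv (deriv γ) s).2 - f (γ s).2 * deriv f (γ s).2 * (deriv γ s).1 ^ 2)

/-- The normal `N = (cos σ / f) ∂_θ - sin σ ∂_t` along a unit speed curve `γ`, where `σ` is the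
oriented angle from `∂_t` to `γ'`, that is, `γ' = cos σ ∂_t + (sin σ / f) ∂_θ`. -/
noncomputable def unitNormal (f : ℝ → ℝ) (γ : ℝ → ℝ × ℝ) (s : ℝ) : ℝ × ℝ :=
  ((deriv γ s).2 / f (γ s).2, -(f (γ s).2 * (deriv γ s).1))

/-- The geodesic curvature, with respect to `unitNormal`, of a unit speed curve. -/
noncomputable def geodesicCurvature (f : ℝ → ℝ) (γ : ℝ → ℝ × ℝ) (s : ℝ) : ℝ :=
  metric f (γ s) (covariantAccel f γ s) (unitNormal f γ s)

/-- `sin σ` for a unit speed curve, where `σ` is the oriented angle from `∂_t` to `γ'`. -/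
noncomputable def sinAngle (f : ℝ → ℝ) (γ : ℝ → ℝ × ℝ) (s : ℝ) : ℝ :=
  f (γ s).2 * (deriv γ s).1

/-- Unduloid type curves: unit speed curves of constant geodesic curvature whose `t`-coordinate
has a strict (local) maximum at some `s₀` and such that, `s₁ > s₀` being the next critical point
of the `t`-coordinate, the tangent vector points in the direction of `∂_θ` both at `s₀`
(a choice of orientation) and at `s₁`. -/
structure IsUnduloidType (f : ℝ → ℝ) (γ : ℝ → ℝ × ℝ) : Prop where
  contDiff : ContDiff ℝ 2 γ
  unitSpeed : IsUnitSpeed f γ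
  constCurvature : ∃ h : ℝ, ∀ s, geodesicCurvature f γ s = h
  maxMin : ∃ s₀ s₁ : ℝ, s₀ < s₁ ∧
    (∀ᶠ s in 𝓝[≠] s₀, (γ s).2 < (γ s₀).2) ∧
    (∀ s ∈ Ioo s₀ s₁, deriv (fun x => (γ x).2) s ≠ 0) ∧
    deriv (fun x => (γ x).2) s₁ = 0 ∧
    sinAngle f γ s₀ = 1 ∧ sinAngle f γ s₁ = 1

/-- The lift `c` closes up after the parameter length `l`, winding once around the torus in the
`θ`-direction. -/
def ClosesUp (l : ℝ) (c : ℝ → ℝ × ℝ) : Prop := ∀ s, c (s + l) = c s + (2 * π, 0)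

/-- The curve in the torus with lift `γ` is closed with period `l` and has no self-intersections.
(It is an immersion as soon as `γ` has unit speed.) -/
structure IsClosedEmbedded (t₀ l : ℝ) (γ : ℝ → ℝ × ℝ) : Prop where
  pos : 0 < l
  closesUp : ClosesUp l γ
  injective : ∀ s s' : ℝ, toTorus t₀ (γ s) = toTorus t₀ (γ s') → ∃ k : ℤ, s' = s + k * l

/-- The length of one period of the closed curve `c`. -/
noncomputable def length (f : ℝ → ℝ) (l : ℝ) (c : ℝ → ℝ × ℝ) : ℝ :=
  ∫ s in (0 : ℝ)..l, √(metric f (c s) (deriv c s) (deriv c s))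

/-- The signed area, for the area element `f(t) dt dθ`, of the region between the longest
parallel `S¹ × {0}` and the closed curve `c`, namely the integral of
`(∫_0^t f(x) dx) dθ` along `c`. -/
noncomputable def enclosedArea (f : ℝ → ℝ) (l : ℝ) (c : ℝ → ℝ × ℝ) : ℝ :=
  ∫ s in (0 : ℝ)..l, (∫ x in (0 : ℝ)..(c s).2, f x) * (deriv c s).1

/-- A variation of the closed curve `γ` through closed curves, keeping the enclosed area fixed. -/
structure IsAreaPreservingVariation (f : ℝ → ℝ) (l : ℝ) (γ : ℝ → ℝ × ℝ)
    (V : ℝ → ℝ → ℝ × ℝ) : Prop where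
  contDiff : ContDiff ℝ 2 (fun p : ℝ × ℝ => V p.1 p.2)
  start : V 0 = γ
  closesUp : ∀ τ, ClosesUp l (V τ)
  area : ∀ᶠ τ in 𝓝 (0 : ℝ), enclosedArea f l (V τ) = enclosedArea f l γ

/-- A closed curve is stable if it is a local minimum of length for any variation keeping the
enclosed area fixed. -/
def IsStable (f : ℝ → ℝ) (l : ℝ) (γ : ℝ → ℝ × ℝ) : Prop :=
  ∀ V : ℝ → ℝ → ℝ × ℝ, IsAreaPreservingVariation f l γ V →
    ∀ᶠ τ in 𝓝 (0 : ℝ), length f l γ ≤ length f l (V τ)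

end TorusUnduloid

namespace TorusUnduloid

/-! In the area coordinate `v = ∫₀ᵗ f`, a curve that is a graph `v = w(θ)` encloses the area `∫ w`
and has length `∫ √(g(w)² + w'²/g(w)²)`, where `g` is `f` expressed in `v`. The area constraint is
thus linear: it fixes the mean of `w`. At a constant `m` half the second variation is `½ ∫ (g''(m)
ξ² + ξ'²/g(m)³)` over `ξ` of mean zero, so the parallel loses stability where `g'' + g⁻³` changes
sign. Since `g'' + g⁻³ = (f f'' - f'² + 1)/f³`, this is the equation of the theorem, and for the
torus it says `cos(t/r) = 0`. There the kernel is spanned by `cos θ` and `sin θ`, and stable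
unduloids bifurcate from the parallel.

The bifurcation is treated by a variational Lyapunov–Schmidt reduction. For a mean `m` near the
critical `m₀` and a small first Fourier coefficient `x`, a contraction
(`exists_loop_of_small_lipschitz`, `exists_isCritical`) gives a loop with these modes solving the
Euler–Lagrange equation up to multipliers in `1, cos, sin`. By Wirtinger's inequality with constant
4 (`wirtinger_second`) it minimizes the length among nearby loops with the same modes
(`energy_le_of_isCritical`). Its length is a function `φ(x)` on a disc.

At `m = m₀` the length is at least `2π g(m₀) + k‖x‖⁴` with `k > 0` (`energy_ge_quartic`): the fourth
order coefficient, after completing the square against the second harmonic, is positive because `a <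
3r` (`quartic_condition`). Now `m` is moved slightly to the side where the parallel is unstable. The
quartic barrier persists on the boundary of the disc, so `φ` has an interior minimum. There the
multipliers of `cos` and `sin` vanish (`multipliers_eq_zero`), and the loop is not constant, since
the parallel can be shortened (`exists_energy_lt_const`). This is `exists_local_minimizer`.

Parametrized by arc length, the loop is a closed embedded curve of constant geodesic curvature. By
uniqueness for the ODE the critical points of its height are nondegenerate, which makes it of
unduloid type. A variation stays a graph close in `C¹` for small parameters, so minimality among
loops is stability (`isStable_graphCurve`). -/

/-! ### Periodic loops and Wirtinger's inequality -/

/-- A `2π`-periodic `C¹` function `w` with derivative `w'`. -/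
structure IsLoop (w w' : ℝ → ℝ) : Prop where
  hasDerivAt : ∀ θ, HasDerivAt w (w' θ) θ
  continuous_deriv : Continuous w'
  periodic : Function.Periodic w (2 * π)

namespace IsLoop

variable {w w' u u' : ℝ → ℝ}

theorem continuous (h : IsLoop w w') : Continuous w :=
  continuous_iff_continuousAt.2 fun θ => (h.hasDerivAt θ).continuousAt

theorem periodic_deriv (h : IsLoop w w') : Function.Periodic w' (2 * π) := by
  intro θ
  have h1 := (h.hasDerivAt (θ + 2 * π)).comp_add_const θ (2 * π)
  have h2 : (fun x => w (x + 2 * π)) = w := funext h.periodic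
  rw [h2] at h1
  exact h1.unique (h.hasDerivAt θ)

theorem add (h : IsLoop w w') (k : IsLoop u u') :
    IsLoop (fun θ => w θ + u θ) (fun θ => w' θ + u' θ) :=
  ⟨fun θ => (h.hasDerivAt θ).add (k.hasDerivAt θ), h.continuous_deriv.add k.continuous_deriv,
    h.periodic.add k.periodic⟩

theorem sub (h : IsLoop w w') (k : IsLoop u u') :
    IsLoop (fun θ => w θ - u θ) (fun θ => w' θ - u' θ) :=
  ⟨fun θ => (h.hasDerivAt θ).sub (k.hasDerivAt θ), h.continuous_deriv.sub k.continuous_deriv,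
    h.periodic.sub k.periodic⟩

theorem const (m : ℝ) : IsLoop (fun _ => m) (fun _ => 0) :=
  ⟨fun θ => hasDerivAt_const θ m, continuous_const, fun _ => rfl⟩

theorem integral_deriv (h : IsLoop w w') : ∫ θ in (0:ℝ)..2 * π, w' θ = 0 := by
  rw [intervalIntegral.integral_eq_sub_of_hasDerivAt (fun θ _ => h.hasDerivAt θ)
    (h.continuous_deriv.intervalIntegrable _ _)]
  have := h.periodic 0
  simp only [zero_add] at this
  rw [this, sub_self]

end IsLoop

/-- Parseval: the coefficients with `|n| ≤ 1` vanish, and differentiation multiplies the others by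
`i n` with `n² ≥ 4`. The gap between 4 and 1 is what makes the length strictly convex transversally
to the first modes. -/
theorem wirtinger_second {ξ ξ' : ℝ → ℝ} (h : IsLoop ξ ξ')
    (h0 : ∫ θ in (0:ℝ)..2 * π, ξ θ = 0) (hc : ∫ θ in (0:ℝ)..2 * π, ξ θ * cos θ = 0)
    (hs : ∫ θ in (0:ℝ)..2 * π, ξ θ * sin θ = 0) :
    4 * ∫ θ in (0:ℝ)..2 * π, ξ θ ^ 2 ≤ ∫ θ in (0:ℝ)..2 * π, ξ' θ ^ 2 := by
  have hπ : (0:ℝ) < 2 * π := by positivity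
  have key : ∀ φ : ℝ → ℝ, Continuous φ →
      HasSum (fun i => ‖fourierCoeffOn hπ (fun θ => (φ θ : ℂ)) i‖ ^ 2)
        ((2 * π)⁻¹ * ∫ θ in (0:ℝ)..2 * π, φ θ ^ 2) := by
    intro φ hφ
    have := hasSum_sq_fourierCoeffOn (f := fun θ => (φ θ : ℂ)) hπ ?_
    · simpa using this
    · have hc : Continuous (fun θ => (φ θ : ℂ)) := by fun_prop
      obtain ⟨C, hC⟩ := (isCompact_Icc (a := (0:ℝ)) (b := 2 * π)).exists_bound_of_continuousOn
        hc.continuousOn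
      refine MeasureTheory.MemLp.of_bound hc.aestronglyMeasurable C ?_
      exact (MeasureTheory.ae_restrict_mem measurableSet_Ioc).mono
        fun θ hθ => hC θ (Ioc_subset_Icc_self hθ)
  have k1 := key ξ h.continuous
  have k2 := key ξ' h.continuous_deriv
  have coef : ∀ n : ℤ, fourierCoeffOn hπ (fun θ => (ξ' θ : ℂ)) n
      = (Complex.I * n) * fourierCoeffOn hπ (fun θ => (ξ θ : ℂ)) n := by
    intro n
    by_cases hn : n = 0
    · subst hn
      rw [fourierCoeffOn_eq_integral]
      have := h.integral_deriv
      simp [intervalIntegral.integral_ofReal, this]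
    · rw [fourierCoeffOn_of_hasDerivAt hπ hn (f := fun θ => (ξ θ : ℂ))
        (f' := fun θ => (ξ' θ : ℂ)) (fun θ _ => (h.hasDerivAt θ).ofReal_comp)
        ((Complex.continuous_ofReal.comp h.continuous_deriv).intervalIntegrable _ _)]
      have := h.periodic 0
      simp only [zero_add] at this
      have hπ' : (π:ℂ) ≠ 0 := by exact_mod_cast pi_ne_zero
      have hn' : (n:ℂ) ≠ 0 := by exact_mod_cast hn
      rw [this]
      simp
      field_simp
      ring_nf
      simp
  have exp_int : ∀ n : ℤ, fourierCoeffOn hπ (fun θ => (ξ θ : ℂ)) n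
      = (2 * π)⁻¹ * ∫ θ in (0:ℝ)..2 * π, ((ξ θ * cos (n * θ) : ℝ) - (ξ θ * sin (n * θ) : ℝ) * Complex.I : ℂ) := by
    intro n
    rw [fourierCoeffOn_eq_integral]
    simp only [sub_zero, one_div, Complex.real_smul]
    push_cast
    congr 1
    refine intervalIntegral.integral_congr fun θ _ => ?_
    simp only [fourier_coe_apply, smul_eq_mul]
    have : (2 * π * Complex.I * ((-n : ℤ) : ℂ) * θ / ((2 * π : ℝ) : ℂ) : ℂ) = -(n * θ : ℂ) * Complex.I := by
      have hπ' : (π:ℂ) ≠ 0 := by exact_mod_cast pi_ne_zero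
      push_cast
      field_simp
    simp only [sub_zero]
    rw [this, Complex.exp_mul_I, Complex.cos_neg, Complex.sin_neg]
    ring
  have hξ := h.continuous
  have zero : ∀ n : ℤ, |n| ≤ 1 → fourierCoeffOn hπ (fun θ => (ξ θ : ℂ)) n = 0 := by
    intro n hn
    rw [exp_int, intervalIntegral.integral_sub (Continuous.intervalIntegrable (by fun_prop) _ _)
      (Continuous.intervalIntegrable (by fun_prop) _ _), intervalIntegral.integral_mul_const,
      intervalIntegral.integral_ofReal, intervalIntegral.integral_ofReal]
    rw [abs_le] at hn
    obtain ⟨h1, h2⟩ := hn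
    interval_cases n <;> simp [h0, hc, hs]
  have le : 4 * ((2 * π)⁻¹ * ∫ θ in (0:ℝ)..2 * π, ξ θ ^ 2)
      ≤ (2 * π)⁻¹ * ∫ θ in (0:ℝ)..2 * π, ξ' θ ^ 2 := by
    refine hasSum_le (fun n => ?_) (k1.mul_left 4) k2
    rw [coef]
    by_cases hn : |n| ≤ 1
    · simp [zero n hn]
    · rw [norm_mul, mul_pow]
      refine mul_le_mul_of_nonneg_right ?_ (by positivity)
      push Not at hn
      have : (4:ℤ) ≤ n ^ 2 := by rw [← sq_abs]; nlinarith
      simp only [norm_mul, Complex.norm_I, one_mul, Complex.norm_intCast, sq_abs]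
      exact_mod_cast this
  have : 0 < (2 * π)⁻¹ := by positivity
  nlinarith

/-! ### The linear equation `z' + i z = k` on the circle -/

theorem integral_sin_period : ∫ θ in (0:ℝ)..2 * π, sin θ = 0 := by simp

theorem integral_cos_period : ∫ θ in (0:ℝ)..2 * π, cos θ = 0 := by simp

theorem integral_cos_sq_period : ∫ θ in (0:ℝ)..2 * π, cos θ ^ 2 = π := by
  rw [integral_cos_sq]; simp

theorem integral_sin_sq_period : ∫ θ in (0:ℝ)..2 * π, sin θ ^ 2 = π := by
  rw [integral_sin_sq]; simp

theorem integral_sin_mul_cos_period : ∫ θ in (0:ℝ)..2 * π, sin θ * cos θ = 0 := by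
  rw [integral_sin_mul_cos₁]; simp

theorem integral_ofReal_add_mul_I {u v : ℝ → ℝ} (hu : Continuous u) (hv : Continuous v) (a b : ℝ) :
    ∫ θ in a..b, ((u θ : ℂ) + (v θ : ℂ) * Complex.I)
      = ((∫ θ in a..b, u θ : ℝ) : ℂ) + ((∫ θ in a..b, v θ : ℝ) : ℂ) * Complex.I := by
  rw [intervalIntegral.integral_add (Continuous.intervalIntegrable (by fun_prop) _ _)
    (Continuous.intervalIntegrable (by fun_prop) _ _), intervalIntegral.integral_mul_const,
    intervalIntegral.integral_ofReal, intervalIntegral.integral_ofReal]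

theorem exp_I_mul (s : ℝ) : Complex.exp (Complex.I * s) = (cos s : ℂ) + (sin s : ℂ) * Complex.I := by
  rw [mul_comm, Complex.exp_mul_I]; push_cast; rfl

theorem exp_neg_I_mul (s : ℝ) :
    Complex.exp (-(Complex.I * s)) = (cos s : ℂ) - (sin s : ℂ) * Complex.I := by
  rw [show -(Complex.I * (s:ℂ)) = (-(s:ℂ)) * Complex.I by ring, Complex.exp_mul_I, Complex.cos_neg,
    Complex.sin_neg]; push_cast; ring

theorem norm_exp_I_mul (s : ℝ) : ‖Complex.exp (Complex.I * s)‖ = 1 := by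
  rw [mul_comm]; exact Complex.norm_exp_ofReal_mul_I s

theorem norm_exp_neg_I_mul (s : ℝ) : ‖Complex.exp (-(Complex.I * s))‖ = 1 := by
  rw [Complex.exp_neg, norm_inv, norm_exp_I_mul, inv_one]

theorem norm_integral_period_le {E : Type*} [NormedAddCommGroup E] [NormedSpace ℝ E] {f : ℝ → E}
    {M : ℝ} (h : ∀ s, ‖f s‖ ≤ M) : ‖∫ s in (0:ℝ)..2 * π, f s‖ ≤ 2 * π * M := by
  have := intervalIntegral.norm_integral_le_of_norm_le_const (a := 0) (b := 2 * π) (f := f)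
    (fun s _ => h s)
  rw [sub_zero, abs_of_pos (by positivity)] at this
  linarith

/-- The obstruction to solving `z' + i z = k` by a `2π`-periodic function. -/
noncomputable def resonance (k : ℝ → ℂ) : ℂ := ∫ s in (0:ℝ)..2 * π, Complex.exp (Complex.I * s) * k s

/-- The combination of `cos` and `sin` which removes the obstruction `resonance k`. -/
noncomputable def multiplier (k : ℝ → ℂ) (s : ℝ) : ℝ :=
  ((resonance k).re * sin s - (resonance k).im * cos s) / π

/-- The right-hand side `k` with its resonant part removed. -/
noncomputable def nonresonant (k : ℝ → ℂ) (s : ℝ) : ℂ := k s + Complex.I * multiplier k s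

/-- The solution of `z' + i z = nonresonant k` with `z(0) = 0`. -/
noncomputable def rawSol (k : ℝ → ℂ) (θ : ℝ) : ℂ :=
  Complex.exp (-(Complex.I * θ)) * ∫ s in (0:ℝ)..θ, Complex.exp (Complex.I * s) * nonresonant k s

/-- The mean value of the real part of `rawSol k`. -/
noncomputable def solMean (k : ℝ → ℂ) : ℝ := (∫ θ in (0:ℝ)..2 * π, (rawSol k θ).re) / (2 * π)

/-- The first Fourier coefficient of the real part of `rawSol k`. -/
noncomputable def solCoef (k : ℝ → ℂ) : ℂ :=
  (∫ θ in (0:ℝ)..2 * π, ((rawSol k θ).re : ℂ) * Complex.exp (Complex.I * θ)) / π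

/-- A periodic solution of `z' + i z = k`, up to multipliers, whose real part is orthogonal to
`1`, `cos` and `sin`. -/
noncomputable def sol (k : ℝ → ℂ) (θ : ℝ) : ℂ :=
  rawSol k θ - solMean k - solCoef k * Complex.exp (-(Complex.I * θ))

variable {k k₁ k₂ : ℝ → ℂ} {M : ℝ}

theorem continuous_nonresonant (hk : Continuous k) : Continuous (nonresonant k) := by
  unfold nonresonant multiplier; fun_prop

theorem hasDerivAt_rawSol (hk : Continuous k) (θ : ℝ) :
    HasDerivAt (rawSol k) (-Complex.I * rawSol k θ + nonresonant k θ) θ := by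
  have h1 : HasDerivAt (fun θ : ℝ => Complex.exp (-(Complex.I * θ)))
      (-Complex.I * Complex.exp (-(Complex.I * θ))) θ := by
    have := ((Complex.ofRealCLM.hasDerivAt (x := θ)).const_mul Complex.I).neg.cexp
    simpa [mul_comm] using this
  have hc := continuous_nonresonant hk
  have h2 := (Continuous.integral_hasStrictDerivAt
    (f := fun s : ℝ => Complex.exp (Complex.I * s) * nonresonant k s) (by fun_prop) 0 θ).hasDerivAt
  have h3 := h1.mul h2
  refine h3.congr_deriv ?_
  have e : Complex.exp (-(Complex.I * θ)) * Complex.exp (Complex.I * θ) = 1 := by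
    rw [← Complex.exp_add]; simp
  unfold rawSol
  linear_combination nonresonant k θ * e

theorem continuous_rawSol (hk : Continuous k) : Continuous (rawSol k) :=
  continuous_iff_continuousAt.2 fun θ => (hasDerivAt_rawSol hk θ).continuousAt

/-- With `resonance k = A + iB`, integrating `e^{is} · i (A sin s - B cos s)/π` over a period gives
`-(A + iB)`. Two real multipliers therefore remove one complex obstruction. -/
theorem resonance_nonresonant (hk : Continuous k) : resonance (nonresonant k) = 0 := by
  have h : ∀ s : ℝ, Complex.exp (Complex.I * s) * nonresonant k s
      = Complex.exp (Complex.I * s) * k s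
        + (((((resonance k).im / π) * (sin s * cos s) - ((resonance k).re / π) * sin s ^ 2 : ℝ)) +
          ((((resonance k).re / π) * (sin s * cos s) - ((resonance k).im / π) * cos s ^ 2 : ℝ))
            * Complex.I) := by
    intro s
    unfold nonresonant multiplier
    rw [mul_add, add_right_inj, exp_I_mul]
    push_cast
    linear_combination (Complex.sin s * (((resonance k).re * Complex.sin s - (resonance k).im * Complex.cos s) / π))
      * Complex.I_sq
  unfold resonance
  rw [intervalIntegral.integral_congr fun s _ => h s, intervalIntegral.integral_add
    (Continuous.intervalIntegrable (by fun_prop) _ _)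
    (Continuous.intervalIntegrable (by fun_prop) _ _),
    integral_ofReal_add_mul_I (by fun_prop) (by fun_prop)]
  rw [intervalIntegral.integral_sub (Continuous.intervalIntegrable (by fun_prop) _ _)
    (Continuous.intervalIntegrable (by fun_prop) _ _),
    intervalIntegral.integral_sub (Continuous.intervalIntegrable (by fun_prop) _ _)
    (Continuous.intervalIntegrable (by fun_prop) _ _)]
  simp only [intervalIntegral.integral_const_mul, integral_sin_mul_cos_period,
    integral_sin_sq_period, integral_cos_sq_period]
  have hπ : (π:ℂ) ≠ 0 := by exact_mod_cast pi_ne_zero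
  change resonance k + _ = 0
  nth_rw 1 [← Complex.re_add_im (resonance k)]
  push_cast
  field_simp
  ring

theorem periodic_multiplier (k : ℝ → ℂ) : Function.Periodic (multiplier k) (2 * π) := by
  intro s; simp [multiplier]

theorem exp_I_mul_add_period (s : ℝ) :
    Complex.exp (Complex.I * ((s + 2 * π : ℝ) : ℂ)) = Complex.exp (Complex.I * s) := by
  rw [exp_I_mul, exp_I_mul]; simp

theorem exp_neg_I_mul_add_period (s : ℝ) :
    Complex.exp (-(Complex.I * ((s + 2 * π : ℝ) : ℂ))) = Complex.exp (-(Complex.I * s)) := by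
  rw [exp_neg_I_mul, exp_neg_I_mul]; simp

/-- In the formula of variation of constants, the increment of the integral over a period is the
resonance of the corrected right-hand side, which is zero. -/
theorem periodic_rawSol (hk : Continuous k) (hp : Function.Periodic k (2 * π)) :
    Function.Periodic (rawSol k) (2 * π) := by
  intro θ
  have hper : Function.Periodic (fun s : ℝ => Complex.exp (Complex.I * s) * nonresonant k s)
      (2 * π) := by
    intro s
    simp only [exp_I_mul_add_period, nonresonant, hp s, periodic_multiplier k s]
  have hc := continuous_nonresonant hk
  have hcont : Continuous (fun s : ℝ => Complex.exp (Complex.I * s) * nonresonant k s) := by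
    fun_prop
  have hr := resonance_nonresonant hk
  unfold resonance at hr
  unfold rawSol
  rw [exp_neg_I_mul_add_period, ← intervalIntegral.integral_add_adjacent_intervals
    (hcont.intervalIntegrable 0 θ) (hcont.intervalIntegrable θ _),
    hper.intervalIntegral_add_eq θ 0, zero_add, hr, add_zero]

theorem periodic_sol (hk : Continuous k) (hp : Function.Periodic k (2 * π)) :
    Function.Periodic (sol k) (2 * π) := by
  intro θ
  simp only [sol, periodic_rawSol hk hp θ, exp_neg_I_mul_add_period]

theorem hasDerivAt_exp_neg_I_mul (θ : ℝ) :
    HasDerivAt (fun θ : ℝ => Complex.exp (-(Complex.I * θ)))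
      (-Complex.I * Complex.exp (-(Complex.I * θ))) θ := by
  have := ((Complex.ofRealCLM.hasDerivAt (x := θ)).const_mul Complex.I).neg.cexp
  simpa [mul_comm] using this

/-- Removing the first coefficient costs nothing, as `e^{-iθ}` solves the homogeneous equation.
Removing the mean costs the constant multiplier `-solMean k`. -/
theorem hasDerivAt_sol (hk : Continuous k) (θ : ℝ) :
    HasDerivAt (sol k)
      (-Complex.I * sol k θ + k θ + Complex.I * ((-solMean k + multiplier k θ : ℝ))) θ := by
  have h := ((hasDerivAt_rawSol hk θ).sub_const (solMean k : ℂ)).sub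
    ((hasDerivAt_exp_neg_I_mul θ).const_mul (solCoef k))
  refine h.congr_deriv ?_
  unfold sol nonresonant
  push_cast
  ring

theorem continuous_sol (hk : Continuous k) : Continuous (sol k) :=
  continuous_iff_continuousAt.2 fun θ => (hasDerivAt_sol hk θ).continuousAt

/-- The constant is `10π` for `rawSol` (a right-hand side of size `5M` over a length `2π`), `10π`
for its mean and `20π` for its first coefficient. -/
theorem norm_sol_le (hk : Continuous k) (hp : Function.Periodic k (2 * π)) (hM : ∀ s, ‖k s‖ ≤ M)
    (θ : ℝ) : ‖sol k θ‖ ≤ 40 * π * M := by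
  have hπ := pi_pos
  have hM0 : 0 ≤ M := (norm_nonneg _).trans (hM 0)
  have h1 : ‖resonance k‖ ≤ 2 * π * M := norm_integral_period_le fun s => by
    rw [norm_mul, norm_exp_I_mul, one_mul]; exact hM s
  have h2 : ∀ s, ‖nonresonant k s‖ ≤ 5 * M := by
    intro s
    have h3 : |multiplier k s| ≤ 4 * M := by
      unfold multiplier
      rw [abs_div, abs_of_pos hπ, div_le_iff₀ hπ]
      have e1 := (Complex.abs_re_le_norm (resonance k)).trans h1
      have e2 := (Complex.abs_im_le_norm (resonance k)).trans h1
      calc |(resonance k).re * sin s - (resonance k).im * cos s|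
          ≤ |(resonance k).re * sin s| + |(resonance k).im * cos s| := abs_sub _ _
        _ = |(resonance k).re| * |sin s| + |(resonance k).im| * |cos s| := by rw [abs_mul, abs_mul]
        _ ≤ 2 * π * M * 1 + 2 * π * M * 1 := by
            gcongr
            · exact abs_sin_le_one s
            · exact abs_cos_le_one s
        _ = _ := by ring
    calc ‖nonresonant k s‖ ≤ ‖k s‖ + ‖Complex.I * multiplier k s‖ := norm_add_le _ _
      _ ≤ M + 4 * M := by
          gcongr
          · exact hM s
          · simpa using h3
      _ = _ := by ring
  have h3 : ∀ θ, ‖rawSol k θ‖ ≤ 10 * π * M := by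
    have : ∀ θ ∈ Ico (0:ℝ) (2 * π), ‖rawSol k θ‖ ≤ 10 * π * M := by
      intro θ hθ
      unfold rawSol
      rw [norm_mul, norm_exp_neg_I_mul, one_mul]
      have := intervalIntegral.norm_integral_le_of_norm_le_const (a := 0) (b := θ)
        (f := fun s : ℝ => Complex.exp (Complex.I * s) * nonresonant k s) (C := 5 * M)
        (fun s _ => by rw [norm_mul, norm_exp_I_mul, one_mul]; exact h2 s)
      rw [sub_zero, abs_of_nonneg hθ.1] at this
      nlinarith [hθ.2]
    intro θ
    obtain ⟨y, hy, e⟩ := (periodic_rawSol hk hp).exists_mem_Ico₀ (by positivity) θ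
    rw [e]; exact this y hy
  have h4 : |solMean k| ≤ 10 * π * M := by
    unfold solMean
    rw [abs_div, abs_of_pos (by positivity : 0 < 2 * π), div_le_iff₀ (by positivity)]
    have := norm_integral_period_le (f := fun θ => (rawSol k θ).re) (M := 10 * π * M)
      fun s => (Complex.abs_re_le_norm _).trans (h3 s)
    rw [Real.norm_eq_abs] at this
    linarith
  have h5 : ‖solCoef k‖ ≤ 20 * π * M := by
    unfold solCoef
    rw [norm_div, Complex.norm_real, Real.norm_eq_abs, abs_of_pos hπ, div_le_iff₀ hπ]
    have := norm_integral_period_le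
      (f := fun θ : ℝ => ((rawSol k θ).re : ℂ) * Complex.exp (Complex.I * θ)) (M := 10 * π * M)
      fun s => by
        rw [norm_mul, norm_exp_I_mul, mul_one, Complex.norm_real]
        exact (Complex.abs_re_le_norm _).trans (h3 s)
    linarith
  calc ‖sol k θ‖ ≤ ‖rawSol k θ‖ + ‖(solMean k : ℂ)‖
        + ‖solCoef k * Complex.exp (-(Complex.I * θ))‖ :=
        (norm_sub_le _ _).trans (add_le_add_left (norm_sub_le _ _) _)
    _ ≤ 10 * π * M + 10 * π * M + 20 * π * M := by
        gcongr
        · exact h3 θ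
        · simpa using h4
        · rwa [norm_mul, norm_exp_neg_I_mul, mul_one]
    _ = _ := by ring

theorem sol_sub (h₁ : Continuous k₁) (h₂ : Continuous k₂) (θ : ℝ) :
    sol (fun s => k₁ s - k₂ s) θ = sol k₁ θ - sol k₂ θ := by
  have hr : resonance (fun s => k₁ s - k₂ s) = resonance k₁ - resonance k₂ := by
    unfold resonance
    rw [← intervalIntegral.integral_sub (Continuous.intervalIntegrable (by fun_prop) _ _)
      (Continuous.intervalIntegrable (by fun_prop) _ _)]
    simp only [mul_sub]
  have hm : ∀ s, multiplier (fun s => k₁ s - k₂ s) s = multiplier k₁ s - multiplier k₂ s := by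
    intro s; unfold multiplier; rw [hr]; simp; ring
  have hn : ∀ s, nonresonant (fun s => k₁ s - k₂ s) s = nonresonant k₁ s - nonresonant k₂ s := by
    intro s; unfold nonresonant; rw [hm]; push_cast; ring
  have c₁ := continuous_nonresonant h₁
  have c₂ := continuous_nonresonant h₂
  have hw : ∀ s, rawSol (fun s => k₁ s - k₂ s) s = rawSol k₁ s - rawSol k₂ s := by
    intro s
    unfold rawSol
    rw [← mul_sub, ← intervalIntegral.integral_sub
      (Continuous.intervalIntegrable (by fun_prop) _ _)
      (Continuous.intervalIntegrable (by fun_prop) _ _)]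
    simp only [hn, mul_sub]
  have r₁ := continuous_rawSol h₁
  have r₂ := continuous_rawSol h₂
  have re₁ : Continuous fun θ => (rawSol k₁ θ).re := Complex.continuous_re.comp r₁
  have re₂ : Continuous fun θ => (rawSol k₂ θ).re := Complex.continuous_re.comp r₂
  have hM : solMean (fun s => k₁ s - k₂ s) = solMean k₁ - solMean k₂ := by
    unfold solMean
    rw [← sub_div, ← intervalIntegral.integral_sub (re₁.intervalIntegrable _ _)
      (re₂.intervalIntegrable _ _)]
    simp only [hw, Complex.sub_re]
  have hC : solCoef (fun s => k₁ s - k₂ s) = solCoef k₁ - solCoef k₂ := by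
    unfold solCoef
    rw [← sub_div, ← intervalIntegral.integral_sub
      (Continuous.intervalIntegrable (by fun_prop) _ _)
      (Continuous.intervalIntegrable (by fun_prop) _ _)]
    simp only [hw, Complex.sub_re]
    push_cast
    simp only [sub_mul]
  unfold sol
  rw [hw, hM, hC]
  push_cast
  ring

theorem integral_sol_re (hk : Continuous k) : ∫ θ in (0:ℝ)..2 * π, (sol k θ).re = 0 := by
  have r := continuous_rawSol hk
  have re : Continuous fun θ => (rawSol k θ).re := Complex.continuous_re.comp r
  have e : ∀ θ : ℝ, (sol k θ).re = (rawSol k θ).re - solMean k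
      - ((solCoef k).re * cos θ + (solCoef k).im * sin θ) := by
    intro θ; unfold sol; rw [exp_neg_I_mul]; simp [Complex.cos_ofReal_re, Complex.sin_ofReal_re]
  rw [intervalIntegral.integral_congr fun θ _ => e θ,
    intervalIntegral.integral_sub (Continuous.intervalIntegrable (by fun_prop) _ _)
      (Continuous.intervalIntegrable (by fun_prop) _ _),
    intervalIntegral.integral_sub (Continuous.intervalIntegrable (by fun_prop) _ _)
      (Continuous.intervalIntegrable (by fun_prop) _ _),
    intervalIntegral.integral_add (Continuous.intervalIntegrable (by fun_prop) _ _)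
      (Continuous.intervalIntegrable (by fun_prop) _ _)]
  simp only [intervalIntegral.integral_const_mul, integral_cos_period, integral_sin_period,
    intervalIntegral.integral_const, solMean, smul_eq_mul]
  field_simp
  ring

theorem solCoef_eq (hk : Continuous k) : solCoef k
    = ((∫ θ in (0:ℝ)..2 * π, (rawSol k θ).re * cos θ) / π : ℝ)
      + ((∫ θ in (0:ℝ)..2 * π, (rawSol k θ).re * sin θ) / π : ℝ) * Complex.I := by
  have r := continuous_rawSol hk
  have re : Continuous fun θ => (rawSol k θ).re := Complex.continuous_re.comp r
  unfold solCoef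
  have := integral_ofReal_add_mul_I (u := fun θ => (rawSol k θ).re * cos θ)
    (v := fun θ => (rawSol k θ).re * sin θ) (by fun_prop) (by fun_prop) 0 (2 * π)
  push_cast
  rw [div_mul_eq_mul_div, ← add_div, ← this]
  congr 1
  refine intervalIntegral.integral_congr fun θ _ => ?_
  simp only [exp_I_mul]
  push_cast
  ring

theorem integral_sol_re_mul_cos (hk : Continuous k) :
    ∫ θ in (0:ℝ)..2 * π, (sol k θ).re * cos θ = 0 := by
  have r := continuous_rawSol hk
  have re : Continuous fun θ => (rawSol k θ).re := Complex.continuous_re.comp r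
  have e : ∀ θ : ℝ, (sol k θ).re * cos θ = (rawSol k θ).re * cos θ - solMean k * cos θ
      - ((solCoef k).re * cos θ ^ 2 + (solCoef k).im * (sin θ * cos θ)) := by
    intro θ; unfold sol; rw [exp_neg_I_mul]; simp [Complex.cos_ofReal_re, Complex.sin_ofReal_re]; ring
  rw [intervalIntegral.integral_congr fun θ _ => e θ,
    intervalIntegral.integral_sub (Continuous.intervalIntegrable (by fun_prop) _ _)
      (Continuous.intervalIntegrable (by fun_prop) _ _),
    intervalIntegral.integral_sub (Continuous.intervalIntegrable (by fun_prop) _ _)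
      (Continuous.intervalIntegrable (by fun_prop) _ _),
    intervalIntegral.integral_add (Continuous.intervalIntegrable (by fun_prop) _ _)
      (Continuous.intervalIntegrable (by fun_prop) _ _)]
  simp only [intervalIntegral.integral_const_mul, integral_cos_period, integral_sin_mul_cos_period,
    integral_cos_sq_period]
  rw [solCoef_eq hk]
  simp

theorem integral_sol_re_mul_sin (hk : Continuous k) :
    ∫ θ in (0:ℝ)..2 * π, (sol k θ).re * sin θ = 0 := by
  have r := continuous_rawSol hk
  have re : Continuous fun θ => (rawSol k θ).re := Complex.continuous_re.comp r
  have e : ∀ θ : ℝ, (sol k θ).re * sin θ = (rawSol k θ).re * sin θ - solMean k * sin θ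
      - ((solCoef k).re * (sin θ * cos θ) + (solCoef k).im * sin θ ^ 2) := by
    intro θ; unfold sol; rw [exp_neg_I_mul]; simp [Complex.cos_ofReal_re, Complex.sin_ofReal_re]; ring
  rw [intervalIntegral.integral_congr fun θ _ => e θ,
    intervalIntegral.integral_sub (Continuous.intervalIntegrable (by fun_prop) _ _)
      (Continuous.intervalIntegrable (by fun_prop) _ _),
    intervalIntegral.integral_sub (Continuous.intervalIntegrable (by fun_prop) _ _)
      (Continuous.intervalIntegrable (by fun_prop) _ _),
    intervalIntegral.integral_add (Continuous.intervalIntegrable (by fun_prop) _ _)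
      (Continuous.intervalIntegrable (by fun_prop) _ _)]
  simp only [intervalIntegral.integral_const_mul, integral_sin_period, integral_sin_mul_cos_period,
    integral_sin_sq_period]
  rw [solCoef_eq hk]
  simp

/-! ### The contraction argument -/

/-- Fixed point of `ζ ↦ m + x e^{-iθ} + sol (N ∘ ζ)` on the periodic functions of norm at most `ρ`.
The real part of `sol` is orthogonal to `1, cos, sin`, so `m` and `x` are exactly the modes of the
fixed point. The hypothesis on `N` says that its strict derivative at `0` vanishes. -/
theorem exists_loop_of_small_lipschitz {N : ℂ → ℂ} (h0 : N 0 = 0)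
    (hN : ∀ ε > 0, ∃ ρ > 0, ∀ z w, ‖z‖ ≤ ρ → ‖w‖ ≤ ρ → ‖N z - N w‖ ≤ ε * ‖z - w‖)
    {δ : ℝ} (hδ : 0 < δ) :
    ∃ η > 0, ∀ (m : ℝ) (x : ℂ), |m| ≤ η → ‖x‖ ≤ η → ∃ (ζ : ℝ → ℂ) (h b c : ℝ),
      (∀ θ, HasDerivAt ζ (-Complex.I * ζ θ + N (ζ θ)
        + Complex.I * ((h + b * cos θ + c * sin θ : ℝ))) θ) ∧
      Function.Periodic ζ (2 * π) ∧
      ∫ θ in (0:ℝ)..2 * π, (ζ θ).re = 2 * π * m ∧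
      ∫ θ in (0:ℝ)..2 * π, (ζ θ).re * cos θ = π * x.re ∧
      ∫ θ in (0:ℝ)..2 * π, (ζ θ).re * sin θ = π * x.im ∧
      ∀ θ, ‖ζ θ‖ ≤ δ := by
  have hπ := pi_pos
  -- Multiplied by the bound `40π` for `sol`, this Lipschitz constant gives a contraction by `1/2`.
  obtain ⟨ρ₀, hρ₀, hlip⟩ := hN (1 / (80 * π)) (by positivity)
  set ρ := min ρ₀ δ with hρdef
  have hρ : 0 < ρ := lt_min hρ₀ hδ
  replace hlip : ∀ z w, ‖z‖ ≤ ρ → ‖w‖ ≤ ρ → ‖N z - N w‖ ≤ 1 / (80 * π) * ‖z - w‖ :=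
    fun z w hz hw => hlip z w (hz.trans (min_le_left _ _)) (hw.trans (min_le_left _ _))
  have hbd : ∀ z, ‖z‖ ≤ ρ → ‖N z‖ ≤ 1 / (80 * π) * ‖z‖ := by
    intro z hz
    have := hlip z 0 hz (by simpa using hρ.le)
    simpa [h0] using this
  -- The terms `m` and `x e^{-iθ}` take `ρ/4` each, which leaves `ρ/2` for `sol`.
  refine ⟨ρ / 4, by positivity, fun m x hm hx => ?_⟩
  let S : Set (BoundedContinuousFunction ℝ ℂ) := {ζ | Function.Periodic ζ (2 * π) ∧ ‖ζ‖ ≤ ρ}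
  have hS : IsClosed S := by
    refine IsClosed.inter ?_ (isClosed_le continuous_norm continuous_const)
    have : {ζ : BoundedContinuousFunction ℝ ℂ | Function.Periodic ζ (2 * π)}
        = ⋂ θ : ℝ, {ζ | ζ (θ + 2 * π) = ζ θ} := by ext ζ; simp [Function.Periodic]
    change IsClosed {ζ : BoundedContinuousFunction ℝ ℂ | Function.Periodic ζ (2 * π)}
    rw [this]
    exact isClosed_iInter fun θ => isClosed_eq (continuous_eval_const _)
      (continuous_eval_const _)
  have : CompleteSpace S := hS.completeSpace_coe
  have : Nonempty S := ⟨⟨0, fun _ => rfl, by simpa using hρ.le⟩⟩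
  have hpt : ∀ (ζ : S) θ, ‖(ζ : BoundedContinuousFunction ℝ ℂ) θ‖ ≤ ρ := fun ζ θ =>
    ((ζ : BoundedContinuousFunction ℝ ℂ).norm_coe_le_norm θ).trans ζ.2.2
  have hcontN : ContinuousOn N (Metric.closedBall 0 ρ) := by
    have : LipschitzOnWith (Real.toNNReal (1 / (80 * π))) N (Metric.closedBall 0 ρ) := by
      refine LipschitzOnWith.of_dist_le_mul fun z hz w hw => ?_
      rw [dist_eq_norm, dist_eq_norm, Real.coe_toNNReal _ (by positivity)]
      exact hlip z w (by simpa using hz) (by simpa using hw)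
    exact this.continuousOn
  have hk : ∀ ζ : S, Continuous fun θ => N ((ζ : BoundedContinuousFunction ℝ ℂ) θ) := fun ζ =>
    hcontN.comp_continuous (ζ : BoundedContinuousFunction ℝ ℂ).continuous
      fun θ => by simpa using hpt ζ θ
  have hkp : ∀ ζ : S, Function.Periodic (fun θ => N ((ζ : BoundedContinuousFunction ℝ ℂ) θ))
      (2 * π) := fun ζ θ => by simp only [ζ.2.1 θ]
  let t : S → ℝ → ℂ := fun ζ θ => (m : ℂ) + x * Complex.exp (-(Complex.I * θ))
    + sol (fun θ => N ((ζ : BoundedContinuousFunction ℝ ℂ) θ)) θ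
  have ht : ∀ ζ θ, ‖t ζ θ‖ ≤ ρ := by
    intro ζ θ
    have h1 := norm_sol_le (hk ζ) (hkp ζ) (M := 1 / (80 * π) * ρ) (fun s =>
      (hbd _ (hpt ζ s)).trans (by gcongr; exact hpt ζ s)) θ
    have e : 40 * π * (1 / (80 * π) * ρ) = ρ / 2 := by field_simp; norm_num
    rw [e] at h1
    calc ‖t ζ θ‖ ≤ ‖(m : ℂ)‖ + ‖x * Complex.exp (-(Complex.I * θ))‖ + ‖sol _ θ‖ := norm_add₃_le
      _ ≤ ρ / 4 + ρ / 4 + ρ / 2 := by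
        gcongr
        · simpa using hm
        · rwa [norm_mul, norm_exp_neg_I_mul, mul_one]
      _ = ρ := by ring
  have htc : ∀ ζ, Continuous (t ζ) := fun ζ => by
    have := continuous_sol (hk ζ)
    fun_prop
  let T : S → S := fun ζ => ⟨BoundedContinuousFunction.ofNormedAddCommGroup (t ζ) (htc ζ) ρ (ht ζ),
    fun θ => by
      simp only [BoundedContinuousFunction.coe_ofNormedAddCommGroup, t]
      rw [exp_neg_I_mul_add_period, periodic_sol (hk ζ) (hkp ζ)],
    BoundedContinuousFunction.norm_ofNormedAddCommGroup_le _ hρ.le (ht ζ)⟩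
  have hT : ContractingWith (1 / 2) T := by
    refine ⟨by norm_num, LipschitzWith.of_dist_le_mul fun ζ₁ ζ₂ => ?_⟩
    rw [Subtype.dist_eq, Subtype.dist_eq, BoundedContinuousFunction.dist_le (by positivity)]
    intro θ
    rw [dist_eq_norm]
    have e : ((T ζ₁ : BoundedContinuousFunction ℝ ℂ) θ - (T ζ₂ : BoundedContinuousFunction ℝ ℂ) θ)
        = sol (fun s => N ((ζ₁ : BoundedContinuousFunction ℝ ℂ) s)
          - N ((ζ₂ : BoundedContinuousFunction ℝ ℂ) s)) θ := by
      rw [sol_sub (hk ζ₁) (hk ζ₂)]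
      simp [T, t]
    rw [e]
    have h1 := norm_sol_le ((hk ζ₁).sub (hk ζ₂)) ((hkp ζ₁).sub (hkp ζ₂))
      (M := 1 / (80 * π) * dist (ζ₁ : BoundedContinuousFunction ℝ ℂ) ζ₂) (fun s =>
      (hlip _ _ (hpt ζ₁ s) (hpt ζ₂ s)).trans (by
        gcongr
        rw [← dist_eq_norm]
        exact BoundedContinuousFunction.dist_coe_le_dist s)) θ
    refine h1.trans (le_of_eq ?_)
    push_cast
    field_simp
    ring
  set ζ : S := ContractingWith.fixedPoint T hT
  have hfix : ∀ θ, (ζ : BoundedContinuousFunction ℝ ℂ) θ = t ζ θ := fun θ => by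
    have : T ζ = ζ := hT.fixedPoint_isFixedPt
    conv_lhs => rw [← this]
    rfl
  set k := fun θ => N ((ζ : BoundedContinuousFunction ℝ ℂ) θ) with hkdef
  have hre : ∀ θ, ((ζ : BoundedContinuousFunction ℝ ℂ) θ).re
      = m + (x.re * cos θ + x.im * sin θ) + (sol k θ).re := by
    intro θ
    rw [hfix θ]
    simp only [t, exp_neg_I_mul]
    simp [Complex.cos_ofReal_re, Complex.sin_ofReal_re, hkdef]
  have hsolre : Continuous fun θ => (sol k θ).re := Complex.continuous_re.comp (continuous_sol (hk ζ))
  -- The constant `m` is not a solution of the homogeneous equation: `-i m` has to be compensated,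
  -- whence the `m` in the first multiplier. The other two are read off `multiplier`.
  refine ⟨(ζ : BoundedContinuousFunction ℝ ℂ), m - solMean k, -(resonance k).im / π,
    (resonance k).re / π, fun θ => ?_, ζ.2.1, ?_, ?_, ?_, fun θ =>
    (hpt ζ θ).trans (min_le_right _ _)⟩
  · have h1 := (((hasDerivAt_exp_neg_I_mul θ).const_mul x).const_add (m : ℂ)).add
      (hasDerivAt_sol (hk ζ) θ)
    have h2 : HasDerivAt (ζ : BoundedContinuousFunction ℝ ℂ) _ θ := h1.congr_of_eventuallyEq
      (Filter.Eventually.of_forall hfix)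
    refine h2.congr_deriv ?_
    rw [hfix θ]
    simp only [t, multiplier, hkdef]
    push_cast
    ring
  · rw [intervalIntegral.integral_congr fun θ _ => hre θ,
      intervalIntegral.integral_add (Continuous.intervalIntegrable (by fun_prop) _ _)
        (Continuous.intervalIntegrable (by fun_prop) _ _),
      intervalIntegral.integral_add (Continuous.intervalIntegrable (by fun_prop) _ _)
        (Continuous.intervalIntegrable (by fun_prop) _ _),
      intervalIntegral.integral_add (Continuous.intervalIntegrable (by fun_prop) _ _)
        (Continuous.intervalIntegrable (by fun_prop) _ _), integral_sol_re (hk ζ)]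
    simp only [intervalIntegral.integral_const_mul, integral_cos_period, integral_sin_period]
    simp
  · have e : ∀ θ, ((ζ : BoundedContinuousFunction ℝ ℂ) θ).re * cos θ
      = m * cos θ + (x.re * cos θ ^ 2 + x.im * (sin θ * cos θ)) + (sol k θ).re * cos θ :=
      fun θ => by rw [hre]; ring
    rw [intervalIntegral.integral_congr fun θ _ => e θ,
      intervalIntegral.integral_add (Continuous.intervalIntegrable (by fun_prop) _ _)
        (Continuous.intervalIntegrable (by fun_prop) _ _),
      intervalIntegral.integral_add (Continuous.intervalIntegrable (by fun_prop) _ _)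
        (Continuous.intervalIntegrable (by fun_prop) _ _),
      intervalIntegral.integral_add (Continuous.intervalIntegrable (by fun_prop) _ _)
        (Continuous.intervalIntegrable (by fun_prop) _ _), integral_sol_re_mul_cos (hk ζ)]
    simp only [intervalIntegral.integral_const_mul, integral_cos_period, integral_cos_sq_period,
      integral_sin_mul_cos_period]
    ring
  · have e : ∀ θ, ((ζ : BoundedContinuousFunction ℝ ℂ) θ).re * sin θ
      = m * sin θ + (x.re * (sin θ * cos θ) + x.im * sin θ ^ 2) + (sol k θ).re * sin θ :=
      fun θ => by rw [hre]; ring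
    rw [intervalIntegral.integral_congr fun θ _ => e θ,
      intervalIntegral.integral_add (Continuous.intervalIntegrable (by fun_prop) _ _)
        (Continuous.intervalIntegrable (by fun_prop) _ _),
      intervalIntegral.integral_add (Continuous.intervalIntegrable (by fun_prop) _ _)
        (Continuous.intervalIntegrable (by fun_prop) _ _),
      intervalIntegral.integral_add (Continuous.intervalIntegrable (by fun_prop) _ _)
        (Continuous.intervalIntegrable (by fun_prop) _ _), integral_sol_re_mul_sin (hk ζ)]
    simp only [intervalIntegral.integral_const_mul, integral_sin_period, integral_sin_sq_period,
      integral_sin_mul_cos_period]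
    ring

/-! ### The length density, its Legendre transform and strict derivatives -/

/-- A positive `C²` function `g` with its first two derivatives. -/
structure IsRadius (g g₁ g₂ : ℝ → ℝ) : Prop where
  pos : ∀ v, 0 < g v
  hasDerivAt : ∀ v, HasDerivAt g (g₁ v) v
  hasDerivAt₁ : ∀ v, HasDerivAt g₁ (g₂ v) v
  continuous₂ : Continuous g₂

namespace IsRadius

variable {g g₁ g₂ : ℝ → ℝ}

theorem continuous (hg : IsRadius g g₁ g₂) : Continuous g :=
  continuous_iff_continuousAt.2 fun v => (hg.hasDerivAt v).continuousAt

theorem continuous₁ (hg : IsRadius g g₁ g₂) : Continuous g₁ :=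
  continuous_iff_continuousAt.2 fun v => (hg.hasDerivAt₁ v).continuousAt

theorem hasStrictFDerivAt_fst (hg : IsRadius g g₁ g₂) (z : ℝ × ℝ) :
    HasStrictFDerivAt (fun z : ℝ × ℝ => g z.1) (g₁ z.1 • ContinuousLinearMap.fst ℝ ℝ ℝ) z :=
  (hasStrictDerivAt_of_hasDerivAt_of_continuousAt (Eventually.of_forall hg.hasDerivAt)
    hg.continuous₁.continuousAt).comp_hasStrictFDerivAt z _root_.hasStrictFDerivAt_fst

theorem hasStrictFDerivAt_fst₁ (hg : IsRadius g g₁ g₂) (z : ℝ × ℝ) :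
    HasStrictFDerivAt (fun z : ℝ × ℝ => g₁ z.1) (g₂ z.1 • ContinuousLinearMap.fst ℝ ℝ ℝ) z :=
  (hasStrictDerivAt_of_hasDerivAt_of_continuousAt (Eventually.of_forall hg.hasDerivAt₁)
    hg.continuous₂.continuousAt).comp_hasStrictFDerivAt z _root_.hasStrictFDerivAt_fst

end IsRadius

/-- `F` is strictly differentiable at `(m, 0)` with partial derivatives `A` and `B`. -/
def StrictAt (F : ℝ → ℝ → ℝ) (m A B : ℝ) : Prop :=
  ∀ ε > 0, ∃ ρ > 0, ∀ v₁ p₁ v₂ p₂ : ℝ, |v₁ - m| ≤ ρ → |p₁| ≤ ρ → |v₂ - m| ≤ ρ → |p₂| ≤ ρ →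
    |F v₂ p₂ - F v₁ p₁ - (A * (v₂ - v₁) + B * (p₂ - p₁))| ≤ ε * (|v₂ - v₁| + |p₂ - p₁|)

theorem StrictAt.of_hasStrictFDerivAt {F : ℝ → ℝ → ℝ} {m A B : ℝ} {L : ℝ × ℝ →L[ℝ] ℝ}
    (h : HasStrictFDerivAt (fun z : ℝ × ℝ => F z.1 z.2) L (m, 0)) (hA : L (1, 0) = A)
    (hB : L (0, 1) = B) : StrictAt F m A B := by
  intro ε hε
  have h1 := (h.isLittleO.def hε)
  rw [nhds_prod_eq, ← nhds_prod_eq, Metric.eventually_nhds_iff_ball] at h1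
  obtain ⟨ρ, hρ, hb⟩ := h1
  refine ⟨ρ / 2, by positivity, fun v₁ p₁ v₂ p₂ h1 h2 h3 h4 => ?_⟩
  have := hb ((v₂, p₂), (v₁, p₁)) (by
    rw [Metric.mem_ball, Prod.dist_eq, Prod.dist_eq, Prod.dist_eq]
    simp only [Real.dist_eq, sub_zero, max_lt_iff]
    refine ⟨⟨?_, ?_⟩, ?_, ?_⟩ <;> linarith)
  have e : L ((v₂, p₂) - (v₁, p₁)) = A * (v₂ - v₁) + B * (p₂ - p₁) := by
    have : ((v₂, p₂) - (v₁, p₁) : ℝ × ℝ) = (v₂ - v₁) • (1, 0) + (p₂ - p₁) • (0, 1) := by simp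
    rw [this, map_add, map_smul, map_smul, hA, hB]
    simp [mul_comm]
  rw [e] at this
  refine this.trans ?_
  gcongr
  rw [Prod.norm_def]
  exact max_le_add_of_nonneg (norm_nonneg _) (norm_nonneg _)

/-- The length element of the curve `v = v(θ)`, where `p = v'`. -/
noncomputable def lengthDensity (g : ℝ → ℝ) (v p : ℝ) : ℝ := √(g v ^ 2 + p ^ 2 / g v ^ 2)

/-- The partial derivative of `lengthDensity` with respect to `v`. -/
noncomputable def densityV (g g₁ : ℝ → ℝ) (v p : ℝ) : ℝ :=
  (g v * g₁ v - p ^ 2 * g₁ v / g v ^ 3) / lengthDensity g v p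

/-- The partial derivative of `lengthDensity` with respect to `p`. -/
noncomputable def densityP (g : ℝ → ℝ) (v p : ℝ) : ℝ := p / (g v ^ 2 * lengthDensity g v p)

/-- The velocity `v'` in terms of the momentum `q`. -/
noncomputable def velocity (g : ℝ → ℝ) (v q : ℝ) : ℝ := g v ^ 3 * q / √(1 - g v ^ 2 * q ^ 2)

/-- The force `∂Φ/∂v` in terms of the momentum `q`. -/
noncomputable def force (g g₁ : ℝ → ℝ) (v q : ℝ) : ℝ :=
  g₁ v * (1 - 2 * (g v ^ 2 * q ^ 2)) / √(1 - g v ^ 2 * q ^ 2)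

variable {g g₁ g₂ : ℝ → ℝ}

theorem lengthDensity_radicand_pos (hg : IsRadius g g₁ g₂) (v p : ℝ) : 0 < g v ^ 2 + p ^ 2 / g v ^ 2 := by
  have := hg.pos v; positivity

theorem lengthDensity_pos (hg : IsRadius g g₁ g₂) (v p : ℝ) : 0 < lengthDensity g v p :=
  sqrt_pos.2 (lengthDensity_radicand_pos hg v p)

theorem lengthDensity_zero (hg : IsRadius g g₁ g₂) (v : ℝ) : lengthDensity g v 0 = g v := by
  have := hg.pos v
  simp [lengthDensity, sqrt_sq this.le]

theorem continuous_lengthDensity (hg : IsRadius g g₁ g₂) : Continuous fun z : ℝ × ℝ => lengthDensity g z.1 z.2 := by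
  have := hg.continuous
  have h : ∀ z : ℝ × ℝ, g z.1 ^ 2 ≠ 0 := fun z => (pow_pos (hg.pos _) 2).ne'
  unfold lengthDensity
  fun_prop (disch := exact h _)

theorem hasDerivAt_lengthDensity (hg : IsRadius g g₁ g₂) {v p : ℝ → ℝ} {v' p' s : ℝ} (hv : HasDerivAt v v' s)
    (hp : HasDerivAt p p' s) :
    HasDerivAt (fun s => lengthDensity g (v s) (p s))
      (densityV g g₁ (v s) (p s) * v' + densityP g (v s) (p s) * p') s := by
  have hgv := (hg.hasDerivAt (v s)).comp s hv
  have hpos := hg.pos (v s)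
  have h := ((hgv.pow 2).add ((hp.pow 2).div (hgv.pow 2) (pow_pos hpos 2).ne')).sqrt
    (lengthDensity_radicand_pos hg (v s) (p s)).ne'
  refine h.congr_deriv ?_
  have hL := lengthDensity_pos hg (v s) (p s)
  unfold densityV densityP
  simp only [Function.comp_apply, Pi.add_apply, Pi.pow_apply, Pi.div_apply]
  change _ / (2 * lengthDensity g (v s) (p s)) = _
  field_simp
  push_cast
  ring

theorem hasStrictFDerivAt_inv_sq (hg : IsRadius g g₁ g₂) (z : ℝ × ℝ) :
    HasStrictFDerivAt (fun z : ℝ × ℝ => (g z.1 ^ 2)⁻¹)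
      ((-2 * g₁ z.1 / g z.1 ^ 3) • ContinuousLinearMap.fst ℝ ℝ ℝ) z := by
  have hpos := hg.pos z.1
  have h := (hasStrictDerivAt_inv (pow_pos hpos 2).ne').comp_hasStrictFDerivAt z
    ((hg.hasStrictFDerivAt_fst z).pow 2)
  refine h.congr_fderiv ?_
  ext <;> simp
  field_simp

theorem hasStrictFDerivAt_lengthDensity (hg : IsRadius g g₁ g₂) (m : ℝ) :
    HasStrictFDerivAt (fun z : ℝ × ℝ => lengthDensity g z.1 z.2)
      (g₁ m • ContinuousLinearMap.fst ℝ ℝ ℝ) (m, 0) := by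
  have hpos := hg.pos m
  have h1 := hg.hasStrictFDerivAt_fst (m, 0)
  have h2 := (h1.pow 2).add
    (((_root_.hasStrictFDerivAt_snd (𝕜 := ℝ) (E := ℝ) (F := ℝ) (p := (m, 0))).pow 2).mul
      (hasStrictFDerivAt_inv_sq hg (m, 0)))
  have h3 := h2.sqrt (by simpa using hpos.ne')
  refine h3.congr_fderiv ?_
  ext <;> simp [sqrt_sq hpos.le]
  field_simp

theorem strictAt_lengthDensity (hg : IsRadius g g₁ g₂) (m : ℝ) :
    StrictAt (lengthDensity g) m (g₁ m) 0 :=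
  .of_hasStrictFDerivAt (hasStrictFDerivAt_lengthDensity hg m) (by simp) (by simp)

theorem hasStrictFDerivAt_inv_lengthDensity (hg : IsRadius g g₁ g₂) (m : ℝ) :
    HasStrictFDerivAt (fun z : ℝ × ℝ => (lengthDensity g z.1 z.2)⁻¹)
      ((-g₁ m / g m ^ 2) • ContinuousLinearMap.fst ℝ ℝ ℝ) (m, 0) := by
  have h := (hasStrictDerivAt_inv (lengthDensity_pos hg m 0).ne').comp_hasStrictFDerivAt (m, 0)
    (hasStrictFDerivAt_lengthDensity hg m)
  refine h.congr_fderiv ?_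
  ext <;> simp [lengthDensity_zero hg]
  ring

theorem strictAt_densityP (hg : IsRadius g g₁ g₂) (m : ℝ) :
    StrictAt (densityP g) m 0 (1 / g m ^ 3) := by
  have hpos := hg.pos m
  have h := (_root_.hasStrictFDerivAt_snd (𝕜 := ℝ) (E := ℝ) (F := ℝ) (p := (m, 0))).mul
    ((hasStrictFDerivAt_inv_sq hg (m, 0)).mul (hasStrictFDerivAt_inv_lengthDensity hg m))
  refine .of_hasStrictFDerivAt (h.congr_of_eventuallyEq (Eventually.of_forall fun z => ?_)) ?_ ?_
  · simp [densityP, div_eq_mul_inv, mul_comm]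
  · simp
  · simp [lengthDensity_zero hg]; field_simp

theorem strictAt_densityV (hg : IsRadius g g₁ g₂) (m : ℝ) :
    StrictAt (densityV g g₁) m (g₂ m) 0 := by
  have hpos := hg.pos m
  have h1 := hg.hasStrictFDerivAt_fst (m, 0)
  have h2 := hg.hasStrictFDerivAt_fst₁ (m, 0)
  have hs := _root_.hasStrictFDerivAt_snd (𝕜 := ℝ) (E := ℝ) (F := ℝ) (p := (m, 0))
  have hi := hasStrictFDerivAt_inv_sq hg (m, 0)
  have h := (h2.mul (h1.mul ((hi.mul (hi.mul (hs.pow 2))).const_sub 1))).mul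
    (hasStrictFDerivAt_inv_lengthDensity hg m)
  refine .of_hasStrictFDerivAt (h.congr_of_eventuallyEq (Eventually.of_forall fun z => ?_)) ?_ ?_
  · have := hg.pos z.1
    simp only [densityV, Pi.mul_apply]
    field_simp
  · simp [lengthDensity_zero hg]; field_simp; ring
  · simp

theorem hasStrictFDerivAt_inv_sine (hg : IsRadius g g₁ g₂) (m : ℝ) :
    HasStrictFDerivAt (fun z : ℝ × ℝ => (√(1 - g z.1 ^ 2 * z.2 ^ 2))⁻¹)
      (0 : ℝ × ℝ →L[ℝ] ℝ) (m, 0) := by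
  have h1 := hg.hasStrictFDerivAt_fst (m, 0)
  have hs := _root_.hasStrictFDerivAt_snd (𝕜 := ℝ) (E := ℝ) (F := ℝ) (p := (m, 0))
  have h2 := (((h1.pow 2).mul (hs.pow 2)).const_sub 1).sqrt (by simp)
  have h := (hasStrictDerivAt_inv (x := √(1 - g m ^ 2 * 0 ^ 2)) (by simp)).comp_hasStrictFDerivAt
    (m, 0) h2
  refine h.congr_fderiv ?_
  ext <;> simp

theorem strictAt_velocity (hg : IsRadius g g₁ g₂) (m : ℝ) :
    StrictAt (velocity g) m 0 (g m ^ 3) := by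
  have h1 := hg.hasStrictFDerivAt_fst (m, 0)
  have hs := _root_.hasStrictFDerivAt_snd (𝕜 := ℝ) (E := ℝ) (F := ℝ) (p := (m, 0))
  have h := ((h1.pow 3).mul hs).mul (hasStrictFDerivAt_inv_sine hg m)
  refine .of_hasStrictFDerivAt (h.congr_of_eventuallyEq (Eventually.of_forall fun z => ?_)) ?_ ?_
  · simp [velocity, div_eq_mul_inv]
  · simp
  · simp

theorem strictAt_force (hg : IsRadius g g₁ g₂) (m : ℝ) :
    StrictAt (force g g₁) m (g₂ m) 0 := by
  have h1 := hg.hasStrictFDerivAt_fst (m, 0)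
  have h2 := hg.hasStrictFDerivAt_fst₁ (m, 0)
  have hs := _root_.hasStrictFDerivAt_snd (𝕜 := ℝ) (E := ℝ) (F := ℝ) (p := (m, 0))
  have h := (h2.mul ((((h1.pow 2).mul (hs.pow 2)).const_mul 2).const_sub 1)).mul
    (hasStrictFDerivAt_inv_sine hg m)
  refine .of_hasStrictFDerivAt (h.congr_of_eventuallyEq (Eventually.of_forall fun z => ?_)) ?_ ?_
  · simp [force, div_eq_mul_inv]
  · simp
  · simp

theorem lengthDensity_velocity (hg : IsRadius g g₁ g₂) {v q : ℝ} (h : g v ^ 2 * q ^ 2 < 1) :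
    lengthDensity g v (velocity g v q) = g v / √(1 - g v ^ 2 * q ^ 2) := by
  have hpos := hg.pos v
  have hS : 0 < 1 - g v ^ 2 * q ^ 2 := by linarith
  have hS' := sqrt_pos.2 hS
  have e := sq_sqrt hS.le
  unfold lengthDensity velocity
  rw [sqrt_eq_iff_mul_self_eq (by positivity) (by positivity)]
  set S := √(1 - g v ^ 2 * q ^ 2)
  field_simp
  rw [e]; ring

/-- `velocity` inverts the Legendre transform `p ↦ densityP g v p`. For the curve on the torus `g v
* q` is `cos σ` and the square root is `sin σ`. -/
theorem densityP_velocity (hg : IsRadius g g₁ g₂) {v q : ℝ} (h : g v ^ 2 * q ^ 2 < 1) :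
    densityP g v (velocity g v q) = q := by
  have hpos := hg.pos v
  have hS' : 0 < √(1 - g v ^ 2 * q ^ 2) := sqrt_pos.2 (by linarith)
  rw [densityP, lengthDensity_velocity hg h, velocity]
  field_simp

theorem densityV_velocity (hg : IsRadius g g₁ g₂) {v q : ℝ} (h : g v ^ 2 * q ^ 2 < 1) :
    densityV g g₁ v (velocity g v q) = force g g₁ v q := by
  have hpos := hg.pos v
  have hS : 0 < 1 - g v ^ 2 * q ^ 2 := by linarith
  have hS' := sqrt_pos.2 hS
  have e := sq_sqrt hS.le
  rw [densityV, lengthDensity_velocity hg h, velocity, force]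
  set S := √(1 - g v ^ 2 * q ^ 2)
  field_simp
  rw [e]; ring

/-! ### Energy, first Fourier modes and critical loops -/

/-- The length of the closed curve `v = w(θ)`. -/
noncomputable def energy (g w w' : ℝ → ℝ) : ℝ := ∫ θ in (0:ℝ)..2 * π, lengthDensity g (w θ) (w' θ)

/-- `w` has mean value `m` and first Fourier coefficients `x.re` and `x.im`. -/
structure HasModes (w : ℝ → ℝ) (m : ℝ) (x : ℂ) : Prop where
  mean : ∫ θ in (0:ℝ)..2 * π, w θ = 2 * π * m
  cos : ∫ θ in (0:ℝ)..2 * π, w θ * cos θ = π * x.re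
  sin : ∫ θ in (0:ℝ)..2 * π, w θ * sin θ = π * x.im

theorem HasModes.sub {w u : ℝ → ℝ} {m n : ℝ} {x y : ℂ} (hw : HasModes w m x) (hu : HasModes u n y)
    (cw : Continuous w) (cu : Continuous u) : HasModes (fun θ => w θ - u θ) (m - n) (x - y) := by
  have e : ∀ φ : ℝ → ℝ, Continuous φ → ∫ θ in (0:ℝ)..2 * π, (w θ - u θ) * φ θ
      = (∫ θ in (0:ℝ)..2 * π, w θ * φ θ) - ∫ θ in (0:ℝ)..2 * π, u θ * φ θ := by
    intro φ hφ
    rw [← intervalIntegral.integral_sub (Continuous.intervalIntegrable (by fun_prop) _ _)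
      (Continuous.intervalIntegrable (by fun_prop) _ _)]
    simp only [sub_mul]
  refine ⟨?_, ?_, ?_⟩
  · have := e (fun _ => 1) continuous_const
    simp only [mul_one] at this
    rw [this, hw.mean, hu.mean]; ring
  · rw [e _ continuous_cos, hw.cos, hu.cos, Complex.sub_re]; ring
  · rw [e _ continuous_sin, hw.sin, hu.sin, Complex.sub_im]; ring

theorem HasModes.add {w u : ℝ → ℝ} {m n : ℝ} {x y : ℂ} (hw : HasModes w m x) (hu : HasModes u n y)
    (cw : Continuous w) (cu : Continuous u) : HasModes (fun θ => w θ + u θ) (m + n) (x + y) := by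
  have e : ∀ φ : ℝ → ℝ, Continuous φ → ∫ θ in (0:ℝ)..2 * π, (w θ + u θ) * φ θ
      = (∫ θ in (0:ℝ)..2 * π, w θ * φ θ) + ∫ θ in (0:ℝ)..2 * π, u θ * φ θ := by
    intro φ hφ
    rw [← intervalIntegral.integral_add (Continuous.intervalIntegrable (by fun_prop) _ _)
      (Continuous.intervalIntegrable (by fun_prop) _ _)]
    simp only [add_mul]
  refine ⟨?_, ?_, ?_⟩
  · have := e (fun _ => 1) continuous_const
    simp only [mul_one] at this
    rw [this, hw.mean, hu.mean]; ring
  · rw [e _ continuous_cos, hw.cos, hu.cos, Complex.add_re]; ring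
  · rw [e _ continuous_sin, hw.sin, hu.sin, Complex.add_im]; ring

/-- The first harmonic with coefficients `x.re` and `x.im`. -/
noncomputable def harmonic (x : ℂ) (θ : ℝ) : ℝ := x.re * cos θ + x.im * sin θ

/-- The derivative of `harmonic x`. -/
noncomputable def harmonicDeriv (x : ℂ) (θ : ℝ) : ℝ := -x.re * sin θ + x.im * cos θ

theorem hasDerivAt_harmonic (x : ℂ) (θ : ℝ) : HasDerivAt (harmonic x) (harmonicDeriv x θ) θ := by
  refine (((hasDerivAt_cos θ).const_mul x.re).add ((hasDerivAt_sin θ).const_mul x.im)).congr_deriv ?_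
  unfold harmonicDeriv; ring

theorem continuous_harmonic (x : ℂ) : Continuous (harmonic x) := by unfold harmonic; fun_prop

theorem continuous_harmonicDeriv (x : ℂ) : Continuous (harmonicDeriv x) := by
  unfold harmonicDeriv; fun_prop

theorem hasDerivAt_harmonicDeriv (x : ℂ) (θ : ℝ) :
    HasDerivAt (harmonicDeriv x) (-harmonic x θ) θ := by
  refine (((hasDerivAt_sin θ).const_mul (-x.re)).add
    ((hasDerivAt_cos θ).const_mul x.im)).congr_deriv ?_
  unfold harmonic; ring

theorem isLoop_harmonic (x : ℂ) : IsLoop (harmonic x) (harmonicDeriv x) :=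
  ⟨hasDerivAt_harmonic x, continuous_harmonicDeriv x, fun θ => by simp [harmonic]⟩

theorem harmonic_sq_add (x : ℂ) (θ : ℝ) : harmonic x θ ^ 2 + harmonicDeriv x θ ^ 2 = ‖x‖ ^ 2 := by
  rw [Complex.sq_norm, Complex.normSq_apply]
  unfold harmonic harmonicDeriv
  linear_combination (x.re ^ 2 + x.im ^ 2) * sin_sq_add_cos_sq θ

theorem abs_harmonic_le (x : ℂ) (θ : ℝ) : |harmonic x θ| ≤ ‖x‖ :=
  abs_le_of_sq_le_sq (by nlinarith [harmonic_sq_add x θ, sq_nonneg (harmonicDeriv x θ)]) (norm_nonneg _)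

theorem abs_harmonicDeriv_le (x : ℂ) (θ : ℝ) : |harmonicDeriv x θ| ≤ ‖x‖ :=
  abs_le_of_sq_le_sq (by nlinarith [harmonic_sq_add x θ, sq_nonneg (harmonic x θ)]) (norm_nonneg _)

theorem hasModes_harmonic (x : ℂ) : HasModes (harmonic x) 0 x := by
  have i : ∀ a b : ℝ, ∀ u v : ℝ → ℝ, Continuous u → Continuous v →
      ∫ θ in (0:ℝ)..2 * π, (a * u θ + b * v θ)
        = a * (∫ θ in (0:ℝ)..2 * π, u θ) + b * ∫ θ in (0:ℝ)..2 * π, v θ := by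
    intro a b u v hu hv
    rw [intervalIntegral.integral_add (Continuous.intervalIntegrable (by fun_prop) _ _)
      (Continuous.intervalIntegrable (by fun_prop) _ _), intervalIntegral.integral_const_mul,
      intervalIntegral.integral_const_mul]
  refine ⟨?_, ?_, ?_⟩
  · unfold harmonic
    rw [i _ _ _ _ continuous_cos continuous_sin, integral_cos_period, integral_sin_period]; ring
  · have e : ∀ θ, harmonic x θ * cos θ = x.re * cos θ ^ 2 + x.im * (sin θ * cos θ) := fun θ => by
      unfold harmonic; ring
    rw [intervalIntegral.integral_congr fun θ _ => e θ, i _ _ _ _ (by fun_prop) (by fun_prop),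
      integral_cos_sq_period, integral_sin_mul_cos_period]; ring
  · have e : ∀ θ, harmonic x θ * sin θ = x.re * (sin θ * cos θ) + x.im * sin θ ^ 2 := fun θ => by
      unfold harmonic; ring
    rw [intervalIntegral.integral_congr fun θ _ => e θ, i _ _ _ _ (by fun_prop) (by fun_prop),
      integral_sin_sq_period, integral_sin_mul_cos_period]; ring

theorem hasModes_const (m : ℝ) : HasModes (fun _ => m) m 0 :=
  ⟨by simp, by rw [intervalIntegral.integral_const_mul, integral_cos_period]; simp,
    by rw [intervalIntegral.integral_const_mul, integral_sin_period]; simp⟩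

/-- `v` is critical for `energy`, up to multipliers `h`, `b`, `c` for the mean value and the first
Fourier coefficients; `q` is its momentum. -/
structure IsCritical (g g₁ v v' q : ℝ → ℝ) (h b c : ℝ) : Prop where
  isLoop : IsLoop v v'
  sine_pos : ∀ θ, g (v θ) ^ 2 * q θ ^ 2 < 1
  velocity : ∀ θ, v' θ = velocity g (v θ) (q θ)
  hasDerivAt : ∀ θ, HasDerivAt q (force g g₁ (v θ) (q θ) + (h + b * cos θ + c * sin θ)) θ
  periodic : Function.Periodic q (2 * π)

/-- The Euler–Lagrange equation is Hamiltonian in `(v, q)`. In the complex unknown `ζ = (v - m₀) + i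
q/κ` its linearization at `(m₀, 0)` is the rotation `ζ' = -i ζ`, precisely because `g₂ m₀ = -κ` and
`g m₀ ^ 3 = κ⁻¹`. The nonlinear rest `N` has zero strict derivative. -/
theorem exists_isCritical (hg : IsRadius g g₁ g₂) {m₀ : ℝ} (h₂ : g₂ m₀ = -(1 / g m₀ ^ 3)) {δ : ℝ}
    (hδ : 0 < δ) : ∃ η > 0, ∀ (m : ℝ) (x : ℂ), |m - m₀| ≤ η → ‖x‖ ≤ η → ∃ (v v' q : ℝ → ℝ)
      (h b c : ℝ), IsCritical g g₁ v v' q h b c ∧ HasModes v m x ∧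
        ∀ θ, |v θ - m₀| ≤ δ ∧ |v' θ| ≤ δ ∧ |q θ| ≤ δ := by
  have hpos := hg.pos m₀
  set κ := 1 / g m₀ ^ 3 with hκdef
  have hκ : 0 < κ := by positivity
  have hκi : g m₀ ^ 3 = κ⁻¹ := by rw [hκdef]; simp
  let V : ℂ → ℝ := fun z => velocity g (m₀ + z.re) (κ * z.im)
  let F : ℂ → ℝ := fun z => force g g₁ (m₀ + z.re) (κ * z.im)
  let N : ℂ → ℂ := fun z => (V z - z.im : ℝ) + Complex.I * (κ⁻¹ * (F z - g₁ m₀) + z.re : ℝ)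
  have hN0 : N 0 = 0 := by simp [N, V, F, velocity, force]
  have hN : ∀ ε > 0, ∃ ρ > 0, ∀ z w, ‖z‖ ≤ ρ → ‖w‖ ≤ ρ → ‖N z - N w‖ ≤ ε * ‖z - w‖ := by
    intro ε hε
    set ε₁ := ε / ((1 + κ) * (1 + κ⁻¹)) with hε₁
    have hε₁p : 0 < ε₁ := by positivity
    obtain ⟨ρ₁, hρ₁, H₁⟩ := strictAt_velocity hg m₀ ε₁ hε₁p
    obtain ⟨ρ₂, hρ₂, H₂⟩ := strictAt_force hg m₀ ε₁ hε₁p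
    refine ⟨min ρ₁ ρ₂ / (1 + κ), by positivity, fun z w hz hw => ?_⟩
    have box : ∀ z : ℂ, ‖z‖ ≤ min ρ₁ ρ₂ / (1 + κ) →
        |m₀ + z.re - m₀| ≤ min ρ₁ ρ₂ ∧ |κ * z.im| ≤ min ρ₁ ρ₂ := by
      intro z hz
      rw [le_div_iff₀ (by positivity)] at hz
      have h1 := Complex.abs_re_le_norm z
      have h2 := Complex.abs_im_le_norm z
      have h3 := norm_nonneg z
      rw [abs_mul, abs_of_pos hκ, add_sub_cancel_left]
      constructor <;> nlinarith
    obtain ⟨z1, z2⟩ := box z hz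
    obtain ⟨w1, w2⟩ := box w hw
    have k1 := H₁ _ _ _ _ (w1.trans (min_le_left _ _)) (w2.trans (min_le_left _ _))
      (z1.trans (min_le_left _ _)) (z2.trans (min_le_left _ _))
    have k2 := H₂ _ _ _ _ (w1.trans (min_le_right _ _)) (w2.trans (min_le_right _ _))
      (z1.trans (min_le_right _ _)) (z2.trans (min_le_right _ _))
    have hr : |m₀ + z.re - (m₀ + w.re)| + |κ * z.im - κ * w.im| ≤ (1 + κ) * ‖z - w‖ := by
      have h1 := Complex.abs_re_le_norm (z - w)
      have h2 := Complex.abs_im_le_norm (z - w)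
      rw [Complex.sub_re] at h1
      rw [Complex.sub_im] at h2
      rw [← mul_sub, abs_mul, abs_of_pos hκ, add_sub_add_left_eq_sub]
      nlinarith
    have k1' := k1.trans (mul_le_mul_of_nonneg_left hr hε₁p.le)
    have k2' := k2.trans (mul_le_mul_of_nonneg_left hr hε₁p.le)
    rw [hκi] at k1'
    rw [h₂] at k2'
    have e : N z - N w = ((V z - V w - (z.im - w.im) : ℝ) : ℂ)
        + Complex.I * ((κ⁻¹ * (F z - F w + κ * (z.re - w.re)) : ℝ) : ℂ) := by
      have : κ⁻¹ * (F z - F w + κ * (z.re - w.re)) = κ⁻¹ * (F z - F w) + (z.re - w.re) := by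
        field_simp
      rw [this]
      simp only [N]
      push_cast
      ring
    have b1 : |V z - V w - (z.im - w.im)| ≤ ε₁ * ((1 + κ) * ‖z - w‖) := by
      have : V z - V w - (z.im - w.im) = V z - V w
          - (0 * (m₀ + z.re - (m₀ + w.re)) + κ⁻¹ * (κ * z.im - κ * w.im)) := by
        rw [← mul_sub, inv_mul_cancel_left₀ hκ.ne']; ring
      rw [this]; exact k1'
    have b2 : |F z - F w + κ * (z.re - w.re)| ≤ ε₁ * ((1 + κ) * ‖z - w‖) := by
      have : F z - F w + κ * (z.re - w.re) = F z - F w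
          - (-κ * (m₀ + z.re - (m₀ + w.re)) + 0 * (κ * z.im - κ * w.im)) := by ring
      rw [this]; exact k2'
    rw [e]
    calc _ ≤ ‖((V z - V w - (z.im - w.im) : ℝ) : ℂ)‖
          + ‖Complex.I * ((κ⁻¹ * (F z - F w + κ * (z.re - w.re)) : ℝ) : ℂ)‖ := norm_add_le _ _
      _ = |V z - V w - (z.im - w.im)| + κ⁻¹ * |F z - F w + κ * (z.re - w.re)| := by
        rw [norm_mul, Complex.norm_I, one_mul, Complex.norm_real, Complex.norm_real,
          Real.norm_eq_abs, Real.norm_eq_abs, abs_mul, abs_of_pos (inv_pos.2 hκ)]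
      _ ≤ ε₁ * ((1 + κ) * ‖z - w‖) + κ⁻¹ * (ε₁ * ((1 + κ) * ‖z - w‖)) := by gcongr
      _ = ε * ‖z - w‖ := by rw [hε₁]; field_simp
  obtain ⟨ρ, hρ, hvel⟩ := strictAt_velocity hg m₀ 1 one_pos
  have hcont : ContinuousAt (fun z : ℝ × ℝ => g z.1 ^ 2 * z.2 ^ 2) (m₀, 0) := by
    have := hg.continuous
    fun_prop
  have hev := hcont.eventually_lt (continuousAt_const (y := (1:ℝ))) (by simp)
  rw [Metric.eventually_nhds_iff] at hev
  obtain ⟨σ, hσ, hsig⟩ := hev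
  -- Below `ρ` the velocity is nearly linear, below `σ/2` one has `g²q² < 1`, and the last bound
  -- serves for `v'`, which is at most `κ⁻¹ δ₁ + 2 δ₁`.
  set δ₁ := min (min δ ρ) (min (σ / 2) (δ / (2 + κ⁻¹))) with hδ₁
  have hδ₁p : 0 < δ₁ := by positivity
  obtain ⟨η, hη, H⟩ := exists_loop_of_small_lipschitz hN0 hN (δ := δ₁ / (1 + κ)) (by positivity)
  refine ⟨η, hη, fun m x hm hx => ?_⟩
  obtain ⟨ζ, h, b, c, hd, hp, hmean, hcos, hsin, hbd⟩ := H (m - m₀) x hm hx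
  have hre : ∀ θ, |(ζ θ).re| ≤ δ₁ ∧ |κ * (ζ θ).im| ≤ δ₁ := by
    intro θ
    have h0 := hbd θ
    rw [le_div_iff₀ (by positivity)] at h0
    have h1 := Complex.abs_re_le_norm (ζ θ)
    have h2 := Complex.abs_im_le_norm (ζ θ)
    have h3 := norm_nonneg (ζ θ)
    rw [abs_mul, abs_of_pos hκ]
    constructor <;> nlinarith
  have hδ₁δ : δ₁ ≤ δ := (min_le_left _ _).trans (min_le_left _ _)
  have hδ₁ρ : δ₁ ≤ ρ := (min_le_left _ _).trans (min_le_right _ _)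
  have hδ₁σ : δ₁ ≤ σ / 2 := (min_le_right _ _).trans (min_le_left _ _)
  have hδ₁κ : δ₁ ≤ δ / (2 + κ⁻¹) := (min_le_right _ _).trans (min_le_right _ _)
  have dre : ∀ θ, HasDerivAt (fun θ => m₀ + (ζ θ).re) (V (ζ θ)) θ := by
    intro θ
    have := (Complex.reCLM.hasFDerivAt.comp_hasDerivAt θ (hd θ)).const_add m₀
    refine this.congr_deriv ?_
    simp [N]
  have dim : ∀ θ, HasDerivAt (fun θ => κ * (ζ θ).im) (F (ζ θ)
      + ((κ * h - g₁ m₀) + (κ * b) * cos θ + (κ * c) * sin θ)) θ := by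
    intro θ
    have := (Complex.imCLM.hasFDerivAt.comp_hasDerivAt θ (hd θ)).const_mul κ
    refine this.congr_deriv ?_
    simp only [N, Complex.imCLM_apply, Complex.add_im, Complex.ofReal_im, Complex.mul_im,
      Complex.ofReal_re, Complex.I_re, Complex.I_im, Complex.neg_im, Complex.neg_re]
    field_simp
    ring
  have hcζ : Continuous ζ := continuous_iff_continuousAt.2 fun θ => (hd θ).continuousAt
  have hcre : Continuous fun θ => (ζ θ).re := Complex.continuous_re.comp hcζ
  have hcim : Continuous fun θ => (ζ θ).im := Complex.continuous_im.comp hcζ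
  have hsine : ∀ θ, g (m₀ + (ζ θ).re) ^ 2 * (κ * (ζ θ).im) ^ 2 < 1 := by
    intro θ
    refine @hsig (m₀ + (ζ θ).re, κ * (ζ θ).im) ?_
    rw [Prod.dist_eq]
    simp only [Real.dist_eq, sub_zero, max_lt_iff, add_sub_cancel_left]
    obtain ⟨h1, h2⟩ := hre θ
    constructor <;> linarith
  have hVc : Continuous fun θ => V (ζ θ) := by
    have := hg.continuous
    simp only [V, velocity]
    refine Continuous.div (by fun_prop) (by fun_prop) fun θ => ?_
    exact (sqrt_pos.2 (by linarith [hsine θ])).ne'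
  have hmod : HasModes (fun θ => m₀ + (ζ θ).re) m x := by
    have := (hasModes_const m₀).add (w := fun _ => m₀) (u := fun θ => (ζ θ).re) (n := m - m₀)
      (y := x) ⟨hmean, hcos, hsin⟩ continuous_const hcre
    rwa [add_sub_cancel, zero_add] at this
  -- `N` contains the force minus its value `g₁ m₀`, so this value moves into the multiplier.
  refine ⟨fun θ => m₀ + (ζ θ).re, fun θ => V (ζ θ), fun θ => κ * (ζ θ).im, κ * h - g₁ m₀, κ * b,
    κ * c, ⟨⟨dre, hVc, fun θ => by simp only [hp θ]⟩, hsine, fun θ => rfl, dim,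
    fun θ => by simp only [hp θ]⟩, hmod, fun θ => ⟨?_, ?_, (hre θ).2.trans hδ₁δ⟩⟩
  · rw [add_sub_cancel_left]; exact (hre θ).1.trans hδ₁δ
  · have k := hvel m₀ 0 (m₀ + (ζ θ).re) (κ * (ζ θ).im) (by simpa using hρ.le) (by simpa using hρ.le)
      (by rw [add_sub_cancel_left]; exact (hre θ).1.trans hδ₁ρ) ((hre θ).2.trans hδ₁ρ)
    have h0 : velocity g m₀ 0 = 0 := by simp [velocity]
    rw [h0, hκi, add_sub_cancel_left, sub_zero, sub_zero, zero_mul, zero_add, one_mul] at k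
    have k2 := abs_sub_abs_le_abs_sub (V (ζ θ)) (κ⁻¹ * (κ * (ζ θ).im))
    rw [abs_mul κ⁻¹, abs_of_pos (inv_pos.2 hκ)] at k2
    obtain ⟨h1, h2⟩ := hre θ
    rw [le_div_iff₀ (by positivity)] at hδ₁κ
    have h3 := mul_le_mul_of_nonneg_left h2 (inv_pos.2 hκ).le
    change |V (ζ θ)| ≤ δ
    change |V (ζ θ) - _| ≤ _ at k
    linarith

/-! ### Minimality of critical loops with fixed modes, and the multipliers -/

/-- The gradient of the density is strictly differentiable at `(m₀, 0)` with matrix `diag(-κ, κ)`,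
and the mean value theorem is applied along the segment. Strictness makes the expansion uniform in
the base point `(v₁, p₁)`, which will vary along a critical loop. -/
theorem abs_lengthDensity_sub_quadratic_le (hg : IsRadius g g₁ g₂) {m₀ κ : ℝ} (hκ : 1 / g m₀ ^ 3 = κ)
    (h₂ : g₂ m₀ = -κ) {ε : ℝ} (hε : 0 < ε) :
    ∃ ρ > 0, ∀ v₁ p₁ v₂ p₂ : ℝ, |v₁ - m₀| ≤ ρ → |p₁| ≤ ρ → |v₂ - m₀| ≤ ρ → |p₂| ≤ ρ →
      |lengthDensity g v₂ p₂ - (lengthDensity g v₁ p₁ + densityV g g₁ v₁ p₁ * (v₂ - v₁)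
        + densityP g v₁ p₁ * (p₂ - p₁) + κ / 2 * ((p₂ - p₁) ^ 2 - (v₂ - v₁) ^ 2))|
        ≤ ε * ((v₂ - v₁) ^ 2 + (p₂ - p₁) ^ 2) := by
  obtain ⟨ρ₁, hρ₁, H₁⟩ := strictAt_densityV hg m₀ (ε / 2) (by positivity)
  obtain ⟨ρ₂, hρ₂, H₂⟩ := strictAt_densityP hg m₀ (ε / 2) (by positivity)
  refine ⟨min ρ₁ ρ₂, by positivity, fun v₁ p₁ v₂ p₂ a1 a2 a3 a4 => ?_⟩
  set a := v₂ - v₁ with ha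
  set b := p₂ - p₁ with hb
  set A := densityV g g₁ v₁ p₁
  set B := densityP g v₁ p₁
  have hd : ∀ s, HasDerivAt (fun s => lengthDensity g (v₁ + s * a) (p₁ + s * b) - s * (A * a + B * b)
      - s ^ 2 * (κ / 2 * (b ^ 2 - a ^ 2)))
      (densityV g g₁ (v₁ + s * a) (p₁ + s * b) * a + densityP g (v₁ + s * a) (p₁ + s * b) * b
        - (A * a + B * b) - s * (κ * (b ^ 2 - a ^ 2))) s := by
    intro s
    have d1 : HasDerivAt (fun s => v₁ + s * a) a s := by
      simpa using ((hasDerivAt_id s).mul_const a).const_add v₁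
    have d2 : HasDerivAt (fun s => p₁ + s * b) b s := by
      simpa using ((hasDerivAt_id s).mul_const b).const_add p₁
    have d3 := ((hasDerivAt_lengthDensity hg d1 d2).sub
      ((hasDerivAt_id s).mul_const (A * a + B * b))).sub
        (((hasDerivAt_id s).pow 2).mul_const (κ / 2 * (b ^ 2 - a ^ 2)))
    refine d3.congr_deriv ?_
    simp
    ring
  obtain ⟨s, hs, e⟩ := exists_hasDerivAt_eq_slope _ _ one_pos
    (fun s _ => (hd s).continuousAt.continuousWithinAt) (fun s _ => hd s)
  have convexBox : ∀ x y ρ : ℝ, |x| ≤ ρ → |y| ≤ ρ → |x + s * (y - x)| ≤ ρ := by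
    intro x y ρ hx hy
    rw [abs_le] at *
    obtain ⟨hs0, hs1⟩ := hs
    constructor <;> nlinarith
  have b1 : |v₁ + s * a - m₀| ≤ min ρ₁ ρ₂ := by
    have := convexBox _ _ _ a1 a3
    rwa [show v₁ - m₀ + s * (v₂ - m₀ - (v₁ - m₀)) = v₁ + s * a - m₀ by rw [ha]; ring] at this
  have b2 : |p₁ + s * b| ≤ min ρ₁ ρ₂ := convexBox _ _ _ a2 a4
  have k1 := H₁ _ _ _ _ (a1.trans (min_le_left _ _)) (a2.trans (min_le_left _ _))
    (b1.trans (min_le_left _ _)) (b2.trans (min_le_left _ _))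
  have k2 := H₂ _ _ _ _ (a1.trans (min_le_right _ _)) (a2.trans (min_le_right _ _))
    (b1.trans (min_le_right _ _)) (b2.trans (min_le_right _ _))
  rw [h₂] at k1
  rw [hκ] at k2
  simp only [add_sub_cancel_left, abs_mul, abs_of_pos hs.1] at k1 k2
  have m1 : |(densityV g g₁ (v₁ + s * a) (p₁ + s * b) - A - (-κ * (s * a) + 0 * (s * b))) * a|
      ≤ ε / 2 * (|a| + |b|) * |a| := by
    rw [abs_mul]
    refine mul_le_mul_of_nonneg_right (k1.trans ?_) (abs_nonneg _)
    have := hs.2.le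
    exact mul_le_mul_of_nonneg_left (add_le_add (mul_le_of_le_one_left (abs_nonneg a) this)
      (mul_le_of_le_one_left (abs_nonneg b) this)) (by positivity)
  have m2 : |(densityP g (v₁ + s * a) (p₁ + s * b) - B - (0 * (s * a) + κ * (s * b))) * b|
      ≤ ε / 2 * (|a| + |b|) * |b| := by
    rw [abs_mul]
    refine mul_le_mul_of_nonneg_right (k2.trans ?_) (abs_nonneg _)
    have := hs.2.le
    exact mul_le_mul_of_nonneg_left (add_le_add (mul_le_of_le_one_left (abs_nonneg a) this)
      (mul_le_of_le_one_left (abs_nonneg b) this)) (by positivity)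
  obtain ⟨m1', m1''⟩ := abs_le.1 m1
  obtain ⟨m2', m2''⟩ := abs_le.1 m2
  clear k1 k2 H₁ H₂
  have m3 : ε / 2 * (|a| + |b|) * |a| + ε / 2 * (|a| + |b|) * |b| ≤ ε * (a ^ 2 + b ^ 2) := by
    have := sq_nonneg (|a| - |b|)
    rw [← sq_abs a, ← sq_abs b]
    have := mul_nonneg hε.le this
    linarith only [this]
  simp only [one_mul, zero_mul, add_zero, sub_zero, one_pow, div_one, ne_eq, OfNat.ofNat_ne_zero,
    not_false_eq_true, zero_pow] at e
  have e1 : v₁ + a = v₂ := by rw [ha]; ring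
  have e2 : p₁ + b = p₂ := by rw [hb]; ring
  rw [e1, e2] at e
  rw [abs_le]
  constructor
  · linarith only [e, m1', m2', m3]
  · linarith only [e, m1'', m2'', m3]

/-- With `ξ = w - v`, the linear term is `(q ξ)' - (h + b cos + c sin) ξ`; it integrates to zero
because `ξ` has no modes of order 0 and 1. The quadratic term is at least `κ (3/8 ξ'² - 5/8 ξ²)`,
whose integral is nonnegative as `∫ ξ'² ≥ 4 ∫ ξ²`. -/
theorem energy_le_of_isCritical (hg : IsRadius g g₁ g₂) {m₀ : ℝ} (h₂ : g₂ m₀ = -(1 / g m₀ ^ 3)) :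
    ∃ ρ > 0, ∀ (v v' q w w' : ℝ → ℝ) (h b c m : ℝ) (x : ℂ), IsCritical g g₁ v v' q h b c →
      IsLoop w w' → HasModes v m x → HasModes w m x →
      (∀ θ, |v θ - m₀| ≤ ρ ∧ |v' θ| ≤ ρ) → (∀ θ, |w θ - m₀| ≤ ρ ∧ |w' θ| ≤ ρ) →
      energy g v v' ≤ energy g w w' := by
  have hpos := hg.pos m₀
  set κ := 1 / g m₀ ^ 3 with hκ
  have hκp : 0 < κ := by positivity
  obtain ⟨ρ, hρ, H⟩ := abs_lengthDensity_sub_quadratic_le hg hκ.symm h₂ (ε := κ / 8) (by positivity)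
  refine ⟨ρ, hρ, fun v v' q w w' h b c m x hv hw mv mw bv bw => ?_⟩
  have cw := hw.continuous
  have cv := hv.isLoop.continuous
  have cw' := hw.continuous_deriv
  have cv' := hv.isLoop.continuous_deriv
  have cg := hg.continuous
  have cg₁ := hg.continuous₁
  have hξ := hw.sub hv.isLoop
  have cq : Continuous q := continuous_iff_continuousAt.2 fun θ => (hv.hasDerivAt θ).continuousAt
  have mξ := mw.sub mv cw cv
  rw [sub_self, sub_self] at mξ
  set ξ := fun θ => w θ - v θ with hξdef
  set ξ' := fun θ => w' θ - v' θ with hξ'def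
  have cξ : Continuous ξ := hξ.continuous
  have cξ' : Continuous ξ' := hξ.continuous_deriv
  have i0 : ∫ θ in (0:ℝ)..2 * π, ξ θ = 0 := by rw [mξ.mean]; ring
  have i1 : ∫ θ in (0:ℝ)..2 * π, ξ θ * cos θ = 0 := by rw [mξ.cos]; simp
  have i2 : ∫ θ in (0:ℝ)..2 * π, ξ θ * sin θ = 0 := by rw [mξ.sin]; simp
  have W := wirtinger_second hξ i0 i1 i2
  have cF : Continuous fun θ => force g g₁ (v θ) (q θ) := by
    unfold force
    refine Continuous.div (by fun_prop) (by fun_prop) fun θ => ?_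
    exact (sqrt_pos.2 (by linarith [hv.sine_pos θ])).ne'
  have hprod : IsLoop (fun θ => q θ * ξ θ) (fun θ =>
      (force g g₁ (v θ) (q θ) + (h + b * cos θ + c * sin θ)) * ξ θ + q θ * ξ' θ) :=
    ⟨fun θ => (hv.hasDerivAt θ).mul (hξ.hasDerivAt θ), by fun_prop, hv.periodic.mul hξ.periodic⟩
  have i3 := hprod.integral_deriv
  have cLw : Continuous fun θ => lengthDensity g (w θ) (w' θ) :=
    (continuous_lengthDensity hg).comp (cw.prodMk cw')
  have cLv : Continuous fun θ => lengthDensity g (v θ) (v' θ) :=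
    (continuous_lengthDensity hg).comp (cv.prodMk cv')
  have pt : ∀ θ, lengthDensity g (v θ) (v' θ)
      + ((force g g₁ (v θ) (q θ) + (h + b * cos θ + c * sin θ)) * ξ θ + q θ * ξ' θ)
      + (-h * ξ θ + (-b * (ξ θ * cos θ) + (-c * (ξ θ * sin θ)
      + (3 / 8 * κ * ξ' θ ^ 2 + -(5 / 8 * κ) * ξ θ ^ 2)))) ≤ lengthDensity g (w θ) (w' θ) := by
    intro θ
    have := (abs_le.1 (H _ _ _ _ (bv θ).1 (bv θ).2 (bw θ).1 (bw θ).2)).1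
    have e1 : densityV g g₁ (v θ) (v' θ) = force g g₁ (v θ) (q θ) := by
      rw [hv.velocity, densityV_velocity hg (hv.sine_pos θ)]
    have e2 : densityP g (v θ) (v' θ) = q θ := by
      rw [hv.velocity, densityP_velocity hg (hv.sine_pos θ)]
    rw [e1, e2] at this
    change -(_ * (ξ θ ^ 2 + ξ' θ ^ 2)) ≤ _ - (_ + _ * ξ θ + _ * ξ' θ + _ * (ξ' θ ^ 2 - ξ θ ^ 2)) at this
    linarith
  have int : ∀ f : ℝ → ℝ, Continuous f → IntervalIntegrable f MeasureTheory.volume 0 (2 * π) :=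
    fun f hf => hf.intervalIntegrable _ _
  have key := intervalIntegral.integral_mono (by positivity) (int _ (by fun_prop))
    (int _ (by fun_prop)) pt
  rw [intervalIntegral.integral_add (int _ (by fun_prop)) (int _ (by fun_prop)),
    intervalIntegral.integral_add (int _ (by fun_prop)) (int _ (by fun_prop)), i3,
    intervalIntegral.integral_add (int _ (by fun_prop)) (int _ (by fun_prop)),
    intervalIntegral.integral_add (int _ (by fun_prop)) (int _ (by fun_prop)),
    intervalIntegral.integral_add (int _ (by fun_prop)) (int _ (by fun_prop)),
    intervalIntegral.integral_add (int _ (by fun_prop)) (int _ (by fun_prop))] at key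
  simp only [intervalIntegral.integral_const_mul] at key
  rw [i0, i1, i2] at key
  have n0 : 0 ≤ ∫ θ in (0:ℝ)..2 * π, ξ θ ^ 2 :=
    intervalIntegral.integral_nonneg (by positivity) fun θ _ => sq_nonneg _
  have n1 := mul_le_mul_of_nonneg_left W hκp.le
  have n2 := mul_nonneg hκp.le n0
  unfold energy
  linarith

/-- The first variation along `harmonic u` is `-π (b u.re + c u.im)`, so minimality under these
shifts forces `b = c = 0`. -/
theorem multipliers_eq_zero (hg : IsRadius g g₁ g₂) {m₀ : ℝ} (h₂ : g₂ m₀ = -(1 / g m₀ ^ 3)) :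
    ∃ ρ > 0, ∀ (v v' q : ℝ → ℝ) (h b c σ : ℝ), IsCritical g g₁ v v' q h b c →
      (∀ θ, |v θ - m₀| ≤ ρ ∧ |v' θ| ≤ ρ) → 0 < σ →
      (∀ u : ℂ, ‖u‖ ≤ σ → energy g v v'
        ≤ energy g (fun θ => v θ + harmonic u θ) (fun θ => v' θ + harmonicDeriv u θ)) →
      b = 0 ∧ c = 0 := by
  have hpos := hg.pos m₀
  have hπ := pi_pos
  set κ := 1 / g m₀ ^ 3 with hκ
  have hκp : 0 < κ := by positivity
  obtain ⟨ρ, hρ, H⟩ := abs_lengthDensity_sub_quadratic_le hg hκ.symm h₂ (ε := κ) (by positivity)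
  refine ⟨ρ / 2, by positivity, fun v v' q h b c σ hv bv hσ hmin => ?_⟩
  set N := b ^ 2 + c ^ 2 with hN
  have hN0 : 0 ≤ N := by positivity
  set T := min (min (σ / (N + 1)) (ρ / (2 * (N + 1)))) (1 / (8 * κ)) with hT
  have hT0 : 0 < T := by positivity
  -- Steepest descent: the linear gain is `π T (b² + c²)`, the loss at most `4πκ T² (b² + c²)`, and
  -- `T ≤ 1/(8κ)` makes the loss at most half of the gain.
  set u : ℂ := ⟨T * b, T * c⟩ with hu
  have hu2 : ‖u‖ ^ 2 = T ^ 2 * N := by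
    rw [Complex.sq_norm, Complex.normSq_apply, hu, hN]; ring
  have hun : ‖u‖ ≤ T * (N + 1) :=
    (abs_le_of_sq_le_sq' (by rw [hu2, mul_pow]; gcongr; nlinarith) (by positivity)).2
  have hu1 : ‖u‖ ≤ σ := by
    have : T ≤ σ / (N + 1) := (min_le_left _ _).trans (min_le_left _ _)
    rw [le_div_iff₀ (by positivity)] at this
    linarith
  have hu3 : ‖u‖ ≤ ρ / 2 := by
    have : T ≤ ρ / (2 * (N + 1)) := (min_le_left _ _).trans (min_le_right _ _)
    rw [le_div_iff₀ (by positivity)] at this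
    linarith
  have cv := hv.isLoop.continuous
  have cv' := hv.isLoop.continuous_deriv
  have cg := hg.continuous
  have cg₁ := hg.continuous₁
  have cq : Continuous q := continuous_iff_continuousAt.2 fun θ => (hv.hasDerivAt θ).continuousAt
  have hξ := isLoop_harmonic u
  have cξ := hξ.continuous
  have cξ' := hξ.continuous_deriv
  have mξ := hasModes_harmonic u
  have cF : Continuous fun θ => force g g₁ (v θ) (q θ) := by
    unfold force
    refine Continuous.div (by fun_prop) (by fun_prop) fun θ => ?_
    exact (sqrt_pos.2 (by linarith [hv.sine_pos θ])).ne'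
  have hprod : IsLoop (fun θ => q θ * harmonic u θ) (fun θ =>
      (force g g₁ (v θ) (q θ) + (h + b * cos θ + c * sin θ)) * harmonic u θ
        + q θ * harmonicDeriv u θ) :=
    ⟨fun θ => (hv.hasDerivAt θ).mul (hξ.hasDerivAt θ), by fun_prop, hv.periodic.mul hξ.periodic⟩
  have i3 := hprod.integral_deriv
  have cLw : Continuous fun θ => lengthDensity g (v θ + harmonic u θ) (v' θ + harmonicDeriv u θ) :=
    (continuous_lengthDensity hg).comp ((cv.add cξ).prodMk (cv'.add cξ'))
  have cLv : Continuous fun θ => lengthDensity g (v θ) (v' θ) :=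
    (continuous_lengthDensity hg).comp (cv.prodMk cv')
  have pt : ∀ θ, lengthDensity g (v θ + harmonic u θ) (v' θ + harmonicDeriv u θ)
      ≤ lengthDensity g (v θ) (v' θ)
      + ((force g g₁ (v θ) (q θ) + (h + b * cos θ + c * sin θ)) * harmonic u θ
        + q θ * harmonicDeriv u θ)
      + (-h * harmonic u θ + (-b * (harmonic u θ * cos θ) + (-c * (harmonic u θ * sin θ)
      + 2 * κ * (T ^ 2 * N)))) := by
    intro θ
    have a1 := abs_harmonic_le u θ
    have a2 := abs_harmonicDeriv_le u θ
    have := (abs_le.1 (H (v θ) (v' θ) (v θ + harmonic u θ) (v' θ + harmonicDeriv u θ)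
      (by linarith [(bv θ).1]) (by linarith [(bv θ).2])
      (by rw [add_sub_right_comm]; exact (abs_add_le _ _).trans (by linarith [(bv θ).1]))
      ((abs_add_le _ _).trans (by linarith [(bv θ).2])))).2
    have e1 : densityV g g₁ (v θ) (v' θ) = force g g₁ (v θ) (q θ) := by
      rw [hv.velocity, densityV_velocity hg (hv.sine_pos θ)]
    have e2 : densityP g (v θ) (v' θ) = q θ := by
      rw [hv.velocity, densityP_velocity hg (hv.sine_pos θ)]
    rw [e1, e2, add_sub_cancel_left, add_sub_cancel_left] at this
    have e3 := harmonic_sq_add u θ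
    rw [hu2] at e3
    have e4 := mul_nonneg hκp.le (sq_nonneg (harmonic u θ))
    rw [← e3]
    have e5 := mul_nonneg hκp.le (sq_nonneg (harmonicDeriv u θ))
    linarith
  have int : ∀ f : ℝ → ℝ, Continuous f → IntervalIntegrable f MeasureTheory.volume 0 (2 * π) :=
    fun f hf => hf.intervalIntegrable _ _
  have key := intervalIntegral.integral_mono (by positivity) (int _ cLw)
    (int _ (by fun_prop)) pt
  rw [intervalIntegral.integral_add (int _ (by fun_prop)) (int _ (by fun_prop)),
    intervalIntegral.integral_add (int _ (by fun_prop)) (int _ (by fun_prop)), i3,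
    intervalIntegral.integral_add (int _ (by fun_prop)) (int _ (by fun_prop)),
    intervalIntegral.integral_add (int _ (by fun_prop)) (int _ (by fun_prop)),
    intervalIntegral.integral_add (int _ (by fun_prop)) (int _ (by fun_prop))] at key
  simp only [intervalIntegral.integral_const_mul, intervalIntegral.integral_const, smul_eq_mul]
    at key
  rw [mξ.mean, mξ.cos, mξ.sin] at key
  have hm := hmin u hu1
  unfold energy at hm
  have hTκ : T * (8 * κ) ≤ 1 := by
    rw [← le_div_iff₀ (by positivity)]; exact min_le_right _ _
  have k1 : π * T * N ≤ 4 * π * κ * (T ^ 2 * N) := by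
    rw [hu] at key
    simp only at key
    have : π * T * N = b * (π * (T * b)) + c * (π * (T * c)) := by rw [hN]; ring
    linarith
  have k2 : 4 * π * κ * (T ^ 2 * N) ≤ 1 / 2 * (π * T * N) := by
    have := mul_le_mul_of_nonneg_right hTκ (by positivity : 0 ≤ π * T * N)
    linarith
  have k3 : π * T * N ≤ 0 := by linarith
  have k4 : N ≤ 0 := by
    by_contra hc
    push Not at hc
    have : 0 < π * T * N := by positivity
    linarith
  constructor <;> nlinarith [sq_nonneg b, sq_nonneg c]

/-- It serves to compare loops with slightly different means or modes. -/
theorem exists_energy_lipschitz (hg : IsRadius g g₁ g₂) (m₀ : ℝ) :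
    ∃ ρ > 0, ∃ C > 0, ∀ (w w' u u' : ℝ → ℝ) (d : ℝ), IsLoop w w' → IsLoop u u' →
      (∀ θ, |w θ - m₀| ≤ ρ ∧ |w' θ| ≤ ρ) → (∀ θ, |u θ - m₀| ≤ ρ ∧ |u' θ| ≤ ρ) →
      (∀ θ, |w θ - u θ| ≤ d ∧ |w' θ - u' θ| ≤ d) → energy g w w' ≤ energy g u u' + C * d := by
  obtain ⟨ρ, hρ, H⟩ := strictAt_lengthDensity hg m₀ 1 one_pos
  refine ⟨ρ, hρ, 2 * π * (|g₁ m₀| + 2), by positivity, fun w w' u u' d hw hu bw bu hd => ?_⟩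
  have cw := hw.continuous
  have cw' := hw.continuous_deriv
  have cu := hu.continuous
  have cu' := hu.continuous_deriv
  have cLw : Continuous fun θ => lengthDensity g (w θ) (w' θ) :=
    (continuous_lengthDensity hg).comp (cw.prodMk cw')
  have cLu : Continuous fun θ => lengthDensity g (u θ) (u' θ) :=
    (continuous_lengthDensity hg).comp (cu.prodMk cu')
  have pt : ∀ θ, lengthDensity g (w θ) (w' θ) ≤ lengthDensity g (u θ) (u' θ)
      + (|g₁ m₀| + 2) * d := by
    intro θ
    have k := (abs_le.1 (H _ _ _ _ (bu θ).1 (bu θ).2 (bw θ).1 (bw θ).2)).2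
    obtain ⟨h1, h2⟩ := hd θ
    have h3 : g₁ m₀ * (w θ - u θ) ≤ |g₁ m₀| * d :=
      (le_abs_self _).trans (by rw [abs_mul]; gcongr)
    linarith
  have key := intervalIntegral.integral_mono (μ := MeasureTheory.volume) (a := 0) (b := 2 * π)
    (by positivity) (cLw.intervalIntegrable _ _)
    (Continuous.intervalIntegrable (by fun_prop) _ _) pt
  rw [intervalIntegral.integral_add (cLu.intervalIntegrable _ _)
    (continuous_const.intervalIntegrable _ _), intervalIntegral.integral_const, smul_eq_mul,
    sub_zero] at key
  unfold energy
  linarith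

/-! ### Estimates for the third and fourth order terms -/

/-- A cubic and quartic polynomial, even in `p`. -/
def higherTerms (α β A B C s p : ℝ) : ℝ :=
  α * s ^ 3 + β * (s * p ^ 2) + A * s ^ 4 + B * (s ^ 2 * p ^ 2) + C * p ^ 4

/-- `X` has weight one and `M` weight two, since the correction to a first harmonic is quadratic in
its amplitude. Terms of weight at least five are small compared with `X⁴ + M²`. -/
theorem mul_add_pow_three_le {X M η : ℝ} (hX : 0 ≤ X) (hM : 0 ≤ M) (hXη : X ≤ η) (hMη : M ≤ 2 * η)
    (hη1 : η ≤ 1) : M * (X + M) ^ 3 ≤ 20 * η * (X ^ 4 + M ^ 2) := by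
  have hη : 0 ≤ η := hX.trans hXη
  have h1 : (X + M) ^ 3 ≤ 4 * (X ^ 3 + M ^ 3) := by
    nlinarith [mul_nonneg (add_nonneg hX hM) (sq_nonneg (X - M))]
  have h2 : M * X ^ 3 ≤ η * (X ^ 4 + M ^ 2) := by
    have : M * X ^ 3 ≤ X * (X ^ 4 + M ^ 2) := by
      nlinarith [mul_nonneg hX (sq_nonneg (M - X ^ 2)), mul_nonneg hX (sq_nonneg (X ^ 2)),
        mul_nonneg hX (sq_nonneg M)]
    exact this.trans (mul_le_mul_of_nonneg_right hXη (by positivity))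
  have h3 : M ^ 4 ≤ 4 * η * M ^ 2 := by
    have : M ^ 2 ≤ 4 * η := by nlinarith
    nlinarith [sq_nonneg M]
  have h4 : 0 ≤ η * X ^ 4 := by positivity
  nlinarith [mul_le_mul_of_nonneg_left h1 hM]

theorem add_pow_five_le {X M η : ℝ} (hX : 0 ≤ X) (hM : 0 ≤ M) (hXη : X ≤ η) (hMη : M ≤ 2 * η)
    (hη1 : η ≤ 1) : (X + M) ^ 5 ≤ 128 * η * (X ^ 4 + M ^ 2) := by
  have hη : 0 ≤ η := hX.trans hXη
  have h1 : (X + M) ^ 5 ≤ 16 * (X ^ 5 + M ^ 5) := by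
    have := add_pow_le hX hM 5
    norm_num at this
    exact this
  have h2 : X ^ 5 ≤ η * X ^ 4 := by rw [pow_succ']; gcongr
  have h3 : M ^ 5 ≤ 8 * η * M ^ 2 := by
    have h4 : M ^ 3 ≤ (2 * η) ^ 3 := by gcongr
    have h5 : η ^ 3 ≤ η := pow_le_of_le_one hη hη1 (by norm_num)
    have : M ^ 5 = M ^ 3 * M ^ 2 := by ring
    rw [this]
    refine mul_le_mul_of_nonneg_right ?_ (sq_nonneg M)
    linarith [mul_pow 2 η 3]
  have h4 : 0 ≤ η * X ^ 4 := by positivity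
  linarith

/-- Here `c` will be the first harmonic and `y` the remainder, with derivatives `c'` and `z`. With
`y, z` of weight two, only the terms of weight at most four are kept; all others, and the fifth
order error, go into `ε`. -/
theorem higherTerms_ge (α β A B C K : ℝ) (hK : 0 ≤ K) {ε : ℝ} (hε : 0 < ε) :
    ∃ η > 0, ∀ X c c' y z : ℝ, X ≤ η → |c| ≤ X → |c'| ≤ X → |y| ≤ η → |z| ≤ η →
      α * c ^ 3 + β * (c * c' ^ 2) + 3 * α * (c ^ 2 * y) + β * (y * c' ^ 2) + 2 * β * (c * c' * z)
        + A * c ^ 4 + B * (c ^ 2 * c' ^ 2) + C * c' ^ 4 - ε * (X ^ 4 + y ^ 2 + z ^ 2)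
      ≤ higherTerms α β A B C (c + y) (c' + z)
        - K * (|c + y| ^ 5 + |c + y| ^ 3 * |c' + z| ^ 2 + |c + y| * |c' + z| ^ 4) := by
  set S := |A| + |B| + |C| with hS
  set L := 12 * (|α| + |β|) + 80 * S + 384 * K + 1 with hL
  have hLp : 0 < L := by positivity
  -- `L` adds up the constants of the discarded terms: 12 for each cubic one, `4 · 20` for each
  -- quartic one, 384 for those of order five. The factor 2 comes from `M² ≤ 2 (y² + z²)`.
  refine ⟨min 1 (ε / (2 * L)), by positivity, fun X c c' y z hX hc hc' hy hz => ?_⟩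
  set η := min 1 (ε / (2 * L)) with hη
  have hη1 : η ≤ 1 := min_le_left _ _
  have hηL : η * (2 * L) ≤ ε := by
    rw [← le_div_iff₀ (by positivity)]; exact min_le_right _ _
  have hX0 : 0 ≤ X := (abs_nonneg _).trans hc
  have hη0 : 0 ≤ η := hX0.trans hX
  set M := |y| + |z| with hM
  have hM0 : 0 ≤ M := by positivity
  have hMη : M ≤ 2 * η := by rw [hM]; linarith
  have hyM : |y| ≤ M := by rw [hM]; linarith [abs_nonneg z]
  have hzM : |z| ≤ M := by rw [hM]; linarith [abs_nonneg y]
  set U := X + M with hU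
  have hU0 : 0 ≤ U := by positivity
  have hs : |c + y| ≤ U := (abs_add_le _ _).trans (by rw [hU]; linarith)
  have hp : |c' + z| ≤ U := (abs_add_le _ _).trans (by rw [hU]; linarith)
  have hcU : |c| ≤ U := by rw [hU]; linarith
  have hcU' : |c'| ≤ U := by rw [hU]; linarith
  have hMU : M ≤ U := by rw [hU]; linarith
  have hU3 : U ≤ 3 * η := by rw [hU]; linarith
  clear_value U M η
  have r1 : |3 * c * y ^ 2 + y ^ 3| ≤ 12 * η * M ^ 2 := by
    have e : 3 * c * y ^ 2 + y ^ 3 = (3 * c + y) * y ^ 2 := by ring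
    rw [e, abs_mul, abs_pow]
    have h1 : |3 * c + y| ≤ 12 * η := by
      refine (abs_add_le _ _).trans ?_
      rw [abs_mul, abs_of_pos (by norm_num : (0:ℝ) < 3)]
      linarith
    gcongr
  have r2 : |c * z ^ 2 + 2 * c' * y * z + y * z ^ 2| ≤ 12 * η * M ^ 2 := by
    calc _ ≤ |c * z ^ 2| + |2 * c' * y * z| + |y * z ^ 2| := abs_add_three _ _ _
      _ = |c| * |z| ^ 2 + 2 * |c'| * |y| * |z| + |y| * |z| ^ 2 := by
        simp only [abs_mul, abs_pow, abs_of_pos (by norm_num : (0:ℝ) < 2)]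
      _ ≤ U * M ^ 2 + 2 * U * M * M + U * M ^ 2 := by gcongr; exact hyM.trans hMU
      _ = 4 * U * M ^ 2 := by ring
      _ ≤ 4 * (3 * η) * M ^ 2 := by gcongr
      _ = _ := by ring
  have hquart := mul_add_pow_three_le hX0 hM0 hX hMη hη1
  rw [← hU] at hquart
  have q1 : ∀ u v t : ℝ, |u| ≤ U → |v| ≤ U → |t| ≤ M → v = u + t → |v ^ 4 - u ^ 4| ≤ 4 * (M * U ^ 3) := by
    intro u v t hu hv ht e
    have e1 : v ^ 4 - u ^ 4 = t * (v + u) * (v ^ 2 + u ^ 2) := by rw [e]; ring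
    rw [e1, abs_mul, abs_mul]
    have h1 : |v + u| ≤ 2 * U := (abs_add_le _ _).trans (by linarith)
    have h2 : |v ^ 2 + u ^ 2| ≤ 2 * U ^ 2 := by
      refine (abs_add_le _ _).trans ?_
      rw [abs_pow, abs_pow]
      have h3 : |v| ^ 2 ≤ U ^ 2 := by gcongr
      have h4 : |u| ^ 2 ≤ U ^ 2 := by gcongr
      linarith
    calc |t| * |v + u| * |v ^ 2 + u ^ 2| ≤ M * (2 * U) * (2 * U ^ 2) := by gcongr
      _ = _ := by ring
  have q2 : |(c + y) ^ 2 * (c' + z) ^ 2 - c ^ 2 * c' ^ 2| ≤ 4 * (M * U ^ 3) := by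
    have e1 : (c + y) ^ 2 * (c' + z) ^ 2 - c ^ 2 * c' ^ 2
        = (c * z + y * (c' + z)) * ((c + y) * (c' + z) + c * c') := by ring
    rw [e1, abs_mul]
    have h1 : |c * z + y * (c' + z)| ≤ U * M + M * U := by
      refine (abs_add_le _ _).trans ?_
      rw [abs_mul, abs_mul]; gcongr
    have h2 : |(c + y) * (c' + z) + c * c'| ≤ U * U + U * U := by
      refine (abs_add_le _ _).trans ?_
      rw [abs_mul, abs_mul]; gcongr
    calc _ ≤ (U * M + M * U) * (U * U + U * U) := by gcongr
      _ = _ := by ring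
  have q0 := q1 c (c + y) y hcU hs hyM rfl
  have q3 := q1 c' (c' + z) z hcU' hp hzM rfl
  have hquint := add_pow_five_le hX0 hM0 hX hMη hη1
  rw [← hU] at hquint
  have t : |c + y| ^ 5 + |c + y| ^ 3 * |c' + z| ^ 2 + |c + y| * |c' + z| ^ 4
      ≤ 384 * η * (X ^ 4 + M ^ 2) := by
    calc _ ≤ U ^ 5 + U ^ 3 * U ^ 2 + U * U ^ 4 := by gcongr
      _ = 3 * U ^ 5 := by ring
      _ ≤ _ := by linarith
  have hM2 : M ^ 2 ≤ 2 * (y ^ 2 + z ^ 2) := by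
    rw [hM, ← sq_abs y, ← sq_abs z]; exact add_sq_le
  have bd : ∀ k r b : ℝ, |r| ≤ b → -(|k| * b) ≤ k * r := by
    intro k r b h
    have := neg_abs_le (k * r)
    rw [abs_mul] at this
    linarith [mul_le_mul_of_nonneg_left h (abs_nonneg k)]
  have b1 := bd α _ _ r1
  have b2 := bd β _ _ r2
  have b3 := bd A _ _ (q0.trans (mul_le_mul_of_nonneg_left hquart (by norm_num)))
  have b4 := bd B _ _ (q2.trans (mul_le_mul_of_nonneg_left hquart (by norm_num)))
  have b5 := bd C _ _ (q3.trans (mul_le_mul_of_nonneg_left hquart (by norm_num)))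
  have b6 := mul_le_mul_of_nonneg_left t hK
  set W := X ^ 4 + M ^ 2 with hW
  have hW0 : 0 ≤ W := by positivity
  have hMW : M ^ 2 ≤ W := by rw [hW]; have : 0 ≤ X ^ 4 := by positivity
                             linarith
  have hfin : L * η * W ≤ ε * (X ^ 4 + y ^ 2 + z ^ 2) := by
    have h1 : W ≤ 2 * (X ^ 4 + y ^ 2 + z ^ 2) := by
      have : 0 ≤ X ^ 4 := by positivity
      rw [hW]; linarith
    calc L * η * W ≤ L * η * (2 * (X ^ 4 + y ^ 2 + z ^ 2)) := by gcongr
      _ = η * (2 * L) * (X ^ 4 + y ^ 2 + z ^ 2) := by ring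
      _ ≤ _ := by gcongr
  have hLe : L * η * W = |α| * (12 * η * W) + |β| * (12 * η * W) + |A| * (4 * (20 * η * W))
      + |B| * (4 * (20 * η * W)) + |C| * (4 * (20 * η * W)) + K * (384 * η * W) + η * W := by
    rw [hL, hS]; ring
  have w1 : |α| * (12 * η * M ^ 2) ≤ |α| * (12 * η * W) := by gcongr
  have w2 : |β| * (12 * η * M ^ 2) ≤ |β| * (12 * η * W) := by gcongr
  have w3 : 0 ≤ η * W := by positivity
  unfold higherTerms
  have expand : α * (c + y) ^ 3 + β * ((c + y) * (c' + z) ^ 2) + A * (c + y) ^ 4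
      + B * ((c + y) ^ 2 * (c' + z) ^ 2) + C * (c' + z) ^ 4
      = (α * c ^ 3 + β * (c * c' ^ 2) + 3 * α * (c ^ 2 * y) + β * (y * c' ^ 2)
        + 2 * β * (c * c' * z) + A * c ^ 4 + B * (c ^ 2 * c' ^ 2) + C * c' ^ 4)
        + (α * (3 * c * y ^ 2 + y ^ 3) + β * (c * z ^ 2 + 2 * c' * y * z + y * z ^ 2)
        + A * ((c + y) ^ 4 - c ^ 4) + B * ((c + y) ^ 2 * (c' + z) ^ 2 - c ^ 2 * c' ^ 2)
        + C * ((c' + z) ^ 4 - c' ^ 4)) := by ring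
  rw [expand]
  linarith only [b1, b2, b3, b4, b5, b6, w1, w2, w3, hfin, hLe]

/-! ### Taylor expansion of the length density -/

/-- Each use of the mean value inequality raises the order of a remainder by one. Iterated, it gives
Taylor's formula when the last derivative is merely differentiable at `m`. -/
theorem abs_sub_le_of_abs_deriv_le {φ φ' : ℝ → ℝ} {m ρ C : ℝ} {n : ℕ} (hC : 0 ≤ C)
    (hd : ∀ v, |v - m| ≤ ρ → HasDerivAt φ (φ' v) v)
    (hb : ∀ v, |v - m| ≤ ρ → |φ' v| ≤ C * |v - m| ^ n) {v : ℝ} (hv : |v - m| ≤ ρ) :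
    |φ v - φ m| ≤ C * |v - m| ^ (n + 1) := by
  have h := (convex_closedBall m |v - m|).norm_image_sub_le_of_norm_hasDerivWithin_le
    (f := φ) (f' := φ') (C := C * |v - m| ^ n) (x := m) (y := v)
    (fun u hu => (hd u ((by simpa [Real.dist_eq] using hu : |u - m| ≤ |v - m|).trans
      hv)).hasDerivWithinAt)
    (fun u hu => by
      have h1 : |u - m| ≤ |v - m| := by simpa [Real.dist_eq] using hu
      refine (hb u (h1.trans hv)).trans ?_
      gcongr) (by simp) (by simp [Real.dist_eq])
  rw [Real.norm_eq_abs, Real.norm_eq_abs] at h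
  rw [pow_succ, ← mul_assoc]
  exact h

theorem exists_abs_sub_le_of_hasDerivAt {φ : ℝ → ℝ} {φ' m : ℝ} (h : HasDerivAt φ φ' m) :
    ∃ ρ > 0, ∃ C ≥ 0, ∀ v, |v - m| ≤ ρ → |φ v - φ m| ≤ C * |v - m| := by
  obtain ⟨C, hC⟩ := h.isBigO_sub.bound
  obtain ⟨ρ, hρ, hb⟩ := Metric.eventually_nhds_iff.1 hC
  refine ⟨ρ / 2, by positivity, |C|, abs_nonneg _, fun v hv => ?_⟩
  have := hb (y := v) (by rw [Real.dist_eq]; linarith)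
  rw [Real.norm_eq_abs, Real.norm_eq_abs] at this
  exact this.trans (by gcongr; exact le_abs_self C)

theorem taylor_two {φ φ₁ φ₂ : ℝ → ℝ} {m d : ℝ} (h0 : ∀ v, HasDerivAt φ (φ₁ v) v)
    (h1 : ∀ v, HasDerivAt φ₁ (φ₂ v) v) (h2 : HasDerivAt φ₂ d m) :
    ∃ ρ > 0, ∃ C ≥ 0, ∀ v, |v - m| ≤ ρ →
      |φ v - (φ m + φ₁ m * (v - m) + φ₂ m / 2 * (v - m) ^ 2)| ≤ C * |v - m| ^ 3 := by
  obtain ⟨ρ, hρ, C, hC, H⟩ := exists_abs_sub_le_of_hasDerivAt h2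
  refine ⟨ρ, hρ, C, hC, fun v hv => ?_⟩
  have k1 : ∀ v, |v - m| ≤ ρ → |φ₁ v - φ₂ m * (v - m) - (φ₁ m - φ₂ m * (m - m))|
      ≤ C * |v - m| ^ (1 + 1) := fun v hv =>
    abs_sub_le_of_abs_deriv_le (φ := fun v => φ₁ v - φ₂ m * (v - m)) hC
      (fun v _ => ((h1 v).sub (((hasDerivAt_id v).sub_const m).const_mul (φ₂ m))).congr_deriv
        (by rw [mul_one])) (fun v hv => by simpa using H v hv) hv
  have k0 := abs_sub_le_of_abs_deriv_le
    (φ := fun v => φ v - (φ₁ m * (v - m) + φ₂ m / 2 * (v - m) ^ 2))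
    (φ' := fun v => φ₁ v - φ₂ m * (v - m) - (φ₁ m - φ₂ m * (m - m))) hC
    (fun v _ => by
      have := (hasDerivAt_id v).sub_const m
      refine ((h0 v).sub ((this.const_mul (φ₁ m)).add
        ((this.pow 2).const_mul (φ₂ m / 2)))).congr_deriv ?_
      simp; ring) k1 hv
  simpa [sub_sub, add_comm, add_left_comm, add_assoc] using k0

theorem taylor_four {φ φ₁ φ₂ φ₃ φ₄ : ℝ → ℝ} {m d : ℝ} (h0 : ∀ v, HasDerivAt φ (φ₁ v) v)
    (h1 : ∀ v, HasDerivAt φ₁ (φ₂ v) v) (h2 : ∀ v, HasDerivAt φ₂ (φ₃ v) v)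
    (h3 : ∀ v, HasDerivAt φ₃ (φ₄ v) v) (h4 : HasDerivAt φ₄ d m) :
    ∃ ρ > 0, ∃ C ≥ 0, ∀ v, |v - m| ≤ ρ →
      |φ v - (φ m + φ₁ m * (v - m) + φ₂ m / 2 * (v - m) ^ 2 + φ₃ m / 6 * (v - m) ^ 3
        + φ₄ m / 24 * (v - m) ^ 4)| ≤ C * |v - m| ^ 5 := by
  obtain ⟨ρ, hρ, C, hC, H⟩ := taylor_two h2 h3 h4
  refine ⟨ρ, hρ, C, hC, fun v hv => ?_⟩
  have k1 : ∀ v, |v - m| ≤ ρ → |φ₁ v - (φ₁ m + φ₂ m * (v - m) + φ₃ m / 2 * (v - m) ^ 2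
      + φ₄ m / 6 * (v - m) ^ 3)| ≤ C * |v - m| ^ 4 := fun v hv => by
    have := abs_sub_le_of_abs_deriv_le (φ := fun v => φ₁ v - (φ₂ m * (v - m)
      + φ₃ m / 2 * (v - m) ^ 2 + φ₄ m / 6 * (v - m) ^ 3))
      (φ' := fun v => φ₂ v - (φ₂ m + φ₃ m * (v - m) + φ₄ m / 2 * (v - m) ^ 2)) hC
      (fun v _ => by
        have := (hasDerivAt_id v).sub_const m
        refine ((h1 v).sub (((this.const_mul (φ₂ m)).add ((this.pow 2).const_mul (φ₃ m / 2))).add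
          ((this.pow 3).const_mul (φ₄ m / 6)))).congr_deriv ?_
        simp; ring) H hv
    simpa [sub_sub, add_comm, add_left_comm, add_assoc] using this
  have := abs_sub_le_of_abs_deriv_le (φ := fun v => φ v - (φ₁ m * (v - m)
      + φ₂ m / 2 * (v - m) ^ 2 + φ₃ m / 6 * (v - m) ^ 3 + φ₄ m / 24 * (v - m) ^ 4))
      (φ' := fun v => φ₁ v - (φ₁ m + φ₂ m * (v - m) + φ₃ m / 2 * (v - m) ^ 2
      + φ₄ m / 6 * (v - m) ^ 3)) hC
      (fun v _ => by
        have := (hasDerivAt_id v).sub_const m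
        refine ((h0 v).sub ((((this.const_mul (φ₁ m)).add ((this.pow 2).const_mul (φ₂ m / 2))).add
          ((this.pow 3).const_mul (φ₃ m / 6))).add
          ((this.pow 4).const_mul (φ₄ m / 24)))).congr_deriv ?_
        simp; ring) k1 hv
  simpa [sub_sub, add_comm, add_left_comm, add_assoc] using this

/-- This is `√(1+z) ≥ 1 + z/2 - z²/8` with `z = p²/g⁴`. The square of the right side is `1 + z -
z³(8 - z)/64`, which settles `z ≤ 8`; for larger `z` the right side is negative. No smallness of `p`
is needed. -/
theorem lengthDensity_ge (hg : IsRadius g g₁ g₂) (v p : ℝ) :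
    g v + p ^ 2 / 2 * (g v ^ 3)⁻¹ - p ^ 4 / 8 * (g v ^ 7)⁻¹ ≤ lengthDensity g v p := by
  have hpos := hg.pos v
  set z := p ^ 2 / g v ^ 4 with hz
  have hz0 : 0 ≤ z := by positivity
  have e : g v + p ^ 2 / 2 * (g v ^ 3)⁻¹ - p ^ 4 / 8 * (g v ^ 7)⁻¹ = g v * (1 + z / 2 - z ^ 2 / 8) := by
    rw [hz]; field_simp
  have e2 : g v ^ 2 + p ^ 2 / g v ^ 2 = g v ^ 2 * (1 + z) := by rw [hz]; field_simp
  rw [e, lengthDensity, e2]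
  by_cases h8 : z ≤ 8
  · apply le_sqrt_of_sq_le
    rw [mul_pow]
    gcongr
    nlinarith [mul_nonneg (pow_nonneg hz0 3) (sub_nonneg.2 h8)]
  · refine le_trans ?_ (sqrt_nonneg _)
    exact mul_nonpos_of_nonneg_of_nonpos hpos.le (by nlinarith)

theorem lengthDensity_le (hg : IsRadius g g₁ g₂) (v p : ℝ) :
    lengthDensity g v p ≤ g v + p ^ 2 / 2 * (g v ^ 3)⁻¹ := by
  have hpos := hg.pos v
  rw [lengthDensity]
  apply sqrt_le_iff.2 ⟨by positivity, ?_⟩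
  have : (g v + p ^ 2 / 2 * (g v ^ 3)⁻¹) ^ 2
      = g v ^ 2 + p ^ 2 / g v ^ 2 + (p ^ 2 / 2 * (g v ^ 3)⁻¹) ^ 2 := by field_simp; ring
  rw [this]
  have := sq_nonneg (p ^ 2 / 2 * (g v ^ 3)⁻¹)
  linarith

theorem hasDerivAt_inv_cube (hg : IsRadius g g₁ g₂) (v : ℝ) :
    HasDerivAt (fun v => (g v ^ 3)⁻¹) (-3 * g₁ v * (g v ^ 4)⁻¹) v := by
  have hpos := hg.pos v
  refine (((hg.hasDerivAt v).pow 3).inv (pow_pos hpos 3).ne').congr_deriv ?_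
  simp; field_simp

/-- In the preceding lower bound `g` is expanded to order four, `g⁻³` to order two and `g⁻⁷` to
order zero; this is where the five coefficients come from. -/
theorem lengthDensity_ge_taylor (hg : IsRadius g g₁ g₂) {g₃ g₄ : ℝ → ℝ} {m d : ℝ}
    (h2 : ∀ v, HasDerivAt g₂ (g₃ v) v) (h3 : ∀ v, HasDerivAt g₃ (g₄ v) v)
    (h4 : HasDerivAt g₄ d m) {κ : ℝ} (hκ : (g m ^ 3)⁻¹ = κ) (hκ₂ : g₂ m = -κ) :
    ∃ ρ > 0, ∃ K ≥ 0, ∀ s p, |s| ≤ ρ →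
      g m + g₁ m * s + κ / 2 * (p ^ 2 - s ^ 2)
        + (higherTerms (g₃ m / 6) (-3 * g₁ m * (g m ^ 4)⁻¹ / 2) (g₄ m / 24)
          (3 * g₁ m ^ 2 * (g m ^ 5)⁻¹ - 3 / 4 * g₂ m * (g m ^ 4)⁻¹) (-(g m ^ 7)⁻¹ / 8) s p
        - K * (|s| ^ 5 + |s| ^ 3 * |p| ^ 2 + |s| * |p| ^ 4)) ≤ lengthDensity g (m + s) p := by
  have hpos := hg.pos m
  obtain ⟨ρ₁, hρ₁, C₁, hC₁, H₁⟩ := taylor_four hg.hasDerivAt hg.hasDerivAt₁ h2 h3 h4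
  have hd1 : ∀ v, HasDerivAt (fun v => -3 * g₁ v * (g v ^ 4)⁻¹)
      (-3 * g₂ v * (g v ^ 4)⁻¹ + 12 * g₁ v ^ 2 * (g v ^ 5)⁻¹) v := by
    intro v
    have hpos := hg.pos v
    refine (((hg.hasDerivAt₁ v).const_mul (-3)).mul
      (((hg.hasDerivAt v).pow 4).inv (pow_pos hpos 4).ne')).congr_deriv ?_
    simp; field_simp; ring
  have hd2 : DifferentiableAt ℝ (fun v => -3 * g₂ v * (g v ^ 4)⁻¹ + 12 * g₁ v ^ 2 * (g v ^ 5)⁻¹) m := by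
    have a := (hg.hasDerivAt m).differentiableAt
    have b := (hg.hasDerivAt₁ m).differentiableAt
    have c := (h2 m).differentiableAt
    have n4 := (pow_pos hpos 4).ne'
    have n5 := (pow_pos hpos 5).ne'
    fun_prop (disch := assumption)
  obtain ⟨ρ₂, hρ₂, C₂, hC₂, H₂⟩ := taylor_two (hasDerivAt_inv_cube hg) hd1 hd2.hasDerivAt
  have hd7 : DifferentiableAt ℝ (fun v => (g v ^ 7)⁻¹) m := by
    have a := (hg.hasDerivAt m).differentiableAt
    have n7 := (pow_pos hpos 7).ne'
    fun_prop (disch := assumption)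
  obtain ⟨ρ₃, hρ₃, C₃, hC₃, H₃⟩ := exists_abs_sub_le_of_hasDerivAt hd7.hasDerivAt
  refine ⟨min ρ₁ (min ρ₂ ρ₃), by positivity, C₁ + C₂ + C₃, by positivity, fun s p hs => ?_⟩
  have es : m + s - m = s := by ring
  have k1 := H₁ (m + s) (by rw [es]; exact hs.trans (min_le_left _ _))
  have k2 := H₂ (m + s) (by rw [es]; exact hs.trans ((min_le_right _ _).trans (min_le_left _ _)))
  have k3 := H₃ (m + s) (by rw [es]; exact hs.trans ((min_le_right _ _).trans (min_le_right _ _)))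
  rw [es] at k1 k2 k3
  rw [hκ] at k2
  rw [hκ₂] at k1 k2 ⊢
  have l := lengthDensity_ge hg (m + s) p
  have m1 := (abs_le.1 k1).1
  have m2 := mul_le_mul_of_nonneg_left (abs_le.1 k2).1 (by positivity : 0 ≤ p ^ 2 / 2)
  have m3 := mul_le_mul_of_nonneg_left (abs_le.1 k3).2 (by positivity : 0 ≤ p ^ 4 / 8)
  have ep : |p| ^ 2 = p ^ 2 := sq_abs p
  have ep4 : |p| ^ 4 = p ^ 4 := Even.pow_abs ⟨2, rfl⟩ p
  rw [ep, ep4]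
  have n1 : 0 ≤ C₁ * (|s| ^ 3 * p ^ 2) := by positivity
  have n2 : 0 ≤ C₁ * (|s| * p ^ 4) := by positivity
  have n3 : 0 ≤ C₂ * |s| ^ 5 := by positivity
  have n4 : 0 ≤ C₂ * (|s| ^ 3 * p ^ 2) := by positivity
  have n5 : 0 ≤ C₂ * (|s| * p ^ 4) := by positivity
  have n6 : 0 ≤ C₃ * |s| ^ 5 := by positivity
  have n7 : 0 ≤ C₃ * (|s| ^ 3 * p ^ 2) := by positivity
  have n8 : 0 ≤ C₃ * (|s| * p ^ 4) := by positivity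
  unfold higherTerms
  linarith only [l, m1, m2, m3, n1, n2, n3, n4, n5, n6, n7, n8]

/-! ### The second harmonic and the quartic lower bound at the critical mean -/

theorem norm_le_of_hasModes {w : ℝ → ℝ} {m m₀ ρ : ℝ} {x : ℂ} (cw : Continuous w)
    (hm : HasModes w m x) (hb : ∀ θ, |w θ - m₀| ≤ ρ) : ‖x‖ ≤ 4 * ρ := by
  have hπ := pi_pos
  have h := hm.sub (hasModes_const m₀) cw continuous_const
  rw [sub_zero] at h
  have bd : ∀ φ : ℝ → ℝ, (∀ θ, |φ θ| ≤ 1) → |∫ θ in (0:ℝ)..2 * π, (w θ - m₀) * φ θ| ≤ 2 * π * ρ := by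
    intro φ hφ
    refine norm_integral_period_le (E := ℝ) (f := fun θ => (w θ - m₀) * φ θ) fun θ => ?_
    rw [Real.norm_eq_abs, abs_mul]
    have h0 := hb θ
    calc |w θ - m₀| * |φ θ| ≤ ρ * 1 := by gcongr; exacts [(abs_nonneg _).trans h0, hφ θ]
      _ = ρ := mul_one ρ
  have h1 := bd cos abs_cos_le_one
  have h2 := bd sin abs_sin_le_one
  rw [h.cos, abs_mul, abs_of_pos hπ] at h1
  rw [h.sin, abs_mul, abs_of_pos hπ] at h2
  have h3 : |x.re| ≤ 2 * ρ := by nlinarith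
  have h4 : |x.im| ≤ 2 * ρ := by nlinarith
  linarith [Complex.norm_le_abs_re_add_abs_im x]

/-- The second harmonic `harmonic x ^ 2 - ‖x‖ ^ 2 / 2`. -/
noncomputable def secondHarmonic (x : ℂ) (θ : ℝ) : ℝ := harmonic x θ ^ 2 - ‖x‖ ^ 2 / 2

/-- The derivative of `secondHarmonic x`. -/
noncomputable def secondHarmonicDeriv (x : ℂ) (θ : ℝ) : ℝ := 2 * (harmonic x θ * harmonicDeriv x θ)

theorem isLoop_secondHarmonic (x : ℂ) : IsLoop (secondHarmonic x) (secondHarmonicDeriv x) := by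
  have h1 := continuous_harmonic x
  have h2 := continuous_harmonicDeriv x
  refine ⟨fun θ => ?_, by unfold secondHarmonicDeriv; fun_prop, fun θ => ?_⟩
  · refine (((hasDerivAt_harmonic x θ).pow 2).sub_const _).congr_deriv ?_
    unfold secondHarmonicDeriv; simp; ring
  · unfold secondHarmonic; rw [(isLoop_harmonic x).periodic]

theorem isLoop_secondHarmonicDeriv (x : ℂ) :
    IsLoop (secondHarmonicDeriv x) (fun θ => -4 * secondHarmonic x θ) := by
  have h1 := continuous_harmonic x
  refine ⟨fun θ => ?_, by unfold secondHarmonic; fun_prop, fun θ => ?_⟩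
  · refine (((hasDerivAt_harmonic x θ).mul (hasDerivAt_harmonicDeriv x θ)).const_mul 2).congr_deriv ?_
    have := harmonic_sq_add x θ
    unfold secondHarmonic; linear_combination 2 * this
  · unfold secondHarmonicDeriv
    rw [(isLoop_harmonic x).periodic, (isLoop_harmonic x).periodic_deriv]

theorem IsLoop.mul {w w' u u' : ℝ → ℝ} (h : IsLoop w w') (k : IsLoop u u') :
    IsLoop (fun θ => w θ * u θ) (fun θ => w' θ * u θ + w θ * u' θ) := by
  have := h.continuous
  have := k.continuous
  have := h.continuous_deriv
  have := k.continuous_deriv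
  exact ⟨fun θ => (h.hasDerivAt θ).mul (k.hasDerivAt θ), by fun_prop, h.periodic.mul k.periodic⟩

theorem integral_add_period {u v : ℝ → ℝ} (hu : Continuous u) (hv : Continuous v) :
    ∫ θ in (0:ℝ)..2 * π, (u θ + v θ)
      = (∫ θ in (0:ℝ)..2 * π, u θ) + ∫ θ in (0:ℝ)..2 * π, v θ :=
  intervalIntegral.integral_add (hu.intervalIntegrable _ _) (hv.intervalIntegrable _ _)

theorem integral_const_period (k : ℝ) : ∫ _ in (0:ℝ)..2 * π, k = 2 * π * k := by simp

theorem integral_secondHarmonic (x : ℂ) : ∫ θ in (0:ℝ)..2 * π, secondHarmonic x θ = 0 := by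
  have := (isLoop_secondHarmonicDeriv x).integral_deriv
  rw [intervalIntegral.integral_const_mul] at this
  linarith

/-- Both factors are eigenfunctions of the second derivative, with the different eigenvalues `-4`
and `-1`. -/
theorem integral_secondHarmonic_mul_harmonic (x u : ℂ) :
    ∫ θ in (0:ℝ)..2 * π, secondHarmonic x θ * harmonic u θ = 0 := by
  have l := isLoop_secondHarmonic x
  have l' := isLoop_secondHarmonicDeriv x
  have e : IsLoop (harmonicDeriv u) (fun θ => -harmonic u θ) :=
    ⟨hasDerivAt_harmonicDeriv u, (continuous_harmonic u).neg, (isLoop_harmonic u).periodic_deriv⟩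
  have := ((l'.mul (isLoop_harmonic u)).sub (l.mul e)).integral_deriv
  rw [intervalIntegral.integral_congr (g := fun θ => -3 * (secondHarmonic x θ * harmonic u θ))
    (fun θ _ => by ring), intervalIntegral.integral_const_mul] at this
  linarith

theorem hasModes_secondHarmonic (x : ℂ) : HasModes (secondHarmonic x) 0 0 := by
  have h1 := integral_secondHarmonic_mul_harmonic x 1
  have h2 := integral_secondHarmonic_mul_harmonic x Complex.I
  simp only [harmonic, Complex.one_re, Complex.one_im, Complex.I_re, Complex.I_im, one_mul, zero_mul,
    add_zero, zero_add] at h1 h2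
  exact ⟨by rw [integral_secondHarmonic]; simp, by rw [h1]; simp, by rw [h2]; simp⟩

theorem integral_secondHarmonicDeriv_mul {x : ℂ} {y z : ℝ → ℝ} (h : IsLoop y z) :
    ∫ θ in (0:ℝ)..2 * π, secondHarmonicDeriv x θ * z θ
      = 4 * ∫ θ in (0:ℝ)..2 * π, secondHarmonic x θ * y θ := by
  have c1 := h.continuous
  have c2 := h.continuous_deriv
  have c3 := (isLoop_secondHarmonic x).continuous
  have c4 := (isLoop_secondHarmonicDeriv x).continuous
  have := ((isLoop_secondHarmonicDeriv x).mul h).integral_deriv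
  rw [intervalIntegral.integral_congr (g := fun θ => -4 * (secondHarmonic x θ * y θ)
    + secondHarmonicDeriv x θ * z θ) (fun θ _ => by ring), integral_add_period (by fun_prop)
    (by fun_prop), intervalIntegral.integral_const_mul] at this
  linarith

theorem integral_secondHarmonic_sq (x : ℂ) :
    ∫ θ in (0:ℝ)..2 * π, secondHarmonic x θ ^ 2 = π / 4 * ‖x‖ ^ 4 := by
  have c3 := (isLoop_secondHarmonic x).continuous
  have h1 := integral_secondHarmonicDeriv_mul (x := x) (isLoop_secondHarmonic x)
  have e : ∀ θ, secondHarmonicDeriv x θ * secondHarmonicDeriv x θ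
      = ‖x‖ ^ 4 + -4 * secondHarmonic x θ ^ 2 := by
    intro θ
    have := harmonic_sq_add x θ
    unfold secondHarmonicDeriv secondHarmonic
    linear_combination (4 * harmonic x θ ^ 2) * this
  rw [intervalIntegral.integral_congr fun θ _ => e θ, integral_add_period (by fun_prop)
    (by fun_prop), intervalIntegral.integral_const_mul, integral_const_period,
    intervalIntegral.integral_congr (f := fun θ => secondHarmonic x θ * secondHarmonic x θ)
      (g := fun θ => secondHarmonic x θ ^ 2) (fun θ _ => by ring)] at h1
  linarith

/-- A lower bound for the second variation which takes the interaction with the second harmonic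
into account. -/
theorem integral_deriv_sq_sub_ge {x : ℂ} {y z : ℝ → ℝ} (h : IsLoop y z) (hm : HasModes y 0 0) (μ : ℝ) :
    -6 * μ * (∫ θ in (0:ℝ)..2 * π, secondHarmonic x θ * y θ) - 3 * μ ^ 2 * (π / 4 * ‖x‖ ^ 4)
      ≤ (∫ θ in (0:ℝ)..2 * π, z θ ^ 2) - ∫ θ in (0:ℝ)..2 * π, y θ ^ 2 := by
  have c1 := h.continuous
  have c2 := h.continuous_deriv
  have c3 := (isLoop_secondHarmonic x).continuous
  have c4 := (isLoop_secondHarmonicDeriv x).continuous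
  have hμ : IsLoop (fun θ => μ * secondHarmonic x θ) (fun θ => μ * secondHarmonicDeriv x θ) :=
    ⟨fun θ => ((isLoop_secondHarmonic x).hasDerivAt θ).const_mul μ, by fun_prop, fun θ => by
      simp only [(isLoop_secondHarmonic x).periodic θ]⟩
  have hmμ : HasModes (fun θ => μ * secondHarmonic x θ) 0 0 := by
    have := hasModes_secondHarmonic x
    refine ⟨?_, ?_, ?_⟩
    · rw [intervalIntegral.integral_const_mul, this.mean]; simp
    · simp only [mul_assoc]; rw [intervalIntegral.integral_const_mul, this.cos]; simp
    · simp only [mul_assoc]; rw [intervalIntegral.integral_const_mul, this.sin]; simp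
  -- Completing the square: `y + μ · secondHarmonic x` still has no modes of order 0 and 1, so
  -- Wirtinger makes `∫ Y'² - ∫ Y²` nonnegative. Expanding, the cross terms give `2μ(4 - 1)` and the
  -- squares `μ²(4 - 1)`.
  have hY := h.add hμ
  have mY := hm.add hmμ c1 hμ.continuous
  rw [add_zero, add_zero] at mY
  have W := wirtinger_second hY (by rw [mY.mean]; simp) (by rw [mY.cos]; simp)
    (by rw [mY.sin]; simp)
  have n0 : 0 ≤ ∫ θ in (0:ℝ)..2 * π, (y θ + μ * secondHarmonic x θ) ^ 2 :=
    intervalIntegral.integral_nonneg (by positivity) fun θ _ => sq_nonneg _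
  have e1 : ∀ θ, (y θ + μ * secondHarmonic x θ) ^ 2
      = y θ ^ 2 + (2 * μ * (secondHarmonic x θ * y θ) + μ ^ 2 * secondHarmonic x θ ^ 2) :=
    fun θ => by ring
  have e2 : ∀ θ, (z θ + μ * secondHarmonicDeriv x θ) ^ 2
      = z θ ^ 2 + (2 * μ * (secondHarmonicDeriv x θ * z θ)
        + μ ^ 2 * (secondHarmonicDeriv x θ * secondHarmonicDeriv x θ)) :=
    fun θ => by ring
  rw [intervalIntegral.integral_congr fun θ _ => e1 θ, integral_add_period (by fun_prop)
    (by fun_prop), integral_add_period (by fun_prop) (by fun_prop),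
    intervalIntegral.integral_const_mul, intervalIntegral.integral_const_mul,
    integral_secondHarmonic_sq] at W n0
  rw [intervalIntegral.integral_congr fun θ _ => e2 θ, integral_add_period (by fun_prop)
    (by fun_prop), integral_add_period (by fun_prop) (by fun_prop),
    intervalIntegral.integral_const_mul, intervalIntegral.integral_const_mul,
    integral_secondHarmonicDeriv_mul h, integral_secondHarmonicDeriv_mul (isLoop_secondHarmonic x),
    intervalIntegral.integral_congr (f := fun θ => secondHarmonic x θ * secondHarmonic x θ)
      (g := fun θ => secondHarmonic x θ ^ 2) (fun θ _ => by ring), integral_secondHarmonic_sq] at W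
  linarith

/-- Write `w = m + c + y` with `c` the first harmonic. The purely quadratic and cubic terms in `c`
integrate to zero, the cubic terms linear in `y` give `3 (α + β) ∫ d y` with `d` the second
harmonic, and the quartic ones give `π (3A + B + 3C)/4 · ‖x‖⁴`. Minimizing over `y` costs `3/8 (α +
β)²/κ · π ‖x‖⁴`, whence the hypothesis `hpos`. -/
theorem energy_ge_quartic (hg : IsRadius g g₁ g₂) {g₃ g₄ : ℝ → ℝ} {m d κ α β A B C : ℝ}
    (h2 : ∀ v, HasDerivAt g₂ (g₃ v) v) (h3 : ∀ v, HasDerivAt g₃ (g₄ v) v)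
    (h4 : HasDerivAt g₄ d m) (hκ : (g m ^ 3)⁻¹ = κ) (hκ₂ : g₂ m = -κ)
    (hα : g₃ m / 6 = α) (hβ : -3 * g₁ m * (g m ^ 4)⁻¹ / 2 = β) (hA : g₄ m / 24 = A)
    (hB : 3 * g₁ m ^ 2 * (g m ^ 5)⁻¹ - 3 / 4 * g₂ m * (g m ^ 4)⁻¹ = B)
    (hC : -(g m ^ 7)⁻¹ / 8 = C)
    (hpos : 3 / 8 * (α + β) ^ 2 / κ < (3 * A + B + 3 * C) / 4) :
    ∃ ρ > 0, ∃ k > 0, ∀ (w w' : ℝ → ℝ) (x : ℂ), IsLoop w w' → HasModes w m x →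
      (∀ θ, |w θ - m| ≤ ρ ∧ |w' θ| ≤ ρ) → 2 * π * g m + k * ‖x‖ ^ 4 ≤ energy g w w' := by
  have hπ := pi_pos
  have hgm := hg.pos m
  have hκ0 : 0 < κ := by rw [← hκ]; positivity
  -- The square is completed with `κ'`; the surplus `κ - κ'` absorbs the errors `ε (y² + z²)`.
  obtain ⟨κ', hκ'κ, hκ'0, hκ'pos⟩ : ∃ κ' < κ, 0 < κ' ∧
      3 / 8 * (α + β) ^ 2 / κ' < (3 * A + B + 3 * C) / 4 := by
    have hc : ContinuousAt (fun t : ℝ => 3 / 8 * (α + β) ^ 2 / t) κ := by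
      have := hκ0.ne'
      fun_prop (disch := assumption)
    have h1 := hc.eventually_lt (continuousAt_const (y := (3 * A + B + 3 * C) / 4)) hpos
    have h2 := (h1.and (lt_mem_nhds hκ0)).filter_mono (nhdsWithin_le_nhds (s := Iio κ))
    obtain ⟨t, ⟨ht1, ht2⟩, ht3⟩ := (h2.and self_mem_nhdsWithin).exists
    exact ⟨t, ht3, ht2, ht1⟩
  set D := (3 * A + B + 3 * C) / 4 - 3 / 8 * (α + β) ^ 2 / κ' with hD
  have hD0 : 0 < D := sub_pos.2 hκ'pos
  -- With `∫ z² ≥ 4 ∫ y²`, the factor `3/10` is the largest for which `(κ - κ')/2 (∫ z² - ∫ y²)`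
  -- dominates `ε (∫ y² + ∫ z²)`. The bound `D/4` leaves half of `D` for the conclusion.
  set ε := min (D / 4) (3 / 10 * (κ - κ')) with hε
  have hκκ : 0 < κ - κ' := sub_pos.2 hκ'κ
  have hε0 : 0 < ε := by positivity
  have hε1 : ε ≤ D / 4 := min_le_left _ _
  have hε2 : ε ≤ 3 / 10 * (κ - κ') := min_le_right _ _
  obtain ⟨ρ, hρ, K, hK, H⟩ := lengthDensity_ge_taylor hg h2 h3 h4 hκ hκ₂
  rw [hα, hβ, hA, hB, hC] at H
  obtain ⟨η, hη, H'⟩ := higherTerms_ge α β A B C K hK hε0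
  -- `‖x‖` is at most four times the bound on `w - m`, so `y` and `z` are at most five times it.
  refine ⟨min ρ (η / 5), by positivity, π * (D / 2), by positivity, fun w w' x hw hmod hb => ?_⟩
  have cw := hw.continuous
  have cw' := hw.continuous_deriv
  have hX := norm_le_of_hasModes cw hmod fun θ => (hb θ).1
  set X := ‖x‖ with hXdef
  have hρη := min_le_right ρ (η / 5)
  have hy := (hw.sub (IsLoop.const m)).sub (isLoop_harmonic x)
  have hym := (hmod.sub (hasModes_const m) cw continuous_const).sub (hasModes_harmonic x)
    (by fun_prop) (continuous_harmonic x)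
  simp only [sub_self, sub_zero] at hy hym
  set y := fun θ => w θ - m - harmonic x θ with hydef
  set z := fun θ => w' θ - harmonicDeriv x θ with hzdef
  have cy : Continuous y := hy.continuous
  have cz : Continuous z := hy.continuous_deriv
  have cc := continuous_harmonic x
  have cc' := continuous_harmonicDeriv x
  have cd := (isLoop_secondHarmonic x).continuous
  have cd' := (isLoop_secondHarmonicDeriv x).continuous
  have pt : ∀ θ, (g m - ε * X ^ 4 + (A + B + C) * (X ^ 4 / 4))
      + ((g₁ m + (α + β) * (X ^ 2 / 2)) * harmonic x θ + ((g₁ m + (3 * α + β) * (X ^ 2 / 2)) * y θ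
      + ((-κ + X ^ 2 * (A - C)) * secondHarmonic x θ
      + ((-κ) * (harmonicDeriv x θ * (-z θ) + harmonic x θ * y θ)
      + ((κ / 2 - ε) * z θ ^ 2 + (-(κ / 2) - ε) * y θ ^ 2
      + ((α - β) * (secondHarmonic x θ * harmonic x θ)
      + ((3 * α - β) * (secondHarmonic x θ * y θ) + (β * (secondHarmonicDeriv x θ * z θ)
      + (A - B + C) * secondHarmonic x θ ^ 2)))))))) ≤ lengthDensity g (w θ) (w' θ) := by
    intro θ
    have es : harmonic x θ + y θ = w θ - m := by rw [hydef]; ring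
    have ep : harmonicDeriv x θ + z θ = w' θ := by rw [hzdef]; ring
    have b1 := abs_harmonic_le x θ
    have b2 := abs_harmonicDeriv_le x θ
    have b3 : |y θ| ≤ η := by
      have : y θ = (w θ - m) - harmonic x θ := rfl
      rw [this]
      refine (abs_sub _ _).trans ?_
      linarith [(hb θ).1]
    have b4 : |z θ| ≤ η := by
      refine (abs_sub _ _).trans ?_
      linarith [(hb θ).2]
    have l1 := H' X _ _ _ _ (by linarith) b1 b2 b3 b4
    have l2 := H (w θ - m) (w' θ) ((hb θ).1.trans (min_le_left _ _))
    rw [es, ep] at l1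
    rw [add_sub_cancel, ← ep, ← es] at l2
    rw [← ep, ← es] at l1
    rw [ep, es] at l1
    rw [ep, es] at l2
    have hc2 : harmonic x θ ^ 2 = secondHarmonic x θ + X ^ 2 / 2 := by unfold secondHarmonic; ring
    have hc2' : harmonicDeriv x θ ^ 2 = X ^ 2 / 2 - secondHarmonic x θ := by
      have := harmonic_sq_add x θ
      linarith
    have hcc : harmonic x θ * harmonicDeriv x θ = secondHarmonicDeriv x θ / 2 := by
      unfold secondHarmonicDeriv; ring
    refine le_trans (le_of_eq ?_) ((add_le_add_right l1 _).trans l2)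
    rw [← ep, ← es]
    have f1 : harmonic x θ ^ 3 = harmonic x θ * (secondHarmonic x θ + X ^ 2 / 2) := by
      rw [← hc2]; ring
    have f2 : harmonic x θ ^ 4 = (secondHarmonic x θ + X ^ 2 / 2) ^ 2 := by
      rw [← hc2]; ring
    have f3 : harmonicDeriv x θ ^ 4 = (X ^ 2 / 2 - secondHarmonic x θ) ^ 2 := by
      rw [← hc2']; ring
    rw [f1, f2, f3, hc2, hc2', hcc]
    have f4 : (harmonicDeriv x θ + z θ) ^ 2 - (harmonic x θ + y θ) ^ 2
        = (X ^ 2 / 2 - secondHarmonic x θ) - (secondHarmonic x θ + X ^ 2 / 2)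
          + 2 * (harmonicDeriv x θ * z θ - harmonic x θ * y θ) + z θ ^ 2 - y θ ^ 2 := by
      rw [← hc2, ← hc2']; ring
    rw [f4]
    ring
  have int : ∀ f : ℝ → ℝ, Continuous f → IntervalIntegrable f MeasureTheory.volume 0 (2 * π) :=
    fun f hf => hf.intervalIntegrable _ _
  have cL : Continuous fun θ => lengthDensity g (w θ) (w' θ) :=
    (continuous_lengthDensity hg).comp (cw.prodMk cw')
  have key := intervalIntegral.integral_mono (by positivity) (int _ (by fun_prop))
    (int _ cL) pt
  have hcross : ∫ θ in (0:ℝ)..2 * π, (harmonicDeriv x θ * (-z θ) + harmonic x θ * y θ) = 0 := by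
    have e : IsLoop (harmonicDeriv x) (fun θ => -harmonic x θ) :=
      ⟨hasDerivAt_harmonicDeriv x, cc.neg, (isLoop_harmonic x).periodic_deriv⟩
    have := (e.mul hy).integral_deriv
    rw [intervalIntegral.integral_congr (g := fun θ => -(harmonicDeriv x θ * (-z θ)
      + harmonic x θ * y θ)) (fun θ _ => by ring), intervalIntegral.integral_neg] at this
    linarith
  rw [integral_add_period (by fun_prop) (by fun_prop), integral_add_period (by fun_prop) (by fun_prop),
    integral_add_period (by fun_prop) (by fun_prop), integral_add_period (by fun_prop) (by fun_prop),
    integral_add_period (by fun_prop) (by fun_prop), integral_add_period (by fun_prop) (by fun_prop),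
    integral_add_period (by fun_prop) (by fun_prop), integral_add_period (by fun_prop) (by fun_prop),
    integral_add_period (by fun_prop) (by fun_prop), integral_add_period (by fun_prop) (by fun_prop),
    integral_add_period (by fun_prop) (by fun_prop)] at key
  simp only [intervalIntegral.integral_const_mul, integral_const_period] at key
  rw [(hasModes_harmonic x).mean, hym.mean, integral_secondHarmonic, hcross,
    integral_secondHarmonic_mul_harmonic, integral_secondHarmonicDeriv_mul hy,
    integral_secondHarmonic_sq] at key
  have W := wirtinger_second hy (by rw [hym.mean]; simp) (by rw [hym.cos]; simp)
    (by rw [hym.sin]; simp)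
  -- This choice of `μ` cancels the coupling `3 (α + β) J` exactly.
  have S := integral_deriv_sq_sub_ge (x := x) hy hym ((α + β) / κ')
  rw [← hXdef] at S key
  set J := ∫ θ in (0:ℝ)..2 * π, secondHarmonic x θ * y θ
  set Y2 := ∫ θ in (0:ℝ)..2 * π, y θ ^ 2
  set Z2 := ∫ θ in (0:ℝ)..2 * π, z θ ^ 2
  have hY0 : 0 ≤ Y2 := intervalIntegral.integral_nonneg (by positivity) fun θ _ => sq_nonneg _
  clear_value J Y2 Z2
  have S' : -3 * (α + β) * J - 3 / 8 * (α + β) ^ 2 / κ' * (π * X ^ 4) ≤ κ' / 2 * (Z2 - Y2) := by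
    have := mul_le_mul_of_nonneg_left S (by positivity : 0 ≤ κ' / 2)
    refine le_trans (le_of_eq ?_) this
    field_simp
    ring
  have T' : ε * (Y2 + Z2) ≤ (κ - κ') / 2 * (Z2 - Y2) := by
    have h1 : ε * (Y2 + Z2) ≤ 3 / 10 * (κ - κ') * (Y2 + Z2) :=
      mul_le_mul_of_nonneg_right hε2 (by linarith)
    have h2 : 3 / 10 * (κ - κ') * (Y2 + Z2) ≤ (κ - κ') / 2 * (Z2 - Y2) := by
      have := mul_nonneg hκκ.le (sub_nonneg.2 W)
      linarith only [this]
    exact h1.trans h2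
  have E' : 2 * π * (ε * X ^ 4) ≤ π * (D / 2) * X ^ 4 := by
    have := mul_le_mul_of_nonneg_right hε1 (by positivity : 0 ≤ 2 * π * X ^ 4)
    linarith only [this]
  have hDX : π * D * X ^ 4 = π / 4 * X ^ 4 * (3 * A + B + 3 * C)
      - 3 / 8 * (α + β) ^ 2 / κ' * (π * X ^ 4) := by rw [hD]; ring
  unfold energy
  linarith only [key, S', T', E', hDX]

/-! ### Existence of a nonconstant local minimizer -/

theorem energy_const (hg : IsRadius g g₁ g₂) (m : ℝ) :
    energy g (fun _ => m) (fun _ => 0) = 2 * π * g m := by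
  unfold energy
  simp only [lengthDensity_zero hg, integral_const_period]

/-- Test loop `m + t cos θ`: the length changes by `π t²/2 · (g₂ m + g(m)⁻³) + O(t³)`. -/
theorem exists_energy_lt_const (hg : IsRadius g g₁ g₂) {m d : ℝ} (h2 : HasDerivAt g₂ d m)
    (hneg : g₂ m + (g m ^ 3)⁻¹ < 0) {η : ℝ} (hη : 0 < η) :
    ∃ x : ℂ, ‖x‖ ≤ η ∧
      energy g (fun θ => m + harmonic x θ) (harmonicDeriv x) < 2 * π * g m := by
  have hπ := pi_pos
  obtain ⟨ρ₁, hρ₁, C₁, hC₁, H₁⟩ := taylor_two hg.hasDerivAt hg.hasDerivAt₁ h2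
  obtain ⟨ρ₂, hρ₂, C₂, hC₂, H₂⟩ := exists_abs_sub_le_of_hasDerivAt (hasDerivAt_inv_cube hg m)
  set k := (g m ^ 3)⁻¹ with hk
  set N := -(g₂ m + k) with hN
  have hN0 : 0 < N := by rw [hN]; linarith
  set t := min (min η (min ρ₁ ρ₂)) (N / (8 * (C₁ + C₂ + 1))) with ht
  have ht0 : 0 < t := by positivity
  have htη : t ≤ η := (min_le_left _ _).trans (min_le_left _ _)
  have ht1 : t ≤ ρ₁ := (min_le_left _ _).trans ((min_le_right _ _).trans (min_le_left _ _))
  have ht2 : t ≤ ρ₂ := (min_le_left _ _).trans ((min_le_right _ _).trans (min_le_right _ _))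
  have htN : t * (8 * (C₁ + C₂ + 1)) ≤ N := by
    rw [← le_div_iff₀ (by positivity)]; exact min_le_right _ _
  clear_value t
  have hxt : ‖(t : ℂ)‖ = t := by rw [Complex.norm_real, Real.norm_eq_abs, abs_of_pos ht0]
  refine ⟨t, by rwa [hxt], ?_⟩
  have hc : ∀ θ, harmonic t θ = t * cos θ := fun θ => by simp [harmonic]
  have hc' : ∀ θ, harmonicDeriv t θ = -(t * sin θ) := fun θ => by simp [harmonicDeriv]
  have pt : ∀ θ, lengthDensity g (m + harmonic t θ) (harmonicDeriv t θ)
      ≤ (g m + (C₁ + C₂) * t ^ 3) + (g₁ m * t * cos θ + (t ^ 2 * g₂ m / 2 * cos θ ^ 2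
        + t ^ 2 * k / 2 * sin θ ^ 2)) := by
    intro θ
    have b1 := abs_harmonic_le t θ
    have b2 := abs_harmonicDeriv_le t θ
    rw [hxt] at b1 b2
    have es : m + harmonic t θ - m = harmonic t θ := by ring
    have k1 := (abs_le.1 (H₁ (m + harmonic t θ) (by rw [es]; exact b1.trans ht1))).2
    have k2 := (abs_le.1 (H₂ (m + harmonic t θ) (by rw [es]; exact b1.trans ht2))).2
    rw [es] at k1 k2
    have l := lengthDensity_le hg (m + harmonic t θ) (harmonicDeriv t θ)
    have m1 : C₁ * |harmonic t θ| ^ 3 ≤ C₁ * t ^ 3 := by gcongr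
    have m2 : harmonicDeriv t θ ^ 2 / 2 * (C₂ * |harmonic t θ|) ≤ C₂ * t ^ 3 := by
      have : harmonicDeriv t θ ^ 2 ≤ t ^ 2 := by rw [← sq_abs]; gcongr
      calc _ ≤ t ^ 2 / 2 * (C₂ * t) := by gcongr
        _ = C₂ * t ^ 3 / 2 := by ring
        _ ≤ C₂ * t ^ 3 := by have : 0 ≤ C₂ * t ^ 3 := by positivity
                             linarith
    have m3 := mul_le_mul_of_nonneg_left k2 (by positivity : 0 ≤ harmonicDeriv t θ ^ 2 / 2)
    have f1 : harmonic t θ ^ 2 = t ^ 2 * cos θ ^ 2 := by rw [hc]; ring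
    have f2 : harmonicDeriv t θ ^ 2 = t ^ 2 * sin θ ^ 2 := by rw [hc']; ring
    rw [f1] at k1
    rw [f2] at l m2 m3
    have f3 : g₁ m * harmonic t θ = g₁ m * t * cos θ := by rw [hc]; ring
    rw [f3] at k1
    linarith only [l, k1, m1, m2, m3]
  have cL : Continuous fun θ => lengthDensity g (m + harmonic t θ) (harmonicDeriv t θ) :=
    (continuous_lengthDensity hg).comp ((continuous_const.add (continuous_harmonic t)).prodMk
      (continuous_harmonicDeriv t))
  have key := intervalIntegral.integral_mono (μ := MeasureTheory.volume) (a := 0) (b := 2 * π)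
    (by positivity) (cL.intervalIntegrable _ _) (Continuous.intervalIntegrable (by fun_prop) _ _) pt
  rw [integral_add_period (by fun_prop) (by fun_prop), integral_add_period (by fun_prop)
    (by fun_prop), integral_add_period (by fun_prop) (by fun_prop),
    integral_add_period (by fun_prop) (by fun_prop), integral_const_period] at key
  simp only [integral_const_period, intervalIntegral.integral_const_mul, integral_cos_period, integral_cos_sq_period,
    integral_sin_sq_period] at key
  have fin : 2 * π * ((C₁ + C₂) * t ^ 3) < t ^ 2 * N / 2 * π := by
    have h1 : 4 * (C₁ + C₂) * t < N := by nlinarith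
    have h2 := mul_lt_mul_of_pos_right h1 (by positivity : 0 < t ^ 2 * π / 2)
    linarith only [h2]
  have e : t ^ 2 * N / 2 * π = -(t ^ 2 * g₂ m / 2 * π) - t ^ 2 * k / 2 * π := by rw [hN]; ring
  unfold energy
  linarith

/-- Existence of a nonconstant local minimizer of the length among closed curves with the same
enclosed area. -/
theorem exists_local_minimizer (hg : IsRadius g g₁ g₂) {g₃ : ℝ → ℝ} {m₀ k ρ₄ : ℝ}
    (h2 : ∀ v, HasDerivAt g₂ (g₃ v) v) (hκ₂ : g₂ m₀ = -(1 / g m₀ ^ 3)) (hk : 0 < k) (hρ₄ : 0 < ρ₄)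
    (hquartic : ∀ (w w' : ℝ → ℝ) (x : ℂ), IsLoop w w' → HasModes w m₀ x →
      (∀ θ, |w θ - m₀| ≤ ρ₄ ∧ |w' θ| ≤ ρ₄) → 2 * π * g m₀ + k * ‖x‖ ^ 4 ≤ energy g w w')
    (hunst : ∀ η > 0, ∃ m, |m - m₀| ≤ η ∧ g₂ m + (g m ^ 3)⁻¹ < 0) {δ : ℝ} (hδ : 0 < δ) :
    ∃ (v v' q : ℝ → ℝ) (h : ℝ), IsCritical g g₁ v v' q h 0 0 ∧
      (∀ θ, |v θ - m₀| ≤ δ ∧ |v' θ| ≤ δ ∧ |q θ| ≤ δ) ∧ (∃ θ, v' θ ≠ 0) ∧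
      ∃ ρ > 0, ∀ w w' : ℝ → ℝ, IsLoop w w' →
        ∫ θ in (0:ℝ)..2 * π, w θ = ∫ θ in (0:ℝ)..2 * π, v θ →
        (∀ θ, |w θ - v θ| ≤ ρ ∧ |w' θ - v' θ| ≤ ρ) → energy g v v' ≤ energy g w w' := by
  have hπ := pi_pos
  obtain ⟨ρ₂, hρ₂, H₂⟩ := energy_le_of_isCritical hg hκ₂
  obtain ⟨ρ₃, hρ₃, C, hC, H₃⟩ := exists_energy_lipschitz hg m₀
  obtain ⟨ρ₅, hρ₅, H₅⟩ := multipliers_eq_zero hg hκ₂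
  -- The loops stay within `R` of `m₀` and comparison shifts add at most `2ρ ≤ 2R`, so `4R` is a
  -- safe radius for all estimates.
  set R := min (min (min ρ₂ ρ₃) (min ρ₄ ρ₅)) δ / 4 with hR
  have hR0 : 0 < R := by positivity
  have hR2 : 4 * R ≤ ρ₂ := by
    rw [hR]; linarith [min_le_left (min (min ρ₂ ρ₃) (min ρ₄ ρ₅)) δ,
      min_le_left (min ρ₂ ρ₃) (min ρ₄ ρ₅), min_le_left ρ₂ ρ₃]
  have hR3 : 4 * R ≤ ρ₃ := by
    rw [hR]; linarith [min_le_left (min (min ρ₂ ρ₃) (min ρ₄ ρ₅)) δ,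
      min_le_left (min ρ₂ ρ₃) (min ρ₄ ρ₅), min_le_right ρ₂ ρ₃]
  have hR4 : 4 * R ≤ ρ₄ := by
    rw [hR]; linarith [min_le_left (min (min ρ₂ ρ₃) (min ρ₄ ρ₅)) δ,
      min_le_right (min ρ₂ ρ₃) (min ρ₄ ρ₅), min_le_left ρ₄ ρ₅]
  have hR5 : 4 * R ≤ ρ₅ := by
    rw [hR]; linarith [min_le_left (min (min ρ₂ ρ₃) (min ρ₄ ρ₅)) δ,
      min_le_right (min ρ₂ ρ₃) (min ρ₄ ρ₅), min_le_right ρ₄ ρ₅]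
  have hRδ : 4 * R ≤ δ := by rw [hR]; linarith [min_le_right (min (min ρ₂ ρ₃) (min ρ₄ ρ₅)) δ]
  clear_value R
  obtain ⟨η, hη, H₁⟩ := exists_isCritical hg hκ₂ hR0
  set ρ := min η R with hρ
  have hρ0 : 0 < ρ := lt_min hη hR0
  have hρη : ρ ≤ η := min_le_left _ _
  have hρR : ρ ≤ R := min_le_right _ _
  clear_value ρ
  -- Changing the mean from `m₀` to `m` costs at most `2C|m - m₀|`, which is kept below the barrier
  -- `k ρ⁴`.
  obtain ⟨m, hm, hneg⟩ := hunst (min ρ (k * ρ ^ 4 / (4 * C))) (by positivity)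
  have hmρ : |m - m₀| ≤ ρ := hm.trans (min_le_left _ _)
  have hmk : |m - m₀| * (4 * C) ≤ k * ρ ^ 4 := by
    rw [← le_div_iff₀ (by positivity)]; exact hm.trans (min_le_right _ _)
  have Hx : ∀ x : ℂ, ‖x‖ ≤ ρ → _ := fun x hx => H₁ m x (hmρ.trans hρη) (hx.trans hρη)
  -- The loops are merely chosen; continuity of their length in `x` follows below from minimality,
  -- by comparison with `v x + harmonic (x' - x)`.
  choose! v v' q h b c hv using Hx
  set φ : ℂ → ℝ := fun x => energy g (v x) (v' x) with hφ
  have hbox : ∀ x : ℂ, ‖x‖ ≤ ρ → ∀ r, R ≤ r → ∀ θ, |v x θ - m₀| ≤ r ∧ |v' x θ| ≤ r := fun x hx r hr θ =>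
    ⟨((hv x hx).2.2 θ).1.trans hr, ((hv x hx).2.2 θ).2.1.trans hr⟩
  have hshift : ∀ x u : ℂ, ‖x‖ ≤ ρ → ‖u‖ ≤ 2 * ρ → ∀ r, 4 * R ≤ r → ∀ θ,
      |v x θ + harmonic u θ - m₀| ≤ r ∧ |v' x θ + harmonicDeriv u θ| ≤ r := by
    intro x u hx hu r hr θ
    have b1 := abs_harmonic_le u θ
    have b2 := abs_harmonicDeriv_le u θ
    obtain ⟨b3, b4⟩ := hbox x hx R le_rfl θ
    constructor
    · rw [add_sub_right_comm]
      exact (abs_add_le _ _).trans (by linarith)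
    · exact (abs_add_le _ _).trans (by linarith)
  have hle : ∀ (x : ℂ) (w w' : ℝ → ℝ), ‖x‖ ≤ ρ → IsLoop w w' → HasModes w m x →
      (∀ θ, |w θ - m₀| ≤ ρ₂ ∧ |w' θ| ≤ ρ₂) → φ x ≤ energy g w w' := fun x w w' hx hw hwm hwb =>
    H₂ _ _ _ _ _ _ _ _ _ _ (hv x hx).1 hw (hv x hx).2.1 hwm (hbox x hx _ (by linarith)) hwb
  have hlip : ∀ x x' : ℂ, ‖x‖ ≤ ρ → ‖x'‖ ≤ ρ → φ x' ≤ φ x + C * ‖x' - x‖ := by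
    intro x x' hx hx'
    have hu : ‖x' - x‖ ≤ 2 * ρ := (norm_sub_le _ _).trans (by linarith)
    have lv := (hv x hx).1.isLoop
    have l := lv.add (isLoop_harmonic (x' - x))
    have hmod := (hv x hx).2.1.add (hasModes_harmonic (x' - x)) lv.continuous
      (continuous_harmonic _)
    rw [add_zero, add_sub_cancel] at hmod
    refine (hle x' _ _ hx' l hmod (hshift x _ hx hu _ hR2)).trans ?_
    refine H₃ _ _ _ _ _ l lv (hshift x _ hx hu _ hR3) (hbox x hx _ (by linarith)) fun θ => ?_
    rw [add_sub_cancel_left, add_sub_cancel_left]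
    exact ⟨abs_harmonic_le _ θ, abs_harmonicDeriv_le _ θ⟩
  have hcont : ContinuousOn φ (Metric.closedBall 0 ρ) := by
    have : LipschitzOnWith C.toNNReal φ (Metric.closedBall 0 ρ) := by
      refine LipschitzOnWith.of_le_add_mul _ fun x hx y hy => ?_
      rw [dist_eq_norm, Real.coe_toNNReal _ hC.le]
      exact hlip y x (by simpa using hy) (by simpa using hx)
    exact this.continuousOn
  obtain ⟨x, hxmem, hxmin⟩ := (isCompact_closedBall (0:ℂ) ρ).exists_isMinOn
    ⟨0, by simpa using hρ0.le⟩ hcont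
  have hx : ‖x‖ ≤ ρ := by simpa using hxmem
  replace hxmin : ∀ y : ℂ, ‖y‖ ≤ ρ → φ x ≤ φ y := fun y hy => hxmin (by simpa using hy)
  have lv := (hv x hx).1.isLoop
  have hconst : φ x ≤ 2 * π * g m := by
    refine (hxmin 0 (by simpa using hρ0.le)).trans ?_
    rw [← energy_const hg]
    exact hle 0 _ _ (by simpa using hρ0.le) (IsLoop.const m) (hasModes_const m) fun θ =>
      ⟨by linarith, by simpa using hρ₂.le⟩
  -- On the boundary circle, shifting the loop to mean `m₀` and using the quartic bound gives a
  -- length above that of the parallel `m`, contradicting minimality.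
  have hxlt : ‖x‖ < ρ := by
    rcases hx.lt_or_eq with hlt | heq
    · exact hlt
    exfalso
    have l := lv.add (IsLoop.const (m₀ - m))
    have hmod := (hv x hx).2.1.add (hasModes_const (m₀ - m)) lv.continuous continuous_const
    rw [add_zero, add_sub_cancel] at hmod
    simp only [add_zero] at l
    have hb : ∀ r, 4 * R ≤ r → ∀ θ, |v x θ + (m₀ - m) - m₀| ≤ r ∧ |v' x θ| ≤ r := by
      intro r hr θ
      obtain ⟨b3, b4⟩ := hbox x hx R le_rfl θ
      refine ⟨?_, by linarith⟩
      rw [add_sub_right_comm]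
      refine (abs_add_le _ _).trans ?_
      rw [abs_sub_comm m₀ m]; linarith
    have e1 := hquartic _ _ x l hmod (hb _ hR4)
    have e2 := H₃ _ _ _ _ |m - m₀| l lv (hb _ hR3) (hbox x hx _ (by linarith)) fun θ => by
      rw [add_sub_cancel_left, sub_self, abs_zero, abs_sub_comm]
      exact ⟨le_rfl, abs_nonneg _⟩
    have e3 := H₃ _ _ _ _ |m - m₀| (IsLoop.const m) (IsLoop.const m₀)
      (fun θ => ⟨by linarith, by simpa using hρ₃.le⟩)
      (fun θ => ⟨by simpa using hρ₃.le, by simpa using hρ₃.le⟩)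
      fun θ => ⟨le_rfl, by simp⟩
    rw [energy_const hg, energy_const hg] at e3
    rw [heq] at e1
    have : 0 < k * ρ ^ 4 := by positivity
    change _ ≤ φ x + _ at e2
    linarith
  -- An interior minimum in `x` is a minimum under all small shifts by first harmonics.
  have hzero : b x = 0 ∧ c x = 0 := by
    refine H₅ _ _ _ _ _ _ (ρ - ‖x‖) (hv x hx).1 (hbox x hx _ (by linarith)) (by linarith)
      fun u hu => ?_
    have hxu : ‖x + u‖ ≤ ρ := (norm_add_le _ _).trans (by linarith)
    have hmod := (hv x hx).2.1.add (hasModes_harmonic u) lv.continuous (continuous_harmonic _)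
    rw [add_zero] at hmod
    exact (hxmin _ hxu).trans (hle _ _ _ hxu (lv.add (isLoop_harmonic u)) hmod
      (hshift x u hx (by linarith [norm_nonneg x]) _ hR2))
  refine ⟨v x, v' x, q x, h x, ?_, fun θ => ?_, ?_, min R ((ρ - ‖x‖) / 4), ?_, ?_⟩
  · have := (hv x hx).1
    rwa [hzero.1, hzero.2] at this
  · obtain ⟨b1, b2, b3⟩ := (hv x hx).2.2 θ
    exact ⟨by linarith, by linarith, by linarith⟩
  -- A constant minimizer would be the parallel `m`, which a first harmonic shortens.
  · by_contra hc
    push Not at hc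
    have hconstv : ∀ θ, v x θ = v x 0 := fun θ =>
      is_const_of_deriv_eq_zero (fun θ => (lv.hasDerivAt θ).differentiableAt)
        (fun θ => by rw [(lv.hasDerivAt θ).deriv, hc θ]) θ 0
    have hmean := (hv x hx).2.1.mean
    rw [intervalIntegral.integral_congr fun θ _ => hconstv θ, integral_const_period] at hmean
    have hv0 : v x 0 = m := mul_left_cancel₀ (by positivity : 2 * π ≠ 0) hmean
    have hen : φ x = 2 * π * g m := by
      rw [← energy_const hg]
      simp only [hφ]
      congr 1
      · funext θ; rw [hconstv θ, hv0]
      · funext θ; exact hc θ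
    obtain ⟨y, hy, hlt⟩ := exists_energy_lt_const hg (h2 m) hneg hρ0
    have l := (IsLoop.const m).add (isLoop_harmonic y)
    have hmod := (hasModes_const m).add (hasModes_harmonic y) continuous_const
      (continuous_harmonic _)
    rw [add_zero, zero_add] at hmod
    simp only [zero_add] at l
    have := (hxmin y hy).trans (hle y _ _ hy l hmod fun θ => by
      have b1 := abs_harmonic_le y θ
      have b2 := abs_harmonicDeriv_le y θ
      refine ⟨?_, by linarith⟩
      rw [add_sub_right_comm]
      exact (abs_add_le _ _).trans (by linarith))
    linarith
  · exact lt_min hR0 (by linarith)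
  -- The competitor has first modes `y` in the disc, so its length is at least `φ y ≥ φ x`. The
  -- denominator 4 in the radius is the constant of `norm_le_of_hasModes`.
  · intro w w' hw hmean hwb
    set y : ℂ := ⟨(∫ θ in (0:ℝ)..2 * π, w θ * cos θ) / π, (∫ θ in (0:ℝ)..2 * π, w θ * sin θ) / π⟩
      with hy
    have hwm : HasModes w m y := by
      refine ⟨by rw [hmean, (hv x hx).2.1.mean], ?_, ?_⟩
      · rw [hy]; field_simp
      · rw [hy]; field_simp
    have hd := hwm.sub (hv x hx).2.1 hw.continuous lv.continuous
    rw [sub_self] at hd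
    have hn := norm_le_of_hasModes (m₀ := 0) (ρ := (ρ - ‖x‖) / 4) (hw.sub lv).continuous hd
      fun θ => by rw [sub_zero]; exact (hwb θ).1.trans (min_le_right _ _)
    have hyρ : ‖y‖ ≤ ρ := by
      have := norm_add_le (y - x) x
      rw [sub_add_cancel] at this
      linarith
    refine (hxmin y hyρ).trans (hle y _ _ hyρ hw hwm fun θ => ?_)
    obtain ⟨b3, b4⟩ := hbox x hx R le_rfl θ
    obtain ⟨b1, b2⟩ := hwb θ
    have b1' := b1.trans (min_le_left _ _)
    have b2' := b2.trans (min_le_left _ _)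
    rw [abs_le] at b1' b2' b3 b4
    exact ⟨abs_le.2 ⟨by linarith, by linarith⟩, abs_le.2 ⟨by linarith, by linarith⟩⟩

/-! ### The torus in the area coordinate -/

/-- Applied to the area primitive, to arc length as a function of the angle, and to the angle along
a varied curve. -/
theorem exists_inverse {Θ Θ' : ℝ → ℝ} {l p : ℝ} (hd : ∀ s, HasDerivAt Θ (Θ' s) s)
    (hpos : ∀ s, 0 < Θ' s) (hp : 0 < p) (hper : ∀ s, Θ (s + l) = Θ s + p) :
    ∃ Ψ : ℝ → ℝ, (∀ s, Ψ (Θ s) = s) ∧ (∀ y, Θ (Ψ y) = y) ∧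
      (∀ y, HasDerivAt Ψ (Θ' (Ψ y))⁻¹ y) ∧ ∀ y, Ψ (y + p) = Ψ y + l := by
  have hmono : StrictMono Θ := strictMono_of_deriv_pos fun s => by rw [(hd s).deriv]; exact hpos s
  have hcont : Continuous Θ := continuous_iff_continuousAt.2 fun s => (hd s).continuousAt
  have hnat : ∀ n : ℕ, ∀ s, Θ (s + n * l) = Θ s + n * p := by
    intro n
    induction n with
    | zero => simp
    | succ n ih =>
      intro s
      push_cast
      rw [show s + (n + 1) * l = (s + n * l) + l by ring, hper, ih]; ring
  have htop : Tendsto Θ atTop atTop := by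
    refine tendsto_atTop_atTop_of_monotone hmono.monotone fun b => ?_
    obtain ⟨n, hn⟩ := exists_nat_ge ((b - Θ 0) / p)
    refine ⟨0 + n * l, ?_⟩
    rw [hnat]
    rw [div_le_iff₀ hp] at hn
    linarith
  have hbot : Tendsto Θ atBot atBot := by
    refine tendsto_atBot_atBot_of_monotone hmono.monotone fun b => ?_
    obtain ⟨n, hn⟩ := exists_nat_ge ((Θ 0 - b) / p)
    refine ⟨0 - n * l, ?_⟩
    have := hnat n (0 - n * l)
    rw [sub_add_cancel] at this
    rw [div_le_iff₀ hp] at hn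
    linarith
  have hsurj : Function.Surjective Θ := hcont.surjective htop hbot
  let e := hmono.orderIsoOfSurjective Θ hsurj
  have h1 : ∀ s, e.symm (Θ s) = s := fun s => e.symm_apply_apply s
  have h2 : ∀ y, Θ (e.symm y) = y := fun y => e.apply_symm_apply y
  refine ⟨e.symm, h1, h2, fun y => ?_, fun y => ?_⟩
  · exact (hd _).of_local_left_inverse e.symm.continuous.continuousAt (hpos _).ne'
      (Eventually.of_forall h2)
  · rw [← h1 (e.symm y + l), hper, h2]

/-- The primitive of `profile a r` which vanishes at `0`. -/
noncomputable def primitive (a r t : ℝ) : ℝ := a * t + r ^ 2 * sin (t / r)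

theorem hasDerivAt_sin_div {r : ℝ} (t : ℝ) : HasDerivAt (fun t => sin (t / r)) (cos (t / r) / r) t := by
  refine ((hasDerivAt_id t).div_const r).sin.congr_deriv ?_
  simp; ring

theorem hasDerivAt_cos_div {r : ℝ} (t : ℝ) :
    HasDerivAt (fun t => cos (t / r)) (-sin (t / r) / r) t := by
  refine ((hasDerivAt_id t).div_const r).cos.congr_deriv ?_
  simp; ring

theorem hasDerivAt_primitive {a r : ℝ} (hr : 0 < r) (t : ℝ) :
    HasDerivAt (primitive a r) (profile a r t) t := by
  refine (((hasDerivAt_id t).const_mul a).add ((hasDerivAt_sin_div (r := r) t).const_mul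
    (r ^ 2))).congr_deriv ?_
  have := hr.ne'
  unfold profile; field_simp

theorem hasDerivAt_profile {a r : ℝ} (hr : 0 < r) (t : ℝ) :
    HasDerivAt (profile a r) (-sin (t / r)) t := by
  refine (((hasDerivAt_cos_div (r := r) t).const_mul r).const_add a).congr_deriv ?_
  field_simp

theorem profile_pos {a r : ℝ} (hr : 0 < r) (hra : r < a) (t : ℝ) : 0 < profile a r t := by
  unfold profile
  nlinarith [neg_one_le_cos (t / r)]

theorem primitive_add_period {a r : ℝ} (hr : 0 < r) (t : ℝ) :
    primitive a r (t + 2 * π * r) = primitive a r t + 2 * π * r * a := by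
  unfold primitive
  rw [show (t + 2 * π * r) / r = t / r + 2 * π by field_simp, sin_add_two_pi]; ring

theorem continuous_profile (a r : ℝ) : Continuous (profile a r) := by
  unfold profile; fun_prop

theorem integral_profile {a r : ℝ} (hr : 0 < r) (t : ℝ) :
    ∫ x in (0:ℝ)..t, profile a r x = primitive a r t := by
  rw [intervalIntegral.integral_eq_sub_of_hasDerivAt (fun x _ => hasDerivAt_primitive hr x)
    ((continuous_profile a r).intervalIntegrable _ _)]
  simp [primitive]

/-- `G` is the inverse of `primitive a r`. -/
structure IsHeight (a r : ℝ) (G : ℝ → ℝ) : Prop where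
  left : ∀ t, G (primitive a r t) = t
  right : ∀ v, primitive a r (G v) = v
  hasDerivAt : ∀ v, HasDerivAt G (profile a r (G v))⁻¹ v

theorem exists_isHeight {a r : ℝ} (hr : 0 < r) (hra : r < a) : ∃ G, IsHeight a r G := by
  have hπ := pi_pos
  have ha := hr.trans hra
  obtain ⟨G, h1, h2, h3, -⟩ := exists_inverse (fun t => hasDerivAt_primitive (a := a) hr t)
    (profile_pos hr hra) (by positivity) (primitive_add_period hr)
  exact ⟨G, h1, h2, h3⟩

/-- The radius and its derivatives, as functions of the area coordinate. -/
noncomputable def radius (a r : ℝ) (G : ℝ → ℝ) (v : ℝ) : ℝ := profile a r (G v)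

/-- The first derivative of `radius`. -/
noncomputable def radius₁ (a r : ℝ) (G : ℝ → ℝ) (v : ℝ) : ℝ :=
  -sin (G v / r) * (profile a r (G v))⁻¹

/-- The second derivative of `radius`. -/
noncomputable def radius₂ (a r : ℝ) (G : ℝ → ℝ) (v : ℝ) : ℝ :=
  -(cos (G v / r) / r) * (profile a r (G v) ^ 2)⁻¹ - sin (G v / r) ^ 2 * (profile a r (G v) ^ 3)⁻¹

/-- The third derivative of `radius`. -/
noncomputable def radius₃ (a r : ℝ) (G : ℝ → ℝ) (v : ℝ) : ℝ :=
  sin (G v / r) / r ^ 2 * (profile a r (G v) ^ 3)⁻¹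
    - 4 * sin (G v / r) * cos (G v / r) / r * (profile a r (G v) ^ 4)⁻¹
    - 3 * sin (G v / r) ^ 3 * (profile a r (G v) ^ 5)⁻¹

/-- The fourth derivative of `radius`. -/
noncomputable def radius₄ (a r : ℝ) (G : ℝ → ℝ) (v : ℝ) : ℝ :=
  cos (G v / r) / r ^ 3 * (profile a r (G v) ^ 4)⁻¹
    + 3 * sin (G v / r) ^ 2 / r ^ 2 * (profile a r (G v) ^ 5)⁻¹
    - 4 * (cos (G v / r) ^ 2 - sin (G v / r) ^ 2) / r ^ 2 * (profile a r (G v) ^ 5)⁻¹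
    - 25 * sin (G v / r) ^ 2 * cos (G v / r) / r * (profile a r (G v) ^ 6)⁻¹
    - 15 * sin (G v / r) ^ 4 * (profile a r (G v) ^ 7)⁻¹

section

variable {a r : ℝ} {G : ℝ → ℝ}

theorem hasDerivAt_inv_pow_profile (hr : 0 < r) (hra : r < a) (hG : IsHeight a r G) (n : ℕ) (v : ℝ) :
    HasDerivAt (fun v => (profile a r (G v) ^ n)⁻¹)
      (n * sin (G v / r) * (profile a r (G v) ^ (n + 2))⁻¹) v := by
  have hpos := profile_pos hr hra (G v)
  have h := ((((hasDerivAt_profile (a := a) hr (G v)).comp v (hG.hasDerivAt v)).pow n).inv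
    (pow_pos hpos n).ne')
  refine h.congr_deriv ?_
  simp only [Function.comp_apply, Pi.pow_apply]
  cases n with
  | zero => simp
  | succ n =>
    simp only [Nat.add_sub_cancel]
    field_simp
    ring

theorem hasDerivAt_sin_height (hG : IsHeight a r G) (v : ℝ) :
    HasDerivAt (fun v => sin (G v / r)) (cos (G v / r) / r * (profile a r (G v))⁻¹) v :=
  (hasDerivAt_sin_div (G v)).comp v (hG.hasDerivAt v)

theorem hasDerivAt_cos_height (hG : IsHeight a r G) (v : ℝ) :
    HasDerivAt (fun v => cos (G v / r)) (-sin (G v / r) / r * (profile a r (G v))⁻¹) v :=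
  (hasDerivAt_cos_div (G v)).comp v (hG.hasDerivAt v)

theorem isRadius_radius (hr : 0 < r) (hra : r < a) (hG : IsHeight a r G) :
    IsRadius (radius a r G) (radius₁ a r G) (radius₂ a r G) := by
  have hpos := fun v => profile_pos hr hra (G v)
  have cG : Continuous G := continuous_iff_continuousAt.2 fun v => (hG.hasDerivAt v).continuousAt
  have cf := continuous_profile a r
  refine ⟨hpos, fun v => (hasDerivAt_profile hr (G v)).comp v (hG.hasDerivAt v), fun v => ?_, ?_⟩
  · have h := (hasDerivAt_sin_height hG v).neg.mul (hasDerivAt_inv_pow_profile hr hra hG 1 v)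
    simp only [pow_one] at h
    refine h.congr_deriv ?_
    have := (hpos v).ne'
    unfold radius₂
    simp only [Pi.neg_apply]
    field_simp
    push_cast
    ring
  · unfold radius₂
    have h2 : ∀ v, profile a r (G v) ^ 2 ≠ 0 := fun v => (pow_pos (hpos v) 2).ne'
    have h3 : ∀ v, profile a r (G v) ^ 3 ≠ 0 := fun v => (pow_pos (hpos v) 3).ne'
    fun_prop (disch := first | exact h2 _ | exact h3 _)

theorem hasDerivAt_radius₂ (hr : 0 < r) (hra : r < a) (hG : IsHeight a r G) (v : ℝ) :
    HasDerivAt (radius₂ a r G) (radius₃ a r G v) v := by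
  have hpos := (profile_pos hr hra (G v)).ne'
  have h := ((((hasDerivAt_cos_height hG v).div_const r).neg).mul
    (hasDerivAt_inv_pow_profile hr hra hG 2 v)).sub
    (((hasDerivAt_sin_height hG v).pow 2).mul (hasDerivAt_inv_pow_profile hr hra hG 3 v))
  refine h.congr_deriv ?_
  unfold radius₃
  simp only [Pi.neg_apply, Pi.pow_apply]
  field_simp
  push_cast
  ring

theorem hasDerivAt_radius₃ (hr : 0 < r) (hra : r < a) (hG : IsHeight a r G) (v : ℝ) :
    HasDerivAt (radius₃ a r G) (radius₄ a r G v) v := by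
  have hpos := (profile_pos hr hra (G v)).ne'
  have hs := hasDerivAt_sin_height hG v
  have hc := hasDerivAt_cos_height hG v
  have h := (((hs.div_const (r ^ 2)).mul (hasDerivAt_inv_pow_profile hr hra hG 3 v)).sub
    ((((hs.const_mul 4).mul hc).div_const r).mul (hasDerivAt_inv_pow_profile hr hra hG 4 v))).sub
    (((hs.pow 3).const_mul 3).mul (hasDerivAt_inv_pow_profile hr hra hG 5 v))
  refine h.congr_deriv ?_
  unfold radius₄
  simp only [Pi.mul_apply, Pi.pow_apply]
  field_simp
  push_cast
  ring

theorem differentiableAt_radius₄ (hr : 0 < r) (hra : r < a) (hG : IsHeight a r G) (v : ℝ) :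
    DifferentiableAt ℝ (radius₄ a r G) v := by
  have h4 := (hasDerivAt_inv_pow_profile hr hra hG 4 v).differentiableAt
  have h5 := (hasDerivAt_inv_pow_profile hr hra hG 5 v).differentiableAt
  have h6 := (hasDerivAt_inv_pow_profile hr hra hG 6 v).differentiableAt
  have h7 := (hasDerivAt_inv_pow_profile hr hra hG 7 v).differentiableAt
  have hs := (hasDerivAt_sin_height hG v).differentiableAt
  have hc := (hasDerivAt_cos_height hG v).differentiableAt
  unfold radius₄
  fun_prop

/-- The sign of this quantity decides the stability of the parallel: it vanishes where `cos (t/r) =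
0` and is negative, that is unstable, where the cosine is positive. -/
theorem radius₂_add (hr : 0 < r) (hra : r < a) (v : ℝ) :
    radius₂ a r G v + (radius a r G v ^ 3)⁻¹
      = -(a * cos (G v / r) / (r * profile a r (G v) ^ 3)) := by
  have hpos := profile_pos hr hra (G v)
  have h1 := sin_sq_add_cos_sq (G v / r)
  have h2 : profile a r (G v) = a + r * cos (G v / r) := rfl
  unfold radius₂ radius
  field_simp
  rw [h2]
  linear_combination (-r) * h1

/-- At `cos = 0` one has `f = a` and `sin² = 1`, and the difference of the two sides is `(9r² -
a²)/(96 r⁴ a⁵)`. Its sign is decided by `a < 3 * r`. -/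
theorem quartic_condition (hr : 0 < r) (hra : r < a) (har : a < 3 * r) {v : ℝ}
    (hc : cos (G v / r) = 0) :
    3 / 8 * (radius₃ a r G v / 6 + -3 * radius₁ a r G v * (radius a r G v ^ 4)⁻¹ / 2) ^ 2
        / (radius a r G v ^ 3)⁻¹
      < (3 * (radius₄ a r G v / 24) + (3 * radius₁ a r G v ^ 2 * (radius a r G v ^ 5)⁻¹
        - 3 / 4 * radius₂ a r G v * (radius a r G v ^ 4)⁻¹)
        + 3 * (-(radius a r G v ^ 7)⁻¹ / 8)) / 4 := by
  have ha := hr.trans hra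
  have hf : profile a r (G v) = a := by unfold profile; rw [hc]; ring
  have hs2 : sin (G v / r) ^ 2 = 1 := by
    have := sin_sq_add_cos_sq (G v / r)
    rw [hc] at this
    linarith
  set e := sin (G v / r) with he
  have hs3 : e ^ 3 = e := by rw [pow_succ, hs2, one_mul]
  have hs4 : e ^ 4 = 1 := by rw [show e ^ 4 = (e ^ 2) ^ 2 by ring, hs2]; norm_num
  unfold radius radius₁ radius₂ radius₃ radius₄
  rw [hf, hc, ← he, hs3, hs4, hs2]
  have e1 : 3 / 8 * ((e / r ^ 2 * (a ^ 3)⁻¹ - 4 * e * 0 / r * (a ^ 4)⁻¹ - 3 * e * (a ^ 5)⁻¹) / 6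
      + -3 * (-e * a⁻¹) * (a ^ 4)⁻¹ / 2) ^ 2 / (a ^ 3)⁻¹
      = e ^ 2 * (3 / 8 * (1 / (6 * r ^ 2 * a ^ 3) + 1 / a ^ 5) ^ 2 * a ^ 3) := by
    field_simp
    ring
  rw [e1, hs2, ← sub_pos]
  have e3 : (-e * a⁻¹) ^ 2 = (a ^ 2)⁻¹ := by rw [mul_pow, neg_sq, hs2, one_mul, inv_pow]
  rw [e3]
  have e2 : 0 < (9 * r ^ 2 - a ^ 2) / (96 * r ^ 4 * a ^ 5) := by
    apply div_pos _ (by positivity)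
    nlinarith
  refine lt_of_lt_of_eq e2 ?_
  field_simp
  ring

end

/-! ### Equilibria of the ODE and critical points of periodic functions -/

section

/-- A critical curve without multipliers which is tangent to a parallel with vanishing second
derivative is a parallel. -/
theorem deriv_eq_zero_of_equilibrium (hg : IsRadius g g₁ g₂) (m₀ : ℝ) :
    ∃ ρ > 0, ∀ (v v' q : ℝ → ℝ) (h θ₀ : ℝ), IsCritical g g₁ v v' q h 0 0 →
      (∀ θ, |v θ - m₀| ≤ ρ ∧ |q θ| ≤ ρ) → q θ₀ = 0 → force g g₁ (v θ₀) (q θ₀) + h = 0 →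
      ∀ θ, v' θ = 0 := by
  obtain ⟨ρ₁, hρ₁, H₁⟩ := strictAt_velocity hg m₀ 1 one_pos
  obtain ⟨ρ₂, hρ₂, H₂⟩ := strictAt_force hg m₀ 1 one_pos
  refine ⟨min ρ₁ ρ₂, by positivity, fun v v' q h θ₀ hv hb hq hF θ => ?_⟩
  set ρ := min ρ₁ ρ₂
  let Y : ℝ × ℝ → ℝ × ℝ := fun z => (velocity g z.1 z.2, force g g₁ z.1 z.2 + h)
  let B : Set (ℝ × ℝ) := {z | |z.1 - m₀| ≤ ρ ∧ |z.2| ≤ ρ}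
  set K := 2 * (|g m₀ ^ 3| + |g₂ m₀| + 2) with hK
  have hK0 : 0 ≤ K := by positivity
  have hY : LipschitzOnWith K.toNNReal Y B := by
    refine LipschitzOnWith.of_dist_le_mul fun z hz w hw => ?_
    rw [Real.coe_toNNReal _ hK0, dist_eq_norm, dist_eq_norm, Prod.norm_def]
    have n1 : |z.1 - w.1| ≤ ‖z - w‖ := norm_fst_le (z - w)
    have n2 : |z.2 - w.2| ≤ ‖z - w‖ := norm_snd_le (z - w)
    have k1 := H₁ _ _ _ _ (hw.1.trans (min_le_left _ _)) (hw.2.trans (min_le_left _ _))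
      (hz.1.trans (min_le_left _ _)) (hz.2.trans (min_le_left _ _))
    have k2 := H₂ _ _ _ _ (hw.1.trans (min_le_right _ _)) (hw.2.trans (min_le_right _ _))
      (hz.1.trans (min_le_right _ _)) (hz.2.trans (min_le_right _ _))
    rw [zero_mul, zero_add, one_mul] at k1
    rw [zero_mul, add_zero, one_mul] at k2
    have a1 := abs_sub_abs_le_abs_sub (velocity g z.1 z.2 - velocity g w.1 w.2)
      (g m₀ ^ 3 * (z.2 - w.2))
    have a2 := abs_sub_abs_le_abs_sub (force g g₁ z.1 z.2 - force g g₁ w.1 w.2)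
      (g₂ m₀ * (z.1 - w.1))
    rw [abs_mul (g m₀ ^ 3)] at a1
    rw [abs_mul (g₂ m₀)] at a2
    have p1 := mul_le_mul_of_nonneg_left n2 (abs_nonneg (g m₀ ^ 3))
    have p2 := mul_le_mul_of_nonneg_left n1 (abs_nonneg (g₂ m₀))
    have p3 := mul_nonneg (abs_nonneg (g m₀ ^ 3)) (norm_nonneg (z - w))
    have p4 := mul_nonneg (abs_nonneg (g₂ m₀)) (norm_nonneg (z - w))
    have p5 := norm_nonneg (z - w)
    refine max_le ?_ ?_
    · change |velocity g z.1 z.2 - velocity g w.1 w.2| ≤ _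
      rw [hK]; linarith
    · change |force g g₁ z.1 z.2 + h - (force g g₁ w.1 w.2 + h)| ≤ _
      rw [add_sub_add_right_eq_sub, hK]; linarith
  -- The constant `(v θ₀, q θ₀)` solves the same autonomous system, whose vector field is Lipschitz
  -- on the box.
  have key := ODE_solution_unique_univ (v := fun _ => Y) (s := fun _ => B)
    (f := fun θ => (v θ, q θ)) (g := fun _ => (v θ₀, q θ₀)) (t₀ := θ₀) (fun _ => hY)
    (fun θ => ⟨by
      have h1 := hv.isLoop.hasDerivAt θ
      rw [hv.velocity] at h1
      have h2 := hv.hasDerivAt θ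
      rw [zero_mul, zero_mul, add_zero, add_zero] at h2
      exact h1.prodMk h2, hb θ⟩)
    (fun θ => ⟨by
      have : Y (v θ₀, q θ₀) = 0 := by
        simp only [Y]
        rw [hF, hq]
        simp [velocity]
      rw [this]
      exact hasDerivAt_const _ _, hb θ₀⟩) rfl
  have : q θ = q θ₀ := congrArg Prod.snd (congrFun key θ)
  rw [hv.velocity, this, hq]
  simp [velocity]

end

/-- First and second derivative test for a strict local maximum, with signs of the derivative. -/
theorem deriv_signs_of_second_deriv_neg {φ φ' : ℝ → ℝ} {c s₀ : ℝ} (hd : ∀ s, HasDerivAt φ (φ' s) s)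
    (h0 : φ' s₀ = 0) (h2 : HasDerivAt φ' c s₀) (hc : c < 0) :
    ∃ δ > 0, (∀ s ∈ Ioo s₀ (s₀ + δ), φ' s < 0) ∧
      ∀ s, |s - s₀| < δ → s ≠ s₀ → φ s < φ s₀ := by
  have h := (hasDerivAt_iff_tendsto_slope.1 h2).eventually (gt_mem_nhds hc)
  rw [eventually_nhdsWithin_iff, Metric.eventually_nhds_iff] at h
  obtain ⟨δ, hδ, H⟩ := h
  have sl : ∀ s, |s - s₀| < δ → s ≠ s₀ → φ' s / (s - s₀) < 0 := by
    intro s hs hne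
    have := H (y := s) hs hne
    rwa [slope_def_field, h0, sub_zero] at this
  have right : ∀ s ∈ Ioo s₀ (s₀ + δ), φ' s < 0 := by
    intro s hs
    have hp : 0 < s - s₀ := sub_pos.2 hs.1
    have := sl s (by rw [abs_of_pos hp]; linarith [hs.2]) hs.1.ne'
    rwa [div_neg_iff, or_iff_right (fun h => absurd h.2 (by linarith)), and_iff_left hp] at this
  have left : ∀ s ∈ Ioo (s₀ - δ) s₀, 0 < φ' s := by
    intro s hs
    have hp : s - s₀ < 0 := sub_neg.2 hs.2
    have := sl s (by rw [abs_of_neg hp]; linarith [hs.1]) hs.2.ne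
    rwa [div_neg_iff, or_iff_left (fun h => absurd h.2 (by linarith)), and_iff_left hp] at this
  have hcont : Continuous φ := continuous_iff_continuousAt.2 fun s => (hd s).continuousAt
  refine ⟨δ, hδ, right, fun s hs hne => ?_⟩
  rcases lt_or_gt_of_ne hne with hlt | hgt
  · rw [abs_of_neg (sub_neg.2 hlt)] at hs
    have := strictMonoOn_of_deriv_pos (convex_Icc s s₀) hcont.continuousOn fun x hx => by
      rw [interior_Icc] at hx
      rw [(hd x).deriv]
      exact left x ⟨by linarith [hx.1], hx.2⟩
    exact this ⟨le_rfl, hlt.le⟩ ⟨hlt.le, le_rfl⟩ hlt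
  · rw [abs_of_pos (sub_pos.2 hgt)] at hs
    have := strictAntiOn_of_deriv_neg (convex_Icc s₀ s) hcont.continuousOn fun x hx => by
      rw [interior_Icc] at hx
      rw [(hd x).deriv]
      exact right x ⟨hx.1, by linarith [hx.2]⟩
    exact this ⟨le_rfl, hgt.le⟩ ⟨hgt.le, le_rfl⟩ hgt

/-- A periodic function with nonzero second derivative at its maxima has a strict local maximum,
followed by a next critical point. -/
theorem exists_max_next_critical {φ φ' φ'' : ℝ → ℝ} {l : ℝ} (hl : 0 < l)
    (hd : ∀ s, HasDerivAt φ (φ' s) s) (hd' : ∀ s, HasDerivAt φ' (φ'' s) s)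
    (hper : Function.Periodic φ l) (hne : ∀ s, φ' s = 0 → φ'' s ≠ 0) :
    ∃ s₀ s₁ : ℝ, s₀ < s₁ ∧ (∀ᶠ s in 𝓝[≠] s₀, φ s < φ s₀) ∧ (∀ s ∈ Ioo s₀ s₁, φ' s ≠ 0) ∧
      φ' s₀ = 0 ∧ φ' s₁ = 0 := by
  have hcont : Continuous φ := continuous_iff_continuousAt.2 fun s => (hd s).continuousAt
  have hcont' : Continuous φ' := continuous_iff_continuousAt.2 fun s => (hd' s).continuousAt
  obtain ⟨s₀, -, hmax⟩ := isCompact_Icc.exists_isMaxOn (nonempty_Icc.2 hl.le) hcont.continuousOn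
  have hmax' : ∀ s, φ s ≤ φ s₀ := fun s => by
    obtain ⟨y, hy, e⟩ := hper.exists_mem_Ico₀ hl s
    rw [e]; exact hmax (Ico_subset_Icc_self hy)
  have h0 : φ' s₀ = 0 := by
    have : IsLocalMax φ s₀ := Eventually.of_forall hmax'
    exact this.hasDerivAt_eq_zero (hd s₀)
  have hc : φ'' s₀ < 0 := by
    refine lt_of_le_of_ne (le_of_not_gt fun hpos => ?_) (hne s₀ h0)
    obtain ⟨δ, hδ, -, H⟩ := deriv_signs_of_second_deriv_neg (φ := fun s => -φ s)
      (φ' := fun s => -φ' s) (fun s => (hd s).neg) (by rw [h0, neg_zero]) (hd' s₀).neg (by linarith)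
    have := H (s₀ + δ / 2) (by rw [add_sub_cancel_left, abs_of_pos (by positivity)]; linarith)
      (by linarith)
    linarith [hmax' (s₀ + δ / 2)]
  obtain ⟨δ, hδ, hright, hstrict⟩ := deriv_signs_of_second_deriv_neg hd h0 (hd' s₀) hc
  have hper' : φ' (s₀ + l) = 0 := by
    have h1 := (hd (s₀ + l)).comp_add_const s₀ l
    rw [show (fun x => φ (x + l)) = φ from funext hper] at h1
    rw [h1.unique (hd s₀), h0]
  -- The derivative is negative just after `s₀`, so the next zero can be sought in the compact set
  -- `[s₀ + t, s₀ + l]`; it exists because `s₀ + l` is a zero by periodicity.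
  set t := min (δ / 2) l with ht
  have ht0 : 0 < t := by positivity
  have hZ : IsCompact (Icc (s₀ + t) (s₀ + l) ∩ {s | φ' s = 0}) :=
    isCompact_Icc.inter_right (isClosed_eq hcont' continuous_const)
  obtain ⟨s₁, hs₁, hleast⟩ := hZ.exists_isLeast
    ⟨s₀ + l, ⟨by linarith [min_le_right (δ / 2) l], le_rfl⟩, hper'⟩
  refine ⟨s₀, s₁, by linarith [hs₁.1.1], ?_, fun s hs hzero => ?_, h0, hs₁.2⟩
  · rw [eventually_nhdsWithin_iff, Metric.eventually_nhds_iff]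
    exact ⟨δ, hδ, fun s hs hne => hstrict s hs hne⟩
  · by_cases hlt : s < s₀ + t
    · have := hright s ⟨hs.1, by linarith [min_le_left (δ / 2) l]⟩
      linarith
    · have := hleast ⟨⟨not_lt.1 hlt, by linarith [hs.2, hs₁.1.2]⟩, hzero⟩
      linarith [hs.2]

theorem contDiff_two_of_hasDerivAt {γ γ' γ'' : ℝ → ℝ × ℝ} (h1 : ∀ s, HasDerivAt γ (γ' s) s)
    (h2 : ∀ s, HasDerivAt γ' (γ'' s) s) (hc : Continuous γ'') : ContDiff ℝ 2 γ := by
  have e1 : deriv γ = γ' := funext fun s => (h1 s).deriv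
  have e2 : deriv γ' = γ'' := funext fun s => (h2 s).deriv
  rw [show (2 : WithTop ℕ∞) = 1 + 1 by norm_num, contDiff_succ_iff_deriv, e1]
  refine ⟨fun s => (h1 s).differentiableAt, by simp, ?_⟩
  rw [contDiff_one_iff_deriv, e2]
  exact ⟨fun s => (h2 s).differentiableAt, hc⟩

/-! ### From critical loops to curves on the torus -/

theorem IsLoop.continuous_lengthDensity {g g₁ g₂ w w' : ℝ → ℝ} (hw : IsLoop w w')
    (hg : IsRadius g g₁ g₂) : Continuous fun θ => lengthDensity g (w θ) (w' θ) :=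
  (TorusUnduloid.continuous_lengthDensity hg).comp (hw.continuous.prodMk hw.continuous_deriv)

theorem IsLoop.periodic_lengthDensity {w w' : ℝ → ℝ} (hw : IsLoop w w') (g : ℝ → ℝ) :
    Function.Periodic (fun θ => lengthDensity g (w θ) (w' θ)) (2 * π) := fun x => by
  simp only [hw.periodic x, hw.periodic_deriv x]

/-- `Θ` is the angle, as a function of arc length, along the curve `t = G(v(θ))` of length `l`. -/
structure IsArclength (a r : ℝ) (G v q : ℝ → ℝ) (l : ℝ) (Θ : ℝ → ℝ) : Prop where
  pos : 0 < l
  add_period : ∀ s, Θ (s + l) = Θ s + 2 * π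
  injective : Function.Injective Θ
  hasDerivAt : ∀ s, HasDerivAt Θ
    (√(1 - profile a r (G (v (Θ s))) ^ 2 * q (Θ s) ^ 2) / profile a r (G (v (Θ s)))) s
  hasDerivAt_height : ∀ s,
    HasDerivAt (fun s => G (v (Θ s))) (profile a r (G (v (Θ s))) * q (Θ s)) s

/-- `Θ` inverts the arc length function `θ ↦ ∫₀^θ` of the length density. The period `l` is the
energy. -/
theorem exists_isArclength {a r : ℝ} {G v v' q : ℝ → ℝ} {h : ℝ} (hr : 0 < r) (hra : r < a)
    (hG : IsHeight a r G) (hv : IsCritical (radius a r G) (radius₁ a r G) v v' q h 0 0) :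
    ∃ (l : ℝ) (Θ : ℝ → ℝ), IsArclength a r G v q l Θ := by
  have hg := isRadius_radius hr hra hG
  have cL : Continuous fun θ => lengthDensity (radius a r G) (v θ) (v' θ) :=
    hv.isLoop.continuous_lengthDensity hg
  have hd : ∀ θ, HasDerivAt (fun θ => ∫ x in (0:ℝ)..θ, lengthDensity (radius a r G) (v x) (v' x))
      (lengthDensity (radius a r G) (v θ) (v' θ)) θ := fun θ =>
    (cL.integral_hasStrictDerivAt 0 θ).hasDerivAt
  have hLp := fun θ => lengthDensity_pos hg (v θ) (v' θ)
  have hl : 0 < energy (radius a r G) v v' :=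
    intervalIntegral.intervalIntegral_pos_of_pos (cL.intervalIntegrable _ _) hLp (by positivity)
  have hper : ∀ θ, (∫ x in (0:ℝ)..θ + 2 * π, lengthDensity (radius a r G) (v x) (v' x))
      = (∫ x in (0:ℝ)..θ, lengthDensity (radius a r G) (v x) (v' x))
        + energy (radius a r G) v v' := by
    intro θ
    have hp := hv.isLoop.periodic_lengthDensity (radius a r G)
    rw [← intervalIntegral.integral_add_adjacent_intervals (cL.intervalIntegrable 0 θ)
      (cL.intervalIntegrable θ _), hp.intervalIntegral_add_eq θ 0, zero_add]
    rfl
  obtain ⟨Θ, -, h2, h3, h4⟩ := exists_inverse hd hLp hl hper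
  have hΘ : ∀ s, HasDerivAt Θ (√(1 - radius a r G (v (Θ s)) ^ 2 * q (Θ s) ^ 2)
        / profile a r (G (v (Θ s)))) s := by
    intro s
    refine (h3 s).congr_deriv ?_
    rw [hv.velocity, lengthDensity_velocity hg (hv.sine_pos _), inv_div]
    rfl
  refine ⟨_, Θ, hl, h4, fun s s' e => by rw [← h2 s, e, h2], hΘ, fun s => ?_⟩
  have hS := sqrt_pos.2 (by linarith [hv.sine_pos (Θ s)] :
    0 < 1 - radius a r G (v (Θ s)) ^ 2 * q (Θ s) ^ 2)
  have hf := profile_pos hr hra (G (v (Θ s)))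
  refine ((hG.hasDerivAt _).comp s ((hv.isLoop.hasDerivAt _).comp s (hΘ s))).congr_deriv ?_
  rw [hv.velocity, velocity]
  simp only [Function.comp_apply]
  change _ * (profile a r (G (v (Θ s))) ^ 3 * q (Θ s) / _ * _) = _
  generalize √(1 - radius a r G (v (Θ s)) ^ 2 * q (Θ s) ^ 2) = S at hS ⊢
  field_simp

section geometry

variable {a r : ℝ} {G v v' q : ℝ → ℝ} {h l : ℝ} {Θ : ℝ → ℝ}

/-- The curve `t = G(v(θ))` parametrized by `θ = Θ(s)`. -/
def graphCurve (G v Θ : ℝ → ℝ) (s : ℝ) : ℝ × ℝ := (Θ s, G (v (Θ s)))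

/-- The sine of the angle from `∂_t` to `graphCurve`. -/
noncomputable def sine (a r : ℝ) (G v q Θ : ℝ → ℝ) (s : ℝ) : ℝ :=
  √(1 - profile a r (G (v (Θ s))) ^ 2 * q (Θ s) ^ 2)

/-- The derivative of the sine of the angle from `∂_t` to `graphCurve`. -/
noncomputable def sine' (a r : ℝ) (G v q Θ : ℝ → ℝ) (h s : ℝ) : ℝ :=
  -(profile a r (G (v (Θ s))) * q (Θ s) *
    (-sin (G (v (Θ s)) / r) / profile a r (G (v (Θ s))) * sine a r G v q Θ s + h))

/-- The second derivative of the angle along `graphCurve`. -/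
noncomputable def angle'' (a r : ℝ) (G v q Θ : ℝ → ℝ) (h s : ℝ) : ℝ :=
  sine' a r G v q Θ h s / profile a r (G (v (Θ s)))
    + sine a r G v q Θ s * sin (G (v (Θ s)) / r) * q (Θ s) / profile a r (G (v (Θ s)))

/-- The second derivative of the height along `graphCurve`. -/
noncomputable def height'' (a r : ℝ) (G v q Θ : ℝ → ℝ) (h s : ℝ) : ℝ :=
  -sin (G (v (Θ s)) / r) / profile a r (G (v (Θ s))) * sine a r G v q Θ s ^ 2
    + h * sine a r G v q Θ s

theorem sine_pos (hv : IsCritical (radius a r G) (radius₁ a r G) v v' q h 0 0) (s : ℝ) :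
    0 < sine a r G v q Θ s :=
  sqrt_pos.2 (sub_pos.2 (hv.sine_pos (Θ s)))

theorem sine_sq (hv : IsCritical (radius a r G) (radius₁ a r G) v v' q h 0 0) (s : ℝ) :
    sine a r G v q Θ s ^ 2 = 1 - profile a r (G (v (Θ s))) ^ 2 * q (Θ s) ^ 2 :=
  sq_sqrt (sub_pos.2 (hv.sine_pos (Θ s))).le

theorem hasDerivAt_momentum (hr : 0 < r) (hra : r < a)
    (hv : IsCritical (radius a r G) (radius₁ a r G) v v' q h 0 0)
    (hΘ : IsArclength a r G v q l Θ) (s : ℝ) :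
    HasDerivAt (fun s => q (Θ s)) (-sin (G (v (Θ s)) / r) / profile a r (G (v (Θ s))) ^ 2
      * (1 - 2 * (profile a r (G (v (Θ s))) ^ 2 * q (Θ s) ^ 2))
      + h * sine a r G v q Θ s / profile a r (G (v (Θ s)))) s := by
  refine ((hv.hasDerivAt (Θ s)).comp s (hΘ.hasDerivAt s)).congr_deriv ?_
  have hS := sine_pos (Θ := Θ) hv s
  have hf := profile_pos hr hra (G (v (Θ s)))
  simp only [force, radius₁, zero_mul, add_zero]
  change (_ / sine a r G v q Θ s + h) * (sine a r G v q Θ s / _) = _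
  unfold radius
  field_simp

theorem hasDerivAt_profile_height (hr : 0 < r) (hΘ : IsArclength a r G v q l Θ) (s : ℝ) :
    HasDerivAt (fun s => profile a r (G (v (Θ s))))
      (-sin (G (v (Θ s)) / r) * (profile a r (G (v (Θ s))) * q (Θ s))) s :=
  (hasDerivAt_profile hr _).comp s (hΘ.hasDerivAt_height s)

theorem hasDerivAt_sine (hr : 0 < r) (hra : r < a)
    (hv : IsCritical (radius a r G) (radius₁ a r G) v v' q h 0 0)
    (hΘ : IsArclength a r G v q l Θ) (s : ℝ) :
    HasDerivAt (sine a r G v q Θ) (sine' a r G v q Θ h s) s := by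
  have hS := sine_pos (Θ := Θ) hv s
  have hS2 := sine_sq (Θ := Θ) hv s
  have hf := profile_pos hr hra (G (v (Θ s)))
  refine ((((hasDerivAt_profile_height hr hΘ s).pow 2).mul
    ((hasDerivAt_momentum hr hra hv hΘ s).pow 2)).const_sub 1 |>.sqrt
      (sub_pos.2 (hv.sine_pos (Θ s))).ne').congr_deriv ?_
  change _ / (2 * sine a r G v q Θ s) = _
  unfold sine'
  generalize sine a r G v q Θ s = S at hS hS2 ⊢
  simp only [Pi.pow_apply, Nat.cast_ofNat]
  generalize profile a r (G (v (Θ s))) = f at hf hS2 ⊢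
  field_simp
  norm_num
  linear_combination -(q (Θ s) * sin (G (v (Θ s)) / r)) * hS2

theorem hasDerivAt_angle' (hr : 0 < r) (hra : r < a)
    (hv : IsCritical (radius a r G) (radius₁ a r G) v v' q h 0 0)
    (hΘ : IsArclength a r G v q l Θ) (s : ℝ) :
    HasDerivAt (fun s => sine a r G v q Θ s / profile a r (G (v (Θ s))))
      (angle'' a r G v q Θ h s) s := by
  have hf := profile_pos hr hra (G (v (Θ s)))
  refine ((hasDerivAt_sine hr hra hv hΘ s).div (hasDerivAt_profile_height hr hΘ s)
    hf.ne').congr_deriv ?_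
  unfold angle''
  field_simp
  ring

theorem hasDerivAt_height' (hr : 0 < r) (hra : r < a)
    (hv : IsCritical (radius a r G) (radius₁ a r G) v v' q h 0 0)
    (hΘ : IsArclength a r G v q l Θ) (s : ℝ) :
    HasDerivAt (fun s => profile a r (G (v (Θ s))) * q (Θ s)) (height'' a r G v q Θ h s) s := by
  have hf := profile_pos hr hra (G (v (Θ s)))
  refine ((hasDerivAt_profile_height hr hΘ s).mul (hasDerivAt_momentum hr hra hv hΘ s)).congr_deriv
    ?_
  unfold height''
  rw [sine_sq hv s]
  field_simp
  ring

theorem hasDerivAt_graphCurve (hΘ : IsArclength a r G v q l Θ) (s : ℝ) :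
    HasDerivAt (graphCurve G v Θ) (sine a r G v q Θ s / profile a r (G (v (Θ s))),
      profile a r (G (v (Θ s))) * q (Θ s)) s :=
  (hΘ.hasDerivAt s).prodMk (hΘ.hasDerivAt_height s)

theorem deriv_graphCurve (hΘ : IsArclength a r G v q l Θ) :
    deriv (graphCurve G v Θ) = fun s => (sine a r G v q Θ s / profile a r (G (v (Θ s))),
      profile a r (G (v (Θ s))) * q (Θ s)) :=
  funext fun s => (hasDerivAt_graphCurve hΘ s).deriv

theorem hasDerivAt_deriv_graphCurve (hr : 0 < r) (hra : r < a)
    (hv : IsCritical (radius a r G) (radius₁ a r G) v v' q h 0 0)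
    (hΘ : IsArclength a r G v q l Θ) (s : ℝ) :
    HasDerivAt (fun s => (sine a r G v q Θ s / profile a r (G (v (Θ s))),
      profile a r (G (v (Θ s))) * q (Θ s)))
      (angle'' a r G v q Θ h s, height'' a r G v q Θ h s) s :=
  (hasDerivAt_angle' hr hra hv hΘ s).prodMk (hasDerivAt_height' hr hra hv hΘ s)

theorem contDiff_graphCurve (hr : 0 < r) (hra : r < a)
    (hv : IsCritical (radius a r G) (radius₁ a r G) v v' q h 0 0)
    (hΘ : IsArclength a r G v q l Θ) : ContDiff ℝ 2 (graphCurve G v Θ) := by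
  refine contDiff_two_of_hasDerivAt (hasDerivAt_graphCurve hΘ)
    (hasDerivAt_deriv_graphCurve hr hra hv hΘ) ?_
  have c1 : Continuous fun s => G (v (Θ s)) :=
    continuous_iff_continuousAt.2 fun s => (hΘ.hasDerivAt_height s).continuousAt
  have c2 : Continuous fun s => q (Θ s) :=
    continuous_iff_continuousAt.2 fun s => (hasDerivAt_momentum hr hra hv hΘ s).continuousAt
  have c3 : Continuous (sine a r G v q Θ) :=
    continuous_iff_continuousAt.2 fun s => (hasDerivAt_sine hr hra hv hΘ s).continuousAt
  have c4 : Continuous fun s => profile a r (G (v (Θ s))) := (continuous_profile a r).comp c1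
  have hf : ∀ s, profile a r (G (v (Θ s))) ≠ 0 := fun s => (profile_pos hr hra _).ne'
  have c5 := c4.inv₀ hf
  unfold angle'' height'' sine'
  have c6 : Continuous fun s => sin (G (v (Θ s)) * r⁻¹) :=
    continuous_sin.comp (c1.mul continuous_const)
  simp only [div_eq_mul_inv]
  exact (((c4.mul c2).mul (((c6.neg.mul c5).mul c3).add continuous_const)).neg.mul c5).add
    (((c3.mul c6).mul c2).mul c5) |>.prodMk
    (((c6.neg.mul c5).mul (c3.pow 2)).add (continuous_const.mul c3))

theorem isUnitSpeed_graphCurve (hr : 0 < r) (hra : r < a)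
    (hv : IsCritical (radius a r G) (radius₁ a r G) v v' q h 0 0)
    (hΘ : IsArclength a r G v q l Θ) : IsUnitSpeed (profile a r) (graphCurve G v Θ) := by
  intro s
  have hf := profile_pos hr hra (G (v (Θ s)))
  have hS2 := sine_sq (Θ := Θ) hv s
  rw [deriv_graphCurve hΘ]
  simp only [metric, graphCurve]
  field_simp
  linarith

theorem sinAngle_graphCurve (hr : 0 < r) (hra : r < a) (hΘ : IsArclength a r G v q l Θ)
    (s : ℝ) : sinAngle (profile a r) (graphCurve G v Θ) s = sine a r G v q Θ s := by
  rw [sinAngle, deriv_graphCurve hΘ]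
  exact mul_div_cancel₀ _ (profile_pos hr hra _).ne'

/-- `h` is the Lagrange multiplier of the area, and the Euler–Lagrange equation says that the
curvature is this constant up to sign. -/
theorem geodesicCurvature_graphCurve (hr : 0 < r) (hra : r < a)
    (hv : IsCritical (radius a r G) (radius₁ a r G) v v' q h 0 0)
    (hΘ : IsArclength a r G v q l Θ) (s : ℝ) :
    geodesicCurvature (profile a r) (graphCurve G v Θ) s = -h := by
  have hf := profile_pos hr hra (G (v (Θ s)))
  have hS2 := sine_sq (Θ := Θ) hv s
  simp only [geodesicCurvature, covariantAccel, unitNormal, metric]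
  rw [deriv_graphCurve hΘ, (hasDerivAt_deriv_graphCurve hr hra hv hΘ s).deriv]
  simp only [graphCurve]
  rw [(hasDerivAt_profile hr (G (v (Θ s)))).deriv]
  simp only [angle'', height'', sine']
  generalize sine a r G v q Θ s = S at hS2 ⊢
  generalize profile a r (G (v (Θ s))) = f at hf hS2 ⊢
  have : q (Θ s) ^ 2 = (1 - S ^ 2) / f ^ 2 := by
    rw [hS2]; field_simp; ring
  field_simp
  ring_nf
  simp only [this, pow_succ]
  field_simp
  ring

/-- The curve of a critical, nonconstant loop without equilibria is of unduloid type. -/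
theorem isUnduloidType_graphCurve (hr : 0 < r) (hra : r < a)
    (hv : IsCritical (radius a r G) (radius₁ a r G) v v' q h 0 0)
    (hΘ : IsArclength a r G v q l Θ)
    (hne : ∀ θ, q θ = 0 → force (radius a r G) (radius₁ a r G) (v θ) (q θ) + h ≠ 0) :
    IsUnduloidType (profile a r) (graphCurve G v Θ) := by
  refine ⟨contDiff_graphCurve hr hra hv hΘ, isUnitSpeed_graphCurve hr hra hv hΘ,
    ⟨-h, geodesicCurvature_graphCurve hr hra hv hΘ⟩, ?_⟩
  have hq : ∀ s, profile a r (G (v (Θ s))) * q (Θ s) = 0 → q (Θ s) = 0 := fun s =>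
    (mul_eq_zero_iff_left (profile_pos hr hra _).ne').1
  have hs1 : ∀ s, q (Θ s) = 0 → sine a r G v q Θ s = 1 := fun s e => by
    rw [sine, e]; norm_num
  -- The height is critical exactly where `q = 0`. There its second derivative is `force + h`,
  -- nonzero by hypothesis, and `sin σ` is a positive root equal to 1: hence the value is 1, not -1,
  -- at both critical points.
  obtain ⟨s₀, s₁, h01, hmax, hcrit, h0, h1⟩ := exists_max_next_critical hΘ.pos
    hΘ.hasDerivAt_height (hasDerivAt_height' hr hra hv hΘ)
    (fun s => by simp only [hΘ.add_period, hv.isLoop.periodic (Θ s)])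
    (fun s e e' => hne (Θ s) (hq s e) (by
      rw [← e', height'', hs1 s (hq s e), force, hq s e, radius₁]
      norm_num [div_eq_mul_inv, radius]))
  refine ⟨s₀, s₁, h01, hmax, fun s hs => ?_, ?_, ?_, ?_⟩
  · exact ((hΘ.hasDerivAt_height s).deriv.trans_ne (hcrit s hs))
  · exact (hΘ.hasDerivAt_height s₁).deriv.trans h1
  · rw [sinAngle_graphCurve hr hra hΘ, hs1 _ (hq _ h0)]
  · rw [sinAngle_graphCurve hr hra hΘ, hs1 _ (hq _ h1)]

/-- The angle alone separates the points within one period, so the identification of heights modulo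
`2 t₀` plays no role. -/
theorem isClosedEmbedded_graphCurve (hv : IsLoop v v') (hΘ : IsArclength a r G v q l Θ)
    (t₀ : ℝ) : IsClosedEmbedded t₀ l (graphCurve G v Θ) := by
  refine ⟨hΘ.pos, fun s => ?_, fun s s' e => ?_⟩
  · simp only [graphCurve, hΘ.add_period, hv.periodic (Θ s), Prod.mk_add_mk, add_zero]
  · have h1 : ((Θ s : ℝ) : AddCircle (2 * π)) = (Θ s' : ℝ) := congrArg Prod.fst e
    obtain ⟨k, hk⟩ := AddSubgroup.mem_zmultiples_iff.1 (QuotientAddGroup.eq.1 h1)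
    refine ⟨k, hΘ.injective ?_⟩
    -- Periodicity of this difference yields `Θ (s + k l) = Θ s + 2πk` for all integers `k`.
    have hp : Function.Periodic (fun s => Θ s - s * (2 * π / l)) l := fun s => by
      have := hΘ.pos.ne'
      simp only [hΘ.add_period]
      field_simp
      ring
    have := hp.int_mul k s
    simp only [zsmul_eq_mul] at hk this
    have hl := hΘ.pos.ne'
    field_simp at this
    refine mul_left_cancel₀ hl ?_
    linear_combination -this - l * hk

end geometry

/-! ### Stability under area preserving variations -/

section stability

variable {a r : ℝ} {G v v' q : ℝ → ℝ} {h l : ℝ} {Θ : ℝ → ℝ}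

/-- A closed curve along which the angle increases is the graph of a loop. -/
theorem exists_isLoop_of_closesUp (hr : 0 < r) (hra : r < a) (hG : IsHeight a r G)
    {c c' : ℝ → ℝ × ℝ} (hc : ∀ s, HasDerivAt c (c' s) s) (cc : Continuous c')
    (hcl : ClosesUp l c) (hpos : ∀ s, 0 < (c' s).1) :
    ∃ w w' : ℝ → ℝ, IsLoop w w' ∧ length (profile a r) l c = energy (radius a r G) w w' ∧
      enclosedArea (profile a r) l c = ∫ θ in (0:ℝ)..2 * π, w θ ∧
      ∀ θ, ∃ s, (c s).1 = θ ∧ w θ = primitive a r (c s).2 ∧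
        w' θ = profile a r (c s).2 * (c' s).2 / (c' s).1 := by
  have hg := isRadius_radius hr hra hG
  have hx : ∀ s, HasDerivAt (fun s => (c s).1) (c' s).1 s := fun s => (hc s).fst
  have hy : ∀ s, HasDerivAt (fun s => (c s).2) (c' s).2 s := fun s => (hc s).snd
  have cy : Continuous fun s => (c s).2 := continuous_iff_continuousAt.2 fun s => (hy s).continuousAt
  have hxl : ∀ s, (c (s + l)).1 = (c s).1 + 2 * π := fun s => by rw [hcl s]; rfl
  have hyl : ∀ s, (c (s + l)).2 = (c s).2 := fun s => by rw [hcl s]; exact add_zero _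
  obtain ⟨Ψ, h1, h2, h3, h4⟩ := exists_inverse hx hpos two_pi_pos hxl
  have cΨ : Continuous Ψ := continuous_iff_continuousAt.2 fun s => (h3 s).continuousAt
  set w : ℝ → ℝ := fun θ => primitive a r (c (Ψ θ)).2 with hw
  set w' : ℝ → ℝ := fun θ => profile a r (c (Ψ θ)).2 * (c' (Ψ θ)).2 / (c' (Ψ θ)).1 with hw'
  have hloop : IsLoop w w' := by
    refine ⟨fun θ => ?_, ?_, fun θ => ?_⟩
    · refine ((hasDerivAt_primitive hr _).comp θ ((hy _).comp θ (h3 θ))).congr_deriv ?_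
      simp only [hw', div_eq_mul_inv, mul_assoc, Function.comp_apply]
    · exact (((continuous_profile a r).comp (cy.comp cΨ)).mul (cc.comp cΨ).snd).div
        (cc.comp cΨ).fst fun θ => (hpos _).ne'
    · simp only [hw, h4, hyl]
  -- Substituting the angle turns an integral over the parameter period into one over `[0, 2π]`,
  -- whatever the starting angle, by periodicity.
  have change : ∀ φ : ℝ → ℝ, Continuous φ → Function.Periodic φ (2 * π) →
      ∫ s in (0:ℝ)..l, φ (c s).1 * (c' s).1 = ∫ θ in (0:ℝ)..2 * π, φ θ := by
    intro φ cφ hφ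
    have := intervalIntegral.integral_comp_mul_deriv (a := 0) (b := l) (g := φ)
      (fun s _ => hx s) cc.fst.continuousOn cφ
    simp only [Function.comp_apply] at this
    rw [this, show (c l).1 = (c 0).1 + 2 * π by rw [← hxl 0, zero_add],
      hφ.intervalIntegral_add_eq _ 0, zero_add]
  have hderiv : deriv c = c' := funext fun s => (hc s).deriv
  refine ⟨w, w', hloop, ?_, ?_, fun θ => ⟨Ψ θ, h2 θ, rfl, rfl⟩⟩
  · rw [energy, ← change _ (hloop.continuous_lengthDensity hg) (hloop.periodic_lengthDensity _),
      length]
    refine intervalIntegral.integral_congr fun s _ => ?_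
    have hf := profile_pos hr hra (c s).2
    have hp := hpos s
    simp only [hderiv, metric, lengthDensity, hw, hw', h1, radius, hG.left]
    rw [mul_comm (√_), show ∀ x, (c' s).1 * √x = √((c' s).1 ^ 2 * x) from fun x => by
      rw [sqrt_mul (sq_nonneg _), sqrt_sq hp.le]]
    congr 1
    field_simp
  · rw [← change w hloop.continuous hloop.periodic, enclosedArea]
    refine intervalIntegral.integral_congr fun s _ => ?_
    simp only [hderiv, hw, h1, integral_profile hr]

/-- A curve whose loop minimizes the length among nearby loops with the same mean is stable. -/
theorem isStable_graphCurve (hr : 0 < r) (hra : r < a) (hG : IsHeight a r G)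
    (hv : IsCritical (radius a r G) (radius₁ a r G) v v' q h 0 0)
    (hΘ : IsArclength a r G v q l Θ) {ρ : ℝ} (hρ : 0 < ρ)
    (hmin : ∀ w w', IsLoop w w' → ∫ θ in (0:ℝ)..2 * π, w θ = ∫ θ in (0:ℝ)..2 * π, v θ →
      (∀ θ, |w θ - v θ| ≤ ρ ∧ |w' θ - v' θ| ≤ ρ) →
      energy (radius a r G) v v' ≤ energy (radius a r G) w w') :
    IsStable (profile a r) l (graphCurve G v Θ) := by
  intro V hV
  set W : ℝ → ℝ → ℝ × ℝ := fun τ s => fderiv ℝ (fun p : ℝ × ℝ => V p.1 p.2) (τ, s) (0, 1) with hWdef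
  have hVd : ∀ τ s, HasDerivAt (V τ) (W τ s) s := fun τ s =>
    ((hV.contDiff.differentiable (by norm_num) (τ, s)).hasFDerivAt.comp_hasDerivAt s
      ((hasDerivAt_const s τ).prodMk (hasDerivAt_id s)))
  have cV : Continuous fun p : ℝ × ℝ => V p.1 p.2 := hV.contDiff.continuous
  have cW : Continuous fun p : ℝ × ℝ => W p.1 p.2 :=
    (hV.contDiff.continuous_fderiv (by norm_num)).clm_apply continuous_const
  have hWper : ∀ τ, Function.Periodic (W τ) l := fun τ s => by
    have h1 := (hVd τ (s + l)).comp_add_const s l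
    rw [show (fun x => V τ (x + l)) = fun x => V τ x + (2 * π, 0) from
      funext (hV.closesUp τ)] at h1
    exact h1.unique ((hVd τ s).add_const _)
  have hW0 : ∀ s, W 0 s = (sine a r G v q Θ s / profile a r (G (v (Θ s))),
      profile a r (G (v (Θ s))) * q (Θ s)) := fun s => by
    have := hVd 0 s
    rw [hV.start] at this
    exact this.unique (hasDerivAt_graphCurve hΘ s)
  have hpos0 : ∀ s, 0 < (W 0 s).1 := fun s => by
    rw [hW0]; exact div_pos (sine_pos hv s) (profile_pos hr hra _)
  -- At `τ = 0` the angle increases and both differences vanish. By joint continuity and compactness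
  -- of `[0, l]` the strict inequalities persist for small `τ`, uniformly in `s`.
  have near : ∀ᶠ τ in 𝓝 (0:ℝ), ∀ s ∈ Icc 0 l, 0 < (W τ s).1 ∧
      |primitive a r (V τ s).2 - v (V τ s).1| < ρ ∧
      |profile a r (V τ s).2 * (W τ s).2 / (W τ s).1 - v' (V τ s).1| < ρ := by
    refine isCompact_Icc.eventually_forall_of_forall_eventually fun s _ => ?_
    have e1 : (V 0 s) = (Θ s, G (v (Θ s))) := congrFun hV.start s
    have cF : Continuous (primitive a r) :=
      continuous_iff_continuousAt.2 fun t => (hasDerivAt_primitive hr t).continuousAt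
    refine ((cW.fst.tendsto (0, s)).eventually_const_lt (hpos0 s)).and
      (((((cF.comp cV.snd).sub (hv.isLoop.continuous.comp cV.fst)).abs.tendsto
        (0, s)).eventually_lt_const ?_).and
      (ContinuousAt.eventually_lt (f := fun p : ℝ × ℝ =>
        |profile a r (V p.1 p.2).2 * (W p.1 p.2).2 / (W p.1 p.2).1 - v' (V p.1 p.2).1|)
        (g := fun _ => ρ) ?_ continuousAt_const ?_))
    · change |primitive a r (V 0 s).2 - v (V 0 s).1| < ρ
      rw [e1, hG.right, sub_self, abs_zero]
      exact hρ
    · exact (((((continuous_profile a r).comp cV.snd).mul cW.snd).continuousAt.div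
        cW.fst.continuousAt (hpos0 s).ne').sub
        (hv.isLoop.continuous_deriv.comp cV.fst).continuousAt).abs
    · have hS := sine_pos (Θ := Θ) hv s
      have hf := profile_pos hr hra (G (v (Θ s)))
      have : v' (Θ s) = profile a r (G (v (Θ s))) ^ 3 * q (Θ s) / sine a r G v q Θ s :=
        hv.velocity _
      have e2 : profile a r (G (v (Θ s))) * (profile a r (G (v (Θ s))) * q (Θ s))
          / (sine a r G v q Θ s / profile a r (G (v (Θ s)))) - v' (Θ s) = 0 := by
        rw [this]
        field_simp
        ring
      simp only [e1, hW0, e2, abs_zero, hρ]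
  have all : ∀ᶠ τ in 𝓝 (0:ℝ), ∀ s, 0 < (W τ s).1 ∧
      |primitive a r (V τ s).2 - v (V τ s).1| < ρ ∧
      |profile a r (V τ s).2 * (W τ s).2 / (W τ s).1 - v' (V τ s).1| < ρ := by
    filter_upwards [near] with τ hτ s
    have hp : Function.Periodic (fun s => (W τ s, (V τ s).2, v (V τ s).1, v' (V τ s).1)) l :=
      fun s => by
        simp only [hWper τ s, hV.closesUp τ s, Prod.fst_add, Prod.snd_add, add_zero,
          hv.isLoop.periodic _, hv.isLoop.periodic_deriv _]
    obtain ⟨s', hs', e⟩ := hp.exists_mem_Ico₀ hΘ.pos s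
    simp only [Prod.mk.injEq] at e
    rw [e.1, e.2.1, e.2.2.1, e.2.2.2]
    exact hτ s' (Ico_subset_Icc_self hs')
  have loops := fun τ (hτ : ∀ s, 0 < (W τ s).1) => exists_isLoop_of_closesUp hr hra hG (hVd τ)
    (cW.comp (continuous_const.prodMk continuous_id)) (hV.closesUp τ) hτ
  -- At `τ = 0` the loop is `v` itself, so the length and area of `graphCurve` are the energy and
  -- the integral of `v`.
  obtain ⟨w₀, w₀', hw₀, hlen₀, harea₀, hpt₀⟩ := loops 0 hpos0
  have e₀ : w₀ = v := funext fun θ => by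
    obtain ⟨s, rfl, e, -⟩ := hpt₀ θ
    rw [e, hV.start]
    exact hG.right _
  have e₀' : w₀' = v' := funext fun θ => (hw₀.hasDerivAt θ).unique (e₀ ▸ hv.isLoop.hasDerivAt θ)
  rw [hV.start, e₀, e₀'] at hlen₀
  rw [hV.start, e₀] at harea₀
  filter_upwards [all, hV.area] with τ hτ harea
  obtain ⟨w, w', hw, hlen, harea', hpt⟩ := loops τ fun s => (hτ s).1
  rw [hlen₀, hlen]
  refine hmin w w' hw (by rw [← harea', harea, harea₀]) fun θ => ?_
  obtain ⟨s, rfl, e, e'⟩ := hpt θ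
  rw [e, e']
  exact ⟨(hτ s).2.1.le, (hτ s).2.2.le⟩

end stability

/-! ### Conclusion -/

theorem deriv_sq_sub_profile_mul {a r : ℝ} (hr : 0 < r) (t : ℝ) :
    deriv (profile a r) t ^ 2 - profile a r t * deriv (deriv (profile a r)) t
      = 1 + a / r * cos (t / r) := by
  have h1 : deriv (profile a r) = fun t => -sin (t / r) :=
    funext fun t => (hasDerivAt_profile hr t).deriv
  rw [h1, (hasDerivAt_sin_div (r := r) t).fun_neg.deriv]
  have := sin_sq_add_cos_sq (t / r)
  unfold profile
  field_simp
  linear_combination r * this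

/-- Otherwise `cos (t/r)` would have a local maximum at its zero `t₁`, where its derivative is not
zero. This provides unstable parallels arbitrarily close to the critical one. -/
theorem exists_cos_pos_near {r t₁ : ℝ} (hr : 0 < r) (hc : cos (t₁ / r) = 0) {U : Set ℝ}
    (hU : U ∈ 𝓝 t₁) : ∃ t ∈ U, 0 < cos (t / r) := by
  by_contra! H
  have hmax : IsLocalMax (fun t => cos (t / r)) t₁ := by
    filter_upwards [hU] with t ht
    rw [hc]
    exact H t ht
  have h0 := hmax.hasDerivAt_eq_zero (hasDerivAt_cos_div (r := r) t₁)
  have h1 := sin_sq_add_cos_sq (t₁ / r)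
  have : sin (t₁ / r) = 0 := by simpa [hr.ne'] using h0
  rw [hc, this] at h1
  norm_num at h1

/-- Near every `t₁` with `cos (t₁ / r) = 0` there are stable embedded unduloid type curves. -/
theorem exists_stable_unduloid {a r t₁ ε : ℝ} (hr : 0 < r) (hra : r < a) (har : a < 3 * r)
    (hc : cos (t₁ / r) = 0) (hε : 0 < ε) : ∃ (l : ℝ) (γ : ℝ → ℝ × ℝ),
      IsUnduloidType (profile a r) γ ∧ IsClosedEmbedded (π * r) l γ ∧ IsStable (profile a r) l γ ∧
        ∀ s, |(γ s).2 - t₁| < ε := by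
  have ha := hr.trans hra
  obtain ⟨G, hG⟩ := exists_isHeight hr hra
  have hg := isRadius_radius hr hra hG
  set m₀ := primitive a r t₁ with hm₀
  have hGm : G m₀ = t₁ := hG.left t₁
  have hcG : cos (G m₀ / r) = 0 := by rw [hGm, hc]
  have hκ₂ : radius₂ a r G m₀ = -(radius a r G m₀ ^ 3)⁻¹ := by
    have := radius₂_add (G := G) hr hra m₀
    rw [hcG, mul_zero, zero_div, neg_zero] at this
    linarith
  obtain ⟨ρ₄, hρ₄, k, hk, hquartic⟩ := energy_ge_quartic hg
    (hasDerivAt_radius₂ hr hra hG) (hasDerivAt_radius₃ hr hra hG)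
    (differentiableAt_radius₄ hr hra hG m₀).hasDerivAt rfl hκ₂ rfl rfl rfl rfl rfl
    (quartic_condition hr hra har hcG)
  obtain ⟨ρ₀, hρ₀, heq⟩ := deriv_eq_zero_of_equilibrium hg m₀
  have hunst : ∀ η > 0, ∃ m, |m - m₀| ≤ η ∧
      radius₂ a r G m + (radius a r G m ^ 3)⁻¹ < 0 := by
    intro η hη
    obtain ⟨t, ht, htc⟩ := exists_cos_pos_near hr hc
      ((hasDerivAt_primitive hr t₁).continuousAt (Metric.closedBall_mem_nhds m₀ hη))
    refine ⟨primitive a r t, ht, ?_⟩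
    rw [radius₂_add hr hra, hG.left]
    have := profile_pos hr hra t
    exact neg_neg_of_pos (by positivity)
  obtain ⟨δ, hδ, hδε⟩ := Metric.eventually_nhds_iff.1
    ((hG.hasDerivAt m₀).continuousAt (Metric.ball_mem_nhds _ hε))
  obtain ⟨v, v', q, h, hv, hb, ⟨θ₁, hne⟩, ρ, hρ, hmin⟩ := exists_local_minimizer hg
    (hasDerivAt_radius₂ hr hra hG) (by rw [hκ₂, one_div]) hk hρ₄
    hquartic hunst (lt_min hρ₀ (half_pos hδ))
  obtain ⟨l, Θ, hΘ⟩ := exists_isArclength hr hra hG hv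
  refine ⟨l, graphCurve G v Θ,
    isUnduloidType_graphCurve hr hra hv hΘ fun θ hq hF => ?_,
    isClosedEmbedded_graphCurve hv.isLoop hΘ _,
    isStable_graphCurve hr hra hG hv hΘ hρ hmin, fun s => ?_⟩
  -- An equilibrium on the loop would make it constant, against `hne`.
  · exact hne (heq v v' q h θ hv (fun θ => ⟨(hb θ).1.trans (min_le_left _ _),
      (hb θ).2.2.trans (min_le_left _ _)⟩) hq hF θ₁)
  · have := hδε (y := v (Θ s)) (by
      rw [Real.dist_eq]
      linarith [(hb (Θ s)).1, min_le_right ρ₀ (δ / 2)])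
    rwa [hGm, Metric.mem_ball, Real.dist_eq] at this

end TorusUnduloid

theorem mainTheorem3 (a r : ℝ) (hra : r < a) (har : a < 3 * r) :
    (∃ t₁ ∈ Set.Ioo 0 (Real.pi * r),
      (deriv (TorusUnduloid.profile a r) t₁) ^ 2
        - TorusUnduloid.profile a r t₁ * deriv (deriv (TorusUnduloid.profile a r)) t₁ = 1) ∧
    ∀ t₁ ∈ Set.Icc (-(Real.pi * r)) (Real.pi * r),
      (deriv (TorusUnduloid.profile a r) t₁) ^ 2
        - TorusUnduloid.profile a r t₁ * deriv (deriv (TorusUnduloid.profile a r)) t₁ = 1 →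
      ∀ ε > 0, ∃ (l : ℝ) (γ : ℝ → ℝ × ℝ),
        TorusUnduloid.IsUnduloidType (TorusUnduloid.profile a r) γ ∧
        TorusUnduloid.IsClosedEmbedded (Real.pi * r) l γ ∧
        TorusUnduloid.IsStable (TorusUnduloid.profile a r) l γ ∧
        ∀ s, |(γ s).2 - t₁| < ε := by
  have hr : 0 < r := by linarith
  have ha := hr.trans hra
  have hπ := pi_pos
  refine ⟨⟨π * r / 2, ⟨by positivity, by linarith [mul_pos hπ hr]⟩, ?_⟩, fun t₁ _ ht₁ ε hε =>
    TorusUnduloid.exists_stable_unduloid hr hra har ?_ hε⟩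
  · rw [TorusUnduloid.deriv_sq_sub_profile_mul hr, show π * r / 2 / r = π / 2 by field_simp,
      cos_pi_div_two, mul_zero, add_zero]
  · rw [TorusUnduloid.deriv_sq_sub_profile_mul hr] at ht₁
    have : a / r * cos (t₁ / r) = 0 := by linarith
    exact (mul_eq_zero_iff_left (by positivity)).1 this
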